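/- All Hilbert spaces are finite dimensional, $\log$ is to base $2$, $|A|=\dim A$, and $\|M\|_1=\mathrm{Tr}\sqrt{M^\dagger M}$, $\|M\|_2=(\mathrm{Tr}\,M^\dagger M)^{1/2}$. For positive semidefinite $\alpha,\beta$ on the same space let $D_2(\alpha\|\beta):=2\log\|\beta^{-1/4}\alpha\beta^{-1/4}\|_2$ if $\mathrm{supp}(\alpha)\subseteq\mathrm{supp}(\beta)$ (negative powers in the sense of the Moore–Penrose pseudoinverse) and $D_2(\alpha\|\beta):=+\infty$ otherwise. For $0<\epsilon<1$ let $D_2^\epsilon(\alpha\|\beta):=\min_{\alpha'}D_2(\alpha'\|\beta)$, the minimum being over all positive semidefinite $\alpha'$ with $\mathrm{Tr}\,\alpha'\le 1$ and $\|\alpha'-\alpha\|_1\le\epsilon\,\mathrm{Tr}\,\alpha$. For a state $\rho^{AR}$ put $H_2^\epsilon(A|R)_\rho:=-D_2^\epsilon(\rho^{AR}\|1^A\otimes\rho^R)$ and $H_2^\epsilon(A)_\rho:=-D_2^\epsilon(\rho^A\|1^A)$. Let $\mathcal N^{A'B'\to C}$ be a quantum multiple access channel (a completely positive trace preserving map)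 from senders Alice (input $A'$) and Bob (input $B'$) to the receiver Charlie (output $C$). Let $Q_A,E_A,Q_B,E_B$ be non-negative integers. Alice and Charlie share $E_A$ EPR pairs, Bob and Charlie share $E_B$ EPR pairs; Alice holds one half of $Q_A$ further EPR pairs and Bob one half of $Q_B$ further EPR pairs, as quantum messages, the other halves being held by two reference systems. Alice applies an encoding isometry from her message and her halves of the shared entanglement into $A'$; Bob does the same into $B'$; the channel $\mathcal N$ is applied once; and Charlie applies a decoding quantum channel to $C$ and his halves of the shared entanglement, with output registers of $Q_A$ and $Q_B$ qubits. The quadruple $(Q_A,E_A,Q_B,E_B)$ is $\delta$-achievable for $\mathcal N$ if encoders and a decoder exist for which the final joint state of Charlie's output registers and the two references differs from $Q_A+Q_B$ EPR pairs by at most $\delta$ in $\|\cdot\|_1$. Theorem. Let $0<\epsilon<1$. Let $\Omega^{AA'}$ and $\Delta^{BB'}$ be pure states, where $|A|=|A'|$ and $|B|=|B'|$, let $U_{\mathcal N}^{A'B'\to CE}$ be an isometric Stinespring dilation of $\mathcal N$, and let $$\omega^{ABCE}:=(U_{\mathcal N}\otimes 1^{AB})(\Omega^{AA'}\otimes\Delta^{BB'})(U_{\mathcal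 N}\otimes 1^{AB})^\dagger .$$ Suppose that $2^{Q_A+E_A}\le|A'|$ and $2^{Q_B+E_B}\le|B'|$ (so that encoding isometries exist; for $\epsilon^2+\epsilon\le 1$ this already follows from the last two inequalities below) and that $$\begin{aligned} Q_A-E_A+Q_B-E_B&<H_2^\epsilon(AB|E)_\omega-\log\epsilon^{-4},\\ Q_A-E_A&<H_2^\epsilon(A|E)_\omega-\log\epsilon^{-4},\\ Q_B-E_B&<H_2^\epsilon(B|E)_\omega-\log\epsilon^{-4},\\ Q_A+E_A&<H_2^\epsilon(A)_\omega-\log\epsilon^{-4},\\ Q_B+E_B&<H_2^\epsilon(B)_\omega-\log\epsilon^{-4}. \end{aligned}$$ Then $(Q_A,E_A,Q_B,E_B)$ is $(29\epsilon)$-achievable for $\mathcal N$. -/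

import Mathlib

open scoped Kronecker Matrix ComplexOrder

namespace QMAC

noncomputable section

/-! Finite-dimensional Hilbert spaces are given by finite index types of orthonormal bases; operators
are complex matrices, and tensor products are indexed by product types. -/

/-- Computational basis of `n` qubits. -/
abbrev Qubits (n : ℕ) : Type := Fin n → Fin 2

section States

variable {ι κ : Type*}

/-- The rank one operator `|ψ⟩⟨ψ|`. -/
def ketbra (ψ : ι → ℂ) : Matrix ι ι ℂ := Matrix.vecMulVec ψ (star ψ)

/-- Unit vectors (pure states). -/
def IsUnitKet [Fintype ι] (ψ : ι → ℂ) : Prop := ∑ i, ‖ψ i‖ ^ 2 = 1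

/-- Positive semidefinite matrices of trace at most one. -/
def IsSubnormalised [Fintype ι] (ρ : Matrix ι ι ℂ) : Prop :=
  ρ.PosSemidef ∧ ρ.trace.re ≤ 1

/-- Partial trace over the second tensor factor. -/
def traceSnd [Fintype κ] (ρ : Matrix (ι × κ) (ι × κ) ℂ) : Matrix ι ι ℂ :=
  fun i j => ∑ k, ρ (i, k) (j, k)

/-- Partial trace over the first tensor factor. -/
def traceFst [Fintype ι] (ρ : Matrix (ι × κ) (ι × κ) ℂ) : Matrix κ κ ℂ :=
  fun k l => ∑ i, ρ (i, k) (i, l)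

/-- The ket of the maximally entangled state on two copies of `ι`. For `ι = Qubits n` this is the
tensor product of `n` EPR pairs. -/
def epr [Fintype ι] [DecidableEq ι] (p : ι × ι) : ℂ :=
  if p.1 = p.2 then ((√(Fintype.card ι : ℝ))⁻¹ : ℝ) else 0

end States

section Norms

variable {ι : Type*} [Fintype ι] [DecidableEq ι]

/-- The Schatten 1-norm `Tr √(MᴴM)`, i.e. the sum of the singular values of `M`. -/
def traceNorm (M : Matrix ι ι ℂ) : ℝ :=
  ∑ i, √((Matrix.isHermitian_conjTranspose_mul_self M).eigenvalues i)

/-- The Schatten 2-norm `(Tr MᴴM)^(1/2)`. -/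
def schattenTwo (M : Matrix ι ι ℂ) : ℝ := √((Mᴴ * M).trace.re)

/-- `β^(-1/4)` for positive semidefinite `β`, in the sense of the Moore-Penrose pseudoinverse:
the real power `0 ^ (-1/4)` is `0`, so the operator vanishes on the kernel of `β`. -/
def pinvFourthRoot (β : Matrix ι ι ℂ) : Matrix ι ι ℂ :=
  cfc (fun x : ℝ => x ^ (-(1 / 4) : ℝ)) β

/-- The support of a Hermitian matrix: the span of the eigenvectors with non-zero eigenvalue,
which is the range. -/
def support (M : Matrix ι ι ℂ) : Submodule ℂ (ι → ℂ) := LinearMap.range M.mulVecLin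

open Classical in
/-- The Rényi-2 divergence
`D₂(α‖β) = 2 log₂ ‖β^(-1/4) α β^(-1/4)‖₂` if `supp α ≤ supp β`, and `+∞` otherwise
(with `log₂ 0 = -∞`). -/
def renyiTwoDiv (α β : Matrix ι ι ℂ) : EReal :=
  if support α ≤ support β then
    if schattenTwo (pinvFourthRoot β * α * pinvFourthRoot β) = 0 then ⊥
    else ((2 * Real.logb 2 (schattenTwo (pinvFourthRoot β * α * pinvFourthRoot β)) : ℝ) : EReal)
  else ⊤

/-- The smooth Rényi-2 divergence: the least value of `D₂(α'‖β)` over the subnormalised `α'` with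
`‖α' - α‖₁ ≤ ε Tr α`. -/
def smoothRenyiTwoDiv (ε : ℝ) (α β : Matrix ι ι ℂ) : EReal :=
  ⨅ (α' : Matrix ι ι ℂ) (_ : IsSubnormalised α')
    (_ : traceNorm (α' - α) ≤ ε * α.trace.re), renyiTwoDiv α' β

/-- `H₂^ε(A)_ρ = -D₂^ε(ρ^A ‖ 1^A)`. -/
def smoothH2 (ε : ℝ) (ρ : Matrix ι ι ℂ) : EReal := -smoothRenyiTwoDiv ε ρ 1

/-- `H₂^ε(A|R)_ρ = -D₂^ε(ρ^{AR} ‖ 1^A ⊗ ρ^R)`. -/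
def smoothCondH2 {κ : Type*} [Fintype κ] [DecidableEq κ] (ε : ℝ)
    (ρ : Matrix (ι × κ) (ι × κ) ℂ) : EReal :=
  -smoothRenyiTwoDiv ε ρ ((1 : Matrix ι ι ℂ) ⊗ₖ traceFst ρ)

end Norms

section Channels

variable {ι κ : Type*}

/-- The superoperator `N ⊗ id` acting on `ι ⊗ μ`. -/
def tensorId (N : Matrix ι ι ℂ →ₗ[ℂ] Matrix κ κ ℂ) {μ : Type*}
    (X : Matrix (ι × μ) (ι × μ) ℂ) : Matrix (κ × μ) (κ × μ) ℂ :=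
  fun p q => N (fun i j => X (i, p.2) (j, q.2)) p.1 q.1

/-- Quantum channels: completely positive trace preserving superoperators. -/
def IsChannel [Fintype ι] [Fintype κ] (N : Matrix ι ι ℂ →ₗ[ℂ] Matrix κ κ ℂ) : Prop :=
  (∀ (n : ℕ) (X : Matrix (ι × Fin n) (ι × Fin n) ℂ), X.PosSemidef → (tensorId N X).PosSemidef) ∧
    ∀ X, (N X).trace = X.trace

/-- Isometries, as matrices. -/
def IsIsometry [Fintype κ] [DecidableEq ι] (V : Matrix κ ι ℂ) : Prop := Vᴴ * V = 1

/-- `U : ι → κ ⊗ E` is an isometric Stinespring dilation of `N`. -/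
def IsStinespring {η : Type*} [Fintype ι] [Fintype κ] [Fintype η] [DecidableEq ι]
    (N : Matrix ι ι ℂ →ₗ[ℂ] Matrix κ κ ℂ) (U : Matrix (κ × η) ι ℂ) : Prop :=
  IsIsometry U ∧ ∀ X, N X = traceSnd (U * X * Uᴴ)

end Channels

section Control

variable {a b c e : Type*} [Fintype a] [Fintype b]

/-- The ket of the control state `ω^{ABCE} = (U ⊗ 1^{AB}) (Ω^{AA'} ⊗ Δ^{BB'})`, with the registers
in the order `((A, B), E), C`. -/
def controlKet (U : Matrix (c × e) (a × b) ℂ) (Ω : a × a → ℂ) (Δ : b × b → ℂ) :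
    ((a × b) × e) × c → ℂ :=
  fun p => ∑ x : a, ∑ y : b, U (p.2, p.1.2) (x, y) * (Ω (p.1.1.1, x) * Δ (p.1.1.2, y))

variable [Fintype c] [Fintype e]

/-- The marginal `ω^{ABE}`. -/
def controlABE (U : Matrix (c × e) (a × b) ℂ) (Ω : a × a → ℂ) (Δ : b × b → ℂ) :
    Matrix ((a × b) × e) ((a × b) × e) ℂ :=
  traceSnd (ketbra (controlKet U Ω Δ))

/-- The marginal `ω^{AE}`. -/
def controlAE (U : Matrix (c × e) (a × b) ℂ) (Ω : a × a → ℂ) (Δ : b × b → ℂ) :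
    Matrix (a × e) (a × e) ℂ :=
  traceSnd ((controlABE U Ω Δ).submatrix
    (fun p : (a × e) × b => ((p.1.1, p.2), p.1.2)) (fun p => ((p.1.1, p.2), p.1.2)))

/-- The marginal `ω^{BE}`. -/
def controlBE (U : Matrix (c × e) (a × b) ℂ) (Ω : a × a → ℂ) (Δ : b × b → ℂ) :
    Matrix (b × e) (b × e) ℂ :=
  traceSnd ((controlABE U Ω Δ).submatrix
    (fun p : (b × e) × a => ((p.2, p.1.1), p.1.2)) (fun p => ((p.2, p.1.1), p.1.2)))

/-- The marginal `ω^A`. -/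
def controlA (U : Matrix (c × e) (a × b) ℂ) (Ω : a × a → ℂ) (Δ : b × b → ℂ) : Matrix a a ℂ :=
  traceSnd (controlAE U Ω Δ)

/-- The marginal `ω^B`. -/
def controlB (U : Matrix (c × e) (a × b) ℂ) (Ω : a × a → ℂ) (Δ : b × b → ℂ) : Matrix b b ℂ :=
  traceSnd (controlBE U Ω Δ)

end Control

section Protocol

variable {a b c : Type*}

/-- The state after one sender has applied the encoder `V` to the message halves of `Q` EPR pairs
(whose other halves form the reference) and to the sender's halves of `E` EPR pairs shared with the
receiver. Registers: reference, receiver's half of the assistance, channel input. -/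
def encodedKet {Q E : ℕ} (V : Matrix a (Qubits Q × Qubits E) ℂ) :
    (Qubits Q × Qubits E) × a → ℂ :=
  fun p => ∑ m : Qubits Q, ∑ f : Qubits E, V p.2 (m, f) * (epr (p.1.1, m) * epr (p.1.2, f))

/-- The joint state of both senders' registers, in the order
`(Alice's input, Bob's input), (receiver's assistance halves), (references)`. -/
def inputState {QA EA QB EB : ℕ} (VA : Matrix a (Qubits QA × Qubits EA) ℂ)
    (VB : Matrix b (Qubits QB × Qubits EB) ℂ) :
    Matrix ((a × b) × ((Qubits EA × Qubits EB) × (Qubits QA × Qubits QB)))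
      ((a × b) × ((Qubits EA × Qubits EB) × (Qubits QA × Qubits QB))) ℂ :=
  ketbra fun p =>
    encodedKet VA ((p.2.2.1, p.2.1.1), p.1.1) * encodedKet VB ((p.2.2.2, p.2.1.2), p.1.2)

/-- The joint state of the receiver's decoded registers and the two references, after the channel
has acted on the inputs and the decoder `D` has acted on the channel output and the receiver's
halves of the assistance. -/
def outputState {QA EA QB EB : ℕ} (N : Matrix (a × b) (a × b) ℂ →ₗ[ℂ] Matrix c c ℂ)
    (VA : Matrix a (Qubits QA × Qubits EA) ℂ) (VB : Matrix b (Qubits QB × Qubits EB) ℂ)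
    (D : Matrix (c × (Qubits EA × Qubits EB)) (c × (Qubits EA × Qubits EB)) ℂ →ₗ[ℂ]
      Matrix (Qubits QA × Qubits QB) (Qubits QA × Qubits QB) ℂ) :
    Matrix ((Qubits QA × Qubits QB) × (Qubits QA × Qubits QB))
      ((Qubits QA × Qubits QB) × (Qubits QA × Qubits QB)) ℂ :=
  tensorId D ((tensorId N (inputState VA VB)).submatrix
    (fun p => (p.1.1, (p.1.2, p.2))) (fun p => (p.1.1, (p.1.2, p.2))))

/-- `QA + QB` EPR pairs between the decoded registers and the references. -/
def targetState (QA QB : ℕ) :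
    Matrix ((Qubits QA × Qubits QB) × (Qubits QA × Qubits QB))
      ((Qubits QA × Qubits QB) × (Qubits QA × Qubits QB)) ℂ :=
  ketbra fun p => epr (p.1.1, p.2.1) * epr (p.1.2, p.2.2)

/-- The rate quadruple `(QA, EA, QB, EB)` is `δ`-achievable for quantum message transmission with
limited entanglement assistance through `N`. -/
def IsAchievable [Fintype a] [Fintype b] [Fintype c]
    (N : Matrix (a × b) (a × b) ℂ →ₗ[ℂ] Matrix c c ℂ) (δ : ℝ) (QA EA QB EB : ℕ) : Prop :=
  ∃ (VA : Matrix a (Qubits QA × Qubits EA) ℂ) (VB : Matrix b (Qubits QB × Qubits EB) ℂ)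
    (D : Matrix (c × (Qubits EA × Qubits EB)) (c × (Qubits EA × Qubits EB)) ℂ →ₗ[ℂ]
      Matrix (Qubits QA × Qubits QB) (Qubits QA × Qubits QB) ℂ),
    IsIsometry VA ∧ IsIsometry VB ∧ IsChannel D ∧
      traceNorm (outputState N VA VB D - targetState QA QB) ≤ δ

end Protocol

end

end QMAC

/-! Write ρ = ω^{ABE} and θ = ω^E. Two states are at trace distance at most 2, so only 29ε < 2 needs
an argument. There the proof is a decoupling argument, arranged so that the final error is linear in
ε and not of order √ε.

Random encoders. The encoder of a sender is the amplitude matrix of the input state times a matrix G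
of independent uniform cube roots of unity. Distinct off-diagonal products of two phases are
uncorrelated (`expect_phaseDev_mul`), so second moments are plain sums of squares. Seen from the
reference, this encoder is the random completely positive map X ↦ D⁻¹ Tr_f(G X Gᴴ), whose mean is
the completely depolarising map. The condition on Q + E makes its Gram matrix concentrate, and the
polar decomposition replaces it by a nearby isometry (`exists_isometry_family`).

Decoupling. With F the random map, F̄ its mean and δ = F − F̄, one has F_A ⊗ F_B − F̄_A ⊗ F̄_B = δ_A
⊗ δ_B + δ_A ⊗ F̄_B + F̄_A ⊗ δ_B. The three terms see only ρ^{ABE}, ρ^{AE} and ρ^{BE}, so each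
marginal may be smoothed separately and no simultaneous smoothing is required. A Cauchy–Schwarz
inequality weighted by θ^{1/4} turns second moments into trace norm bounds
(`expect_traceNorm_lift_le`). The smoothing of the input states is realised by contractions on the
references (`exists_truncation`), which commute with the weights on E. The outcome is
`expect_traceNorm_decoupling_le`.

Linear error. Decoupling followed by Uhlmann's theorem gives an overlap defect of order ε, hence in
general only a trace distance of order √ε. To do better, the code is first built with both message
spaces enlarged by the factor M = ⌈1/ε⌉. The Uhlmann decoder determines an overlap operator K ≥ 0 on
the references with Tr K² ≤ Tr K (`frobSq_overlap_le`); its mean eigenvalue t satisfies 1 − t = O(ε)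
by the Powers–Størmer inequality. The contribution of order √ε stems from the fluctuation K − t,
whose normalised squared Hilbert–Schmidt norm is at most t − t². Restricting each sender to a random
subspace of relative dimension 1/M divides this by M (`expect_compress_le`), so that the fluctuation
has norm O(ε); the other contribution 2(1 − t²) is linear already (`exists_subcode`). The constant
29 comes out of `error_bound`. -/

namespace QMAC

noncomputable section

open scoped BigOperators ComplexConjugate

set_option linter.unusedSectionVars false

/-! ### Hilbert–Schmidt norm of rectangular matrices -/

section Frobenius

variable {m n p : Type*} [Fintype m] [Fintype n] [Fintype p]

/-- The squared Frobenius norm of a rectangular matrix. -/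
def frobSq (M : Matrix m n ℂ) : ℝ := ∑ i, ∑ j, ‖M i j‖ ^ 2

/-- The Frobenius norm. -/
def frob (M : Matrix m n ℂ) : ℝ := √(frobSq M)

lemma frobSq_nonneg (M : Matrix m n ℂ) : 0 ≤ frobSq M :=
  Finset.sum_nonneg fun _ _ => Finset.sum_nonneg fun _ _ => sq_nonneg _

lemma frob_nonneg (M : Matrix m n ℂ) : 0 ≤ frob M := Real.sqrt_nonneg _

lemma sq_frob (M : Matrix m n ℂ) : frob M ^ 2 = frobSq M := Real.sq_sqrt (frobSq_nonneg M)

lemma trace_mul_conjTranspose_eq_frobSq (M : Matrix m n ℂ) :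
    (M * Mᴴ).trace = (frobSq M : ℂ) := by
  simp [frobSq, Matrix.trace, Matrix.mul_apply, Complex.mul_conj, Complex.normSq_eq_norm_sq]

lemma trace_conjTranspose_mul_eq_frobSq (M : Matrix m n ℂ) :
    (Mᴴ * M).trace = (frobSq M : ℂ) := by
  rw [Matrix.trace_mul_comm, trace_mul_conjTranspose_eq_frobSq]

lemma frobSq_conjTranspose (M : Matrix m n ℂ) : frobSq Mᴴ = frobSq M := by
  simp only [frobSq, Matrix.conjTranspose_apply, norm_star]
  exact Finset.sum_comm

lemma frobSq_smul (z : ℂ) (M : Matrix m n ℂ) : frobSq (z • M) = ‖z‖ ^ 2 * frobSq M := by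
  simp [frobSq, Finset.mul_sum, mul_pow]

lemma frob_smul (z : ℂ) (M : Matrix m n ℂ) : frob (z • M) = ‖z‖ * frob M := by
  rw [frob, frobSq_smul, Real.sqrt_mul (sq_nonneg _), Real.sqrt_sq (norm_nonneg _), frob]

lemma frobSq_neg (M : Matrix m n ℂ) : frobSq (-M) = frobSq M := by
  simp [frobSq]

/-- The Frobenius norm as a Euclidean norm. -/
lemma frob_eq_norm (M : Matrix m n ℂ) :
    frob M = ‖WithLp.toLp 2 (fun q : m × n => M q.1 q.2)‖ := by
  rw [EuclideanSpace.norm_eq, frob, frobSq, Fintype.sum_prod_type]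

lemma frob_add_le (M N : Matrix m n ℂ) : frob (M + N) ≤ frob M + frob N := by
  simp only [frob_eq_norm]
  exact norm_add_le (WithLp.toLp 2 (fun q : m × n => M q.1 q.2))
    (WithLp.toLp 2 (fun q : m × n => N q.1 q.2))

/-- Cauchy-Schwarz for the Hilbert-Schmidt inner product. -/
lemma norm_trace_mul_conjTranspose_le (M N : Matrix m n ℂ) :
    ‖(M * Nᴴ).trace‖ ≤ frob M * frob N := by
  have h := norm_inner_le_norm (𝕜 := ℂ) (WithLp.toLp 2 (fun q : m × n => N q.1 q.2))
    (WithLp.toLp 2 (fun q : m × n => M q.1 q.2))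
  rw [← frob_eq_norm, ← frob_eq_norm, mul_comm] at h
  refine le_of_eq_of_le (congrArg _ ?_) h
  simp [Matrix.trace, Matrix.mul_apply, PiLp.inner_apply, Fintype.sum_prod_type]

lemma re_trace_mul_conjTranspose_le (M N : Matrix m n ℂ) :
    ((M * Nᴴ).trace).re ≤ frob M * frob N :=
  (Complex.re_le_norm _).trans (norm_trace_mul_conjTranspose_le M N)

end Frobenius

/-! ### Functional calculus of Hermitian matrices -/

section Spectral

variable {n : Type*} [Fintype n] [DecidableEq n]

lemma continuousOn_spectrum (A : Matrix n n ℂ) (f : ℝ → ℝ) : ContinuousOn f (spectrum ℝ A) :=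
  A.finite_real_spectrum.continuousOn f

lemma cfc_eq_diag {A : Matrix n n ℂ} (hA : A.IsHermitian) (f : ℝ → ℝ) :
    cfc f A = (hA.eigenvectorUnitary : Matrix n n ℂ) *
      Matrix.diagonal (fun i => (f (hA.eigenvalues i) : ℂ)) *
        (hA.eigenvectorUnitary : Matrix n n ℂ)ᴴ := by
  rw [hA.cfc_eq]; rfl

lemma trace_cfc {A : Matrix n n ℂ} (hA : A.IsHermitian) (f : ℝ → ℝ) :
    (cfc f A).trace = ((∑ i, f (hA.eigenvalues i) : ℝ) : ℂ) := by
  rw [cfc_eq_diag hA, Matrix.trace_mul_comm, ← Matrix.mul_assoc]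
  have h : (hA.eigenvectorUnitary : Matrix n n ℂ)ᴴ * (hA.eigenvectorUnitary : Matrix n n ℂ) = 1 :=
    Matrix.mem_unitaryGroup_iff'.1 hA.eigenvectorUnitary.2
  rw [h, Matrix.one_mul, Matrix.trace_diagonal]
  push_cast; rfl

lemma posSemidef_cfc {A : Matrix n n ℂ} (hA : A.IsHermitian) {f : ℝ → ℝ}
    (hf : ∀ i, 0 ≤ f (hA.eigenvalues i)) : (cfc f A).PosSemidef := by
  rw [cfc_eq_diag hA]
  refine Matrix.PosSemidef.mul_mul_conjTranspose_same ?_ _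
  refine Matrix.PosSemidef.diagonal fun i => ?_
  simpa using hf i

lemma isHermitian_cfc (A : Matrix n n ℂ) (f : ℝ → ℝ) : (cfc f A).IsHermitian :=
  IsSelfAdjoint.cfc (f := f) (a := A)

lemma exists_diagonalization {A : Matrix n n ℂ} (hA : A.IsHermitian) :
    ∃ U : Matrix n n ℂ, Uᴴ * U = 1 ∧ U * Uᴴ = 1 ∧
      A = U * Matrix.diagonal (fun i => (hA.eigenvalues i : ℂ)) * Uᴴ := by
  refine ⟨hA.eigenvectorUnitary, Matrix.mem_unitaryGroup_iff'.1 hA.eigenvectorUnitary.2,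
    Matrix.mem_unitaryGroup_iff.1 hA.eigenvectorUnitary.2, ?_⟩
  have h := cfc_eq_diag hA id
  rwa [cfc_id ℝ A hA.isSelfAdjoint] at h

end Spectral

/-! ### Trace norm inequalities -/

section TraceNorm

variable {n : Type*} [Fintype n] [DecidableEq n]

lemma traceNorm_eq_sum_abs {A : Matrix n n ℂ} (hA : A.IsHermitian) :
    traceNorm A = ∑ i, |hA.eigenvalues i| := by
  have h1 := trace_cfc (Matrix.isHermitian_conjTranspose_mul_self A) Real.sqrt
  have h2 : cfc Real.sqrt (Aᴴ * A) = cfc (fun x : ℝ => |x|) A := by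
    have h3 : Aᴴ * A = cfc (fun x : ℝ => x ^ 2) A := by
      rw [cfc_pow_id (R := ℝ) A 2 hA.isSelfAdjoint, hA.eq, sq]
    rw [h3, ← cfc_comp' Real.sqrt (fun x : ℝ => x ^ 2) A
      ((A.finite_real_spectrum.image _).continuousOn _) (continuousOn_spectrum A _) hA.isSelfAdjoint]
    simp only [Real.sqrt_sq_eq_abs]
  rw [h2, trace_cfc hA] at h1
  exact_mod_cast h1.symm

lemma PosSemidef.re_trace_nonneg {A : Matrix n n ℂ} (hA : A.PosSemidef) : 0 ≤ A.trace.re :=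
  (Complex.le_def.1 hA.trace_nonneg).1

lemma PosSemidef.re_diag_nonneg {A : Matrix n n ℂ} (hA : A.PosSemidef) (i : n) :
    0 ≤ (A i i).re :=
  (Complex.le_def.1 hA.diag_nonneg).1

lemma trace_unitary_conj {U : Matrix n n ℂ} (hU : U * Uᴴ = 1) (A : Matrix n n ℂ) :
    (Uᴴ * A * U).trace = A.trace := by
  rw [Matrix.trace_mul_comm, ← Matrix.mul_assoc, hU, Matrix.one_mul]

/-- Pinching: in any orthonormal basis the diagonal entries of `P` and of `N` are nonnegative and
add up to their traces. -/
lemma sum_abs_diag_sub_le {P N : Matrix n n ℂ} (hP : P.PosSemidef) (hN : N.PosSemidef)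
    {U : Matrix n n ℂ} (hU : U * Uᴴ = 1) :
    ∑ i, |((Uᴴ * (P - N) * U) i i).re| ≤ P.trace.re + N.trace.re := by
  rw [← trace_unitary_conj hU P, ← trace_unitary_conj hU N]
  simp only [Matrix.trace, Matrix.diag_apply, Complex.re_sum, ← Finset.sum_add_distrib]
  refine Finset.sum_le_sum fun i _ => ?_
  have h1 := PosSemidef.re_diag_nonneg (hP.conjTranspose_mul_mul_same U) i
  have h2 := PosSemidef.re_diag_nonneg (hN.conjTranspose_mul_mul_same U) i
  rw [Matrix.mul_sub, Matrix.sub_mul, Matrix.sub_apply, Complex.sub_re, abs_le]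
  constructor <;> linarith

/-- In an eigenbasis of `P - N` the absolute diagonal entries are the singular values. Together with
the Jordan decomposition, which attains equality, this replaces duality: trace norms below are
bounded by exhibiting a Hermitian matrix as a difference of positive ones. -/
lemma traceNorm_sub_le {P N : Matrix n n ℂ} (hP : P.PosSemidef) (hN : N.PosSemidef) :
    traceNorm (P - N) ≤ P.trace.re + N.trace.re := by
  have hA : (P - N).IsHermitian := hP.isHermitian.sub hN.isHermitian
  obtain ⟨U, hU1, hU2, h⟩ := exists_diagonalization hA
  refine le_trans (le_of_eq ?_) (sum_abs_diag_sub_le hP hN hU2)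
  rw [traceNorm_eq_sum_abs hA]
  refine Finset.sum_congr rfl fun i _ => ?_
  have h2 : Uᴴ * (P - N) * U = Matrix.diagonal (fun i => (hA.eigenvalues i : ℂ)) := by
    conv_lhs => rw [h]
    rw [Matrix.mul_assoc, Matrix.mul_assoc, hU1, Matrix.mul_one, ← Matrix.mul_assoc, hU1,
      Matrix.one_mul]
  rw [h2]; simp

lemma exists_posPart_negPart {A : Matrix n n ℂ} (hA : A.IsHermitian) :
    ∃ P N : Matrix n n ℂ, P.PosSemidef ∧ N.PosSemidef ∧ A = P - N ∧
      P + N = cfc (fun x : ℝ => |x|) A ∧ P.trace.re + N.trace.re = traceNorm A := by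
  refine ⟨cfc (fun x : ℝ => max x 0) A, cfc (fun x : ℝ => max (-x) 0) A,
    posSemidef_cfc hA fun i => le_max_right _ _, posSemidef_cfc hA fun i => le_max_right _ _,
    ?_, ?_, ?_⟩
  · rw [← cfc_sub _ _ A (continuousOn_spectrum A _) (continuousOn_spectrum A _)]
    conv_lhs => rw [← cfc_id ℝ A hA.isSelfAdjoint]
    congr 1; ext x
    rcases le_total x 0 with h | h <;> simp [h]
  · rw [← cfc_add _ _ _ (continuousOn_spectrum A _) (continuousOn_spectrum A _)]
    congr 1; ext x
    rcases le_total x 0 with h | h <;> simp [h, abs_of_nonneg, abs_of_nonpos]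
  · rw [traceNorm_eq_sum_abs hA, trace_cfc hA, trace_cfc hA, Complex.ofReal_re, Complex.ofReal_re,
      ← Finset.sum_add_distrib]
    refine Finset.sum_congr rfl fun i _ => ?_
    rcases le_total (hA.eigenvalues i) 0 with h | h <;> simp [h, abs_of_nonneg, abs_of_nonpos]

lemma traceNorm_add_le {A B : Matrix n n ℂ} (hA : A.IsHermitian) (hB : B.IsHermitian) :
    traceNorm (A + B) ≤ traceNorm A + traceNorm B := by
  obtain ⟨P, N, hP, hN, h, -, ht⟩ := exists_posPart_negPart hA
  obtain ⟨P', N', hP', hN', h', -, ht'⟩ := exists_posPart_negPart hB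
  have := traceNorm_sub_le (hP.add hP') (hN.add hN')
  rw [Matrix.trace_add, Matrix.trace_add, Complex.add_re, Complex.add_re] at this
  have e : A + B = P + P' - (N + N') := by rw [h, h']; abel
  rw [e]; linarith

lemma traceNorm_posSemidef_le {P : Matrix n n ℂ} (hP : P.PosSemidef) :
    traceNorm P ≤ P.trace.re := by
  have := traceNorm_sub_le hP Matrix.PosSemidef.zero
  simpa using this

lemma traceNorm_neg {A : Matrix n n ℂ} (hA : A.IsHermitian) : traceNorm (-A) = traceNorm A := by
  have key : ∀ {B : Matrix n n ℂ}, B.IsHermitian → traceNorm (-B) ≤ traceNorm B := by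
    intro B hB
    obtain ⟨P, N, hP, hN, h, -, ht⟩ := exists_posPart_negPart hB
    have := traceNorm_sub_le hN hP
    have e : -B = N - P := by rw [h]; abel
    rw [e]; linarith
  refine le_antisymm (key hA) ?_
  have := key hA.neg
  rwa [neg_neg] at this

lemma sum_abs_diag_le {A : Matrix n n ℂ} (hA : A.IsHermitian)
    {U : Matrix n n ℂ} (hU : U * Uᴴ = 1) :
    ∑ i, |((Uᴴ * A * U) i i).re| ≤ traceNorm A := by
  obtain ⟨P, N, hP, hN, h, -, ht⟩ := exists_posPart_negPart hA
  rw [← ht, h]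
  exact sum_abs_diag_sub_le hP hN hU

lemma traceNorm_smul_le {A : Matrix n n ℂ} (hA : A.IsHermitian) {r : ℝ} (hr : 0 ≤ r) :
    traceNorm ((r : ℂ) • A) ≤ r * traceNorm A := by
  obtain ⟨P, N, hP, hN, h, -, ht⟩ := exists_posPart_negPart hA
  have hr' : (0 : ℂ) ≤ (r : ℂ) := by exact_mod_cast hr
  have := traceNorm_sub_le (hP.smul hr') (hN.smul hr')
  rw [← smul_sub, ← h] at this
  refine this.trans (le_of_eq ?_)
  rw [← ht]; simp [Matrix.trace_smul]; ring

lemma frobSq_abs {Z : Matrix n n ℂ} (hZ : Z.IsHermitian) :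
    frobSq (cfc (fun x : ℝ => |x|) Z) = frobSq Z := by
  have h : (cfc (fun x : ℝ => |x|) Z) * (cfc (fun x : ℝ => |x|) Z)ᴴ = Z * Zᴴ := by
    rw [(isHermitian_cfc Z _).eq, hZ.eq,
      ← cfc_mul _ _ Z (continuousOn_spectrum Z _) (continuousOn_spectrum Z _)]
    simp only [← sq, sq_abs]
    rw [cfc_pow_id (R := ℝ) Z 2 hZ.isSelfAdjoint, sq]
  have h1 := trace_mul_conjTranspose_eq_frobSq (cfc (fun x : ℝ => |x|) Z)
  rw [h, trace_mul_conjTranspose_eq_frobSq] at h1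
  exact_mod_cast h1.symm

/-- A weighted Cauchy-Schwarz bound of the trace norm by the Frobenius norm. -/
lemma traceNorm_conj_le {s Z : Matrix n n ℂ} (hs : s.IsHermitian) (hZ : Z.IsHermitian) :
    traceNorm (s * Z * s) ≤ frob Z * frob (s * s) := by
  obtain ⟨P, N, hP, hN, h, habs, -⟩ := exists_posPart_negPart hZ
  have hP' := hP.mul_mul_conjTranspose_same s
  have hN' := hN.mul_mul_conjTranspose_same s
  rw [hs.eq] at hP' hN'
  have e : s * Z * s = s * P * s - s * N * s := by
    rw [h, Matrix.mul_sub, Matrix.sub_mul]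
  rw [e]
  refine (traceNorm_sub_le hP' hN').trans ?_
  -- The two traces add up to Tr s|Z|s = Tr |Z|s², and |Z| has the same Frobenius norm as Z.
  rw [← Complex.add_re, ← Matrix.trace_add, ← Matrix.add_mul, ← Matrix.mul_add, habs,
    Matrix.trace_mul_comm, ← Matrix.mul_assoc, Matrix.trace_mul_comm]
  have h2 : s * s = (s * s)ᴴ := by rw [Matrix.conjTranspose_mul, hs.eq]
  conv_lhs => rw [h2]
  refine (re_trace_mul_conjTranspose_le _ _).trans (le_of_eq ?_)
  rw [frob, frobSq_abs hZ]; rfl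

/-- The Powers-Størmer inequality. -/
lemma frobSq_sub_le_traceNorm {S R : Matrix n n ℂ} (hS : S.PosSemidef) (hR : R.PosSemidef) :
    frobSq (S - R) ≤ traceNorm (S * S - R * R) := by
  have hT : (S - R).IsHermitian := hS.isHermitian.sub hR.isHermitian
  have hSR : (S * S - R * R).IsHermitian := by
    refine Matrix.IsHermitian.sub ?_ ?_
    · rw [Matrix.IsHermitian, Matrix.conjTranspose_mul, hS.isHermitian.eq]
    · rw [Matrix.IsHermitian, Matrix.conjTranspose_mul, hR.isHermitian.eq]
  obtain ⟨U, hU1, hU2, h⟩ := exists_diagonalization hT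
  refine le_trans ?_ (sum_abs_diag_le hSR hU2)
  set d := hT.eigenvalues
  set D : Matrix n n ℂ := Matrix.diagonal (fun i => (d i : ℂ)) with hD
  have hDU : Uᴴ * (S - R) * U = D := by
    conv_lhs => rw [h]
    rw [Matrix.mul_assoc, Matrix.mul_assoc, hU1, Matrix.mul_one, ← Matrix.mul_assoc, hU1,
      Matrix.one_mul]
  have hfrob : frobSq (S - R) = ∑ i, d i ^ 2 := by
    have h1 := trace_mul_conjTranspose_eq_frobSq (S - R)
    have h2 : (S - R) * (S - R)ᴴ = U * (D * D) * Uᴴ := by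
      rw [hT.eq]
      conv_lhs => rw [h]
      simp only [Matrix.mul_assoc]
      rw [← Matrix.mul_assoc Uᴴ U, hU1, Matrix.one_mul]
    rw [h2, Matrix.trace_mul_comm, ← Matrix.mul_assoc, hU1, Matrix.one_mul, hD,
      Matrix.diagonal_mul_diagonal, Matrix.trace_diagonal] at h1
    have : ((∑ i, d i ^ 2 : ℝ) : ℂ) = (frobSq (S - R) : ℂ) := by
      rw [← h1]; push_cast; simp only [sq]
    exact_mod_cast this.symm
  rw [hfrob]
  refine Finset.sum_le_sum fun i _ => ?_
  -- From 2(S² − R²) = (S − R)(S + R) + (S + R)(S − R): in an eigenbasis of S − R the diagonal of S²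
  -- − R² is that of S + R multiplied by the eigenvalues d i.
  have hG : (2 : ℂ) • (Uᴴ * (S * S - R * R) * U) =
      D * (Uᴴ * (S + R) * U) + (Uᴴ * (S + R) * U) * D := by
    rw [← hDU]
    have e1 : ∀ X Y : Matrix n n ℂ, (Uᴴ * X * U) * (Uᴴ * Y * U) = Uᴴ * (X * Y) * U := by
      intro X Y
      simp only [Matrix.mul_assoc]
      rw [← Matrix.mul_assoc U Uᴴ, hU2, Matrix.one_mul]
    rw [e1, e1, ← Matrix.add_mul, ← Matrix.mul_add, ← Matrix.smul_mul, ← Matrix.mul_smul]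
    congr 2
    rw [two_smul]; noncomm_ring
  have hG2 := congrFun (congrFun hG i) i
  simp only [Matrix.smul_apply, Matrix.add_apply, hD, Matrix.diagonal_mul, Matrix.mul_diagonal,
    smul_eq_mul] at hG2
  have hre := congrArg Complex.re hG2
  simp only [Complex.mul_re, Complex.add_re, Complex.re_ofNat, Complex.im_ofNat, zero_mul, sub_zero,
    Complex.ofReal_re, Complex.ofReal_im, mul_zero] at hre
  have hd := congrArg Complex.re (congrFun (congrFun hDU i) i)
  rw [hD, Matrix.diagonal_apply_eq, Complex.ofReal_re] at hd
  have hp1 := PosSemidef.re_diag_nonneg (hS.conjTranspose_mul_mul_same U) i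
  have hp2 := PosSemidef.re_diag_nonneg (hR.conjTranspose_mul_mul_same U) i
  simp only [Matrix.mul_sub, Matrix.sub_mul, Matrix.mul_add, Matrix.add_mul, Matrix.sub_apply,
    Matrix.add_apply, Complex.sub_re, Complex.add_re] at hre hd ⊢
  set s := ((Uᴴ * S * U) i i).re
  set r := ((Uᴴ * R * U) i i).re
  have hk : ((Uᴴ * (S * S) * U) i i).re - ((Uᴴ * (R * R) * U) i i).re = d i * (s + r) := by
    linarith
  -- Since d i = s − r with s, r ≥ 0, one has |d i| ≤ s + r and therefore d i² ≤ |d i|(s + r).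
  rw [hk, abs_mul, abs_of_nonneg (by linarith : 0 ≤ s + r), ← sq_abs, sq]
  refine mul_le_mul_of_nonneg_left ?_ (abs_nonneg _)
  rw [← hd, abs_le]
  constructor <;> linarith

section Rect
variable {p : Type*} [Fintype p]

lemma isHermitian_mul_conjTranspose_add (P u : Matrix n p ℂ) :
    (P * uᴴ + u * Pᴴ).IsHermitian := by
  rw [Matrix.IsHermitian, Matrix.conjTranspose_add, Matrix.conjTranspose_mul,
    Matrix.conjTranspose_mul, Matrix.conjTranspose_conjTranspose,
    Matrix.conjTranspose_conjTranspose, add_comm]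

lemma frobSq_eq_zero {m : Type*} [Fintype m] {M : Matrix m p ℂ} (h : frobSq M = 0) : M = 0 := by
  ext i j
  rw [frobSq, Finset.sum_eq_zero_iff_of_nonneg
    (fun _ _ => Finset.sum_nonneg fun _ _ => sq_nonneg _)] at h
  have h1 := h i (Finset.mem_univ _)
  rw [Finset.sum_eq_zero_iff_of_nonneg (fun _ _ => sq_nonneg _)] at h1
  simpa using h1 j (Finset.mem_univ _)

/-- Polarisation writes the cross term as a difference of two positive matrices, with a free scale
to be optimised. -/
lemma traceNorm_cross_le (P u : Matrix n p ℂ) :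
    traceNorm (P * uᴴ + u * Pᴴ) ≤ 2 * (frob P * frob u) := by
  by_cases hP : frobSq P = 0
  · have := frobSq_eq_zero hP
    subst this
    have h0 := traceNorm_posSemidef_le (n := n) Matrix.PosSemidef.zero
    have : 0 ≤ 2 * (frob (0 : Matrix n p ℂ) * frob u) := by
      have := frob_nonneg u; have := frob_nonneg (0 : Matrix n p ℂ); positivity
    simp at h0 ⊢
    linarith
  by_cases hu : frobSq u = 0
  · have := frobSq_eq_zero hu
    subst this
    have h0 := traceNorm_posSemidef_le (n := n) Matrix.PosSemidef.zero
    have : 0 ≤ 2 * (frob P * frob (0 : Matrix n p ℂ)) := by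
      have := frob_nonneg P; have := frob_nonneg (0 : Matrix n p ℂ); positivity
    simp at h0 ⊢
    linarith
  have hP0 : 0 < frob P := Real.sqrt_pos.2 (lt_of_le_of_ne (frobSq_nonneg P) (Ne.symm hP))
  have hu0 : 0 < frob u := Real.sqrt_pos.2 (lt_of_le_of_ne (frobSq_nonneg u) (Ne.symm hu))
  -- The two positive parts have total trace x‖P‖² + ‖u‖²/x, and this x minimises it.
  set x : ℝ := frob u / frob P with hx
  have hx0 : 0 < x := div_pos hu0 hP0
  set y : ℝ := (2 * x)⁻¹ with hy
  have hy0 : 0 < y := by positivity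
  have hy' : (0 : ℂ) ≤ (y : ℂ) := by exact_mod_cast hy0.le
  have hPP := (Matrix.posSemidef_self_mul_conjTranspose ((x : ℂ) • P + u)).smul hy'
  have hNN := (Matrix.posSemidef_self_mul_conjTranspose ((x : ℂ) • P - u)).smul hy'
  have hyx : (y : ℂ) * x = 1 / 2 := by
    have : y * x = 1 / 2 := by rw [hy]; field_simp
    rw [← Complex.ofReal_mul, this]; push_cast; rfl
  have e : P * uᴴ + u * Pᴴ = (y : ℂ) • (((x : ℂ) • P + u) * ((x : ℂ) • P + u)ᴴ) -
      (y : ℂ) • (((x : ℂ) • P - u) * ((x : ℂ) • P - u)ᴴ) := by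
    simp only [Matrix.conjTranspose_add, Matrix.conjTranspose_sub, Matrix.conjTranspose_smul,
      Matrix.add_mul, Matrix.mul_add, Matrix.sub_mul, Matrix.mul_sub, Matrix.smul_mul,
      Matrix.mul_smul, smul_add, smul_sub, smul_smul, Complex.star_def, Complex.conj_ofReal]
    rw [hyx]
    module
  rw [e]
  refine (traceNorm_sub_le hPP hNN).trans (le_of_eq ?_)
  rw [← Complex.add_re, ← Matrix.trace_add, ← smul_add]
  have e2 : ((x : ℂ) • P + u) * ((x : ℂ) • P + u)ᴴ + ((x : ℂ) • P - u) * ((x : ℂ) • P - u)ᴴ =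
      (2 * x ^ 2 : ℂ) • (P * Pᴴ) + (2 : ℂ) • (u * uᴴ) := by
    simp only [Matrix.conjTranspose_add, Matrix.conjTranspose_sub, Matrix.conjTranspose_smul,
      Matrix.add_mul, Matrix.mul_add, Matrix.sub_mul, Matrix.mul_sub, Matrix.smul_mul,
      Matrix.mul_smul, Complex.star_def, Complex.conj_ofReal]
    module
  rw [e2, Matrix.trace_smul, Matrix.trace_add, Matrix.trace_smul, Matrix.trace_smul,
    trace_mul_conjTranspose_eq_frobSq, trace_mul_conjTranspose_eq_frobSq]
  have : (y : ℂ) • (((2 * x ^ 2 : ℂ) • (frobSq P : ℂ)) + (2 : ℂ) • (frobSq u : ℂ)) =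
      ((y * (2 * x ^ 2 * frobSq P + 2 * frobSq u) : ℝ) : ℂ) := by
    push_cast; simp only [smul_eq_mul]
  rw [this, Complex.ofReal_re, ← sq_frob, ← sq_frob, hy, hx]
  field_simp
  ring

/-- Expansion around `P`: the difference is the cross term of P and P − Q, minus (P − Q)(P − Q)ᴴ. -/
lemma traceNorm_mul_conjTranspose_sub_le (P Q : Matrix n p ℂ) :
    traceNorm (P * Pᴴ - Q * Qᴴ) ≤ 2 * (frob P * frob (P - Q)) + frob (P - Q) ^ 2 := by
  have e : P * Pᴴ - Q * Qᴴ = (P * (P - Q)ᴴ + (P - Q) * Pᴴ) + -((P - Q) * (P - Q)ᴴ) := by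
    simp only [Matrix.conjTranspose_sub, Matrix.mul_sub, Matrix.sub_mul]; abel
  rw [e]
  have hps := Matrix.posSemidef_self_mul_conjTranspose (P - Q)
  refine (traceNorm_add_le (isHermitian_mul_conjTranspose_add _ _) hps.isHermitian.neg).trans ?_
  rw [traceNorm_neg hps.isHermitian]
  refine add_le_add (traceNorm_cross_le _ _) ((traceNorm_posSemidef_le hps).trans (le_of_eq ?_))
  rw [trace_mul_conjTranspose_eq_frobSq, Complex.ofReal_re, sq_frob]

end Rect

end TraceNorm

/-! ### Square roots and their pseudoinverses -/

section Roots

variable {n : Type*} [Fintype n] [DecidableEq n]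

lemma cfc_mul_cfc (A : Matrix n n ℂ) (f g : ℝ → ℝ) :
    cfc f A * cfc g A = cfc (fun x => f x * g x) A :=
  (cfc_mul _ _ A (continuousOn_spectrum A _) (continuousOn_spectrum A _)).symm

lemma cfc_congr_nonneg {A : Matrix n n ℂ} (hA : A.PosSemidef) {f g : ℝ → ℝ}
    (h : ∀ x, 0 ≤ x → f x = g x) : cfc f A = cfc g A := by
  rw [cfc_eq_diag hA.isHermitian, cfc_eq_diag hA.isHermitian]
  simp only [h _ (hA.eigenvalues_nonneg _)]

/-- The square root of a positive semidefinite matrix and its pseudoinverse. -/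
lemma exists_sqrt_pinv {A : Matrix n n ℂ} (hA : A.PosSemidef) :
    ∃ R H : Matrix n n ℂ, R.PosSemidef ∧ H.IsHermitian ∧ R * R = A ∧ A * H = R ∧
      H * H * A * (H * H) = H * H := by
  have hid : cfc (fun x : ℝ => x) A = A := cfc_id' ℝ A hA.isHermitian.isSelfAdjoint
  -- As 0⁻¹ = 0, the second function vanishes at the eigenvalue 0 and yields the pseudoinverse of
  -- the square root.
  refine ⟨cfc Real.sqrt A, cfc (fun x => (√x)⁻¹) A,
    posSemidef_cfc hA.isHermitian fun i => Real.sqrt_nonneg _, isHermitian_cfc _ _, ?_, ?_, ?_⟩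
  · rw [cfc_mul_cfc]
    conv_rhs => rw [← hid]
    exact cfc_congr_nonneg hA fun x hx => Real.mul_self_sqrt hx
  · nth_rw 1 [← hid]
    rw [cfc_mul_cfc]
    refine cfc_congr_nonneg hA fun x hx => ?_
    rcases eq_or_lt_of_le hx with h | h
    · simp [← h]
    · field_simp [(Real.sqrt_pos.2 h).ne']
      rw [Real.sq_sqrt hx]
  · nth_rw 3 [← hid]
    rw [cfc_mul_cfc, cfc_mul_cfc, cfc_mul_cfc]
    refine cfc_congr_nonneg hA fun x hx => ?_
    rcases eq_or_lt_of_le hx with h | h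
    · simp [← h]
    · have := (Real.sqrt_pos.2 h).ne'
      field_simp
      rw [Real.sq_sqrt hx]

end Roots

/-! ### Weights θ^{1/4} and the smooth Rényi-2 divergence -/

section Divergence

variable {ι κ : Type*} [Fintype ι] [DecidableEq ι] [Fintype κ] [DecidableEq κ]

/-- Tensoring with the identity, as a homomorphism of star algebras. -/
def oneKron (ι κ : Type*) [Fintype ι] [DecidableEq ι] [Fintype κ] [DecidableEq κ] :
    Matrix κ κ ℂ →⋆ₐ[ℝ] Matrix (ι × κ) (ι × κ) ℂ where
  toFun X := (1 : Matrix ι ι ℂ) ⊗ₖ X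
  map_one' := Matrix.one_kronecker_one
  map_mul' X Y := by rw [← Matrix.mul_kronecker_mul, Matrix.one_mul]
  map_zero' := Matrix.kronecker_zero _
  map_add' X Y := Matrix.kronecker_add _ _ _
  commutes' r := by
    rw [Algebra.algebraMap_eq_smul_one, Algebra.algebraMap_eq_smul_one, Matrix.kronecker_smul,
      Matrix.one_kronecker_one]
  map_star' X := by
    simp [Matrix.star_eq_conjTranspose, Matrix.conjTranspose_kronecker]

lemma continuous_oneKron : Continuous (oneKron ι κ) := by
  show Continuous fun X : Matrix κ κ ℂ => (1 : Matrix ι ι ℂ) ⊗ₖ X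
  refine continuous_pi fun p => continuous_pi fun q => ?_
  simp only [Matrix.kroneckerMap_apply]
  fun_prop

/-- Functional calculus commutes with the continuous star homomorphism X ↦ 1 ⊗ X, so the fourth root
of 1 ⊗ θ acts on the environment alone. -/
lemma cfc_one_kronecker {θ : Matrix κ κ ℂ} (hθ : θ.IsHermitian) (f : ℝ → ℝ) :
    cfc f ((1 : Matrix ι ι ℂ) ⊗ₖ θ) = (1 : Matrix ι ι ℂ) ⊗ₖ cfc f θ := by
  have h := StarAlgHom.map_cfc (S := ℝ) (oneKron ι κ) f θ (continuousOn_spectrum θ f) 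
    continuous_oneKron hθ.isSelfAdjoint (by
      exact hθ.isSelfAdjoint.map (oneKron ι κ))
  exact h.symm

lemma posSemidef_one_kronecker {θ : Matrix κ κ ℂ} (hθ : θ.PosSemidef) :
    ((1 : Matrix ι ι ℂ) ⊗ₖ θ).PosSemidef :=
  Matrix.PosSemidef.one.kronecker hθ

/-- The projection onto the support fixes every matrix whose range lies in the support. -/
lemma fourthRoot_mul_pinv_mul {β τ : Matrix ι ι ℂ} (hβ : β.PosSemidef)
    (h : support τ ≤ support β) :
    cfc (fun x : ℝ => x ^ (1 / 4 : ℝ)) β * pinvFourthRoot β * τ = τ := by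
  -- β^{1/4}β^{-1/4} acts as the identity on the range of β; what it does on the kernel is
  -- irrelevant after multiplication by β.
  have hβ' : cfc (fun x : ℝ => x ^ (1 / 4 : ℝ)) β * pinvFourthRoot β * β = β := by
    have hid : cfc (fun x : ℝ => x) β = β := cfc_id' ℝ β hβ.isHermitian.isSelfAdjoint
    nth_rw 3 [← hid]
    nth_rw 4 [← hid]
    rw [pinvFourthRoot, cfc_mul_cfc, cfc_mul_cfc]
    refine cfc_congr_nonneg hβ fun x hx => ?_
    rcases eq_or_lt_of_le hx with h | h
    · simp [← h]
    · rw [← Real.rpow_add h]; simp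
  have key : ∀ v : ι → ℂ,
      (cfc (fun x : ℝ => x ^ (1 / 4 : ℝ)) β * pinvFourthRoot β * τ).mulVec v = τ.mulVec v := by
    intro v
    obtain ⟨w, hw⟩ := h (show τ.mulVec v ∈ support τ from ⟨v, rfl⟩)
    have hw' : β.mulVec w = τ.mulVec v := hw
    rw [← Matrix.mulVec_mulVec, ← hw', Matrix.mulVec_mulVec, hβ']
  exact Matrix.ext_of_mulVec_single fun i => key _

/-- A matrix supported in `1 ⊗ θ` factors through the fourth root of `θ`. -/
lemma exists_weighted_factor {θ : Matrix κ κ ℂ} (hθ : θ.PosSemidef)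
    {τ : Matrix (ι × κ) (ι × κ) ℂ} (hτ : τ.IsHermitian)
    (h : support τ ≤ support ((1 : Matrix ι ι ℂ) ⊗ₖ θ)) :
    ∃ T : Matrix (ι × κ) (ι × κ) ℂ, T.IsHermitian ∧
      τ = ((1 : Matrix ι ι ℂ) ⊗ₖ cfc (fun x : ℝ => x ^ (1 / 4 : ℝ)) θ) * T *
        ((1 : Matrix ι ι ℂ) ⊗ₖ cfc (fun x : ℝ => x ^ (1 / 4 : ℝ)) θ) ∧
      schattenTwo (pinvFourthRoot ((1 : Matrix ι ι ℂ) ⊗ₖ θ) * τ *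
        pinvFourthRoot ((1 : Matrix ι ι ℂ) ⊗ₖ θ)) = frob T := by
  set β := (1 : Matrix ι ι ℂ) ⊗ₖ θ with hβ
  have hβp : β.PosSemidef := posSemidef_one_kronecker hθ
  have hP : (pinvFourthRoot β).IsHermitian := isHermitian_cfc _ _
  have hQ : (cfc (fun x : ℝ => x ^ (1 / 4 : ℝ)) β).IsHermitian := isHermitian_cfc _ _
  refine ⟨pinvFourthRoot β * τ * pinvFourthRoot β, ?_, ?_, ?_⟩
  · rw [Matrix.IsHermitian, Matrix.conjTranspose_mul, Matrix.conjTranspose_mul, hP.eq, hτ.eq,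
      Matrix.mul_assoc]
  · rw [← cfc_one_kronecker hθ.isHermitian]
    have h1 := fourthRoot_mul_pinv_mul hβp h
    have h2 := congrArg Matrix.conjTranspose h1
    rw [Matrix.conjTranspose_mul, Matrix.conjTranspose_mul, hP.eq, hτ.eq, hQ.eq] at h2
    calc τ = cfc (fun x : ℝ => x ^ (1 / 4 : ℝ)) β * pinvFourthRoot β * τ := h1.symm
      _ = cfc (fun x : ℝ => x ^ (1 / 4 : ℝ)) β * pinvFourthRoot β *
          (τ * (pinvFourthRoot β * cfc (fun x : ℝ => x ^ (1 / 4 : ℝ)) β)) := by rw [h2]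
      _ = _ := by simp only [hβ, Matrix.mul_assoc]
  · rw [schattenTwo, trace_conjTranspose_mul_eq_frobSq, Complex.ofReal_re]; rfl

/-- The square of the weight is 1 ⊗ θ^{1/2}. This is the factor by which weighted Cauchy–Schwarz
loses, and the way the reference dimension enters the rates. -/
lemma frobSq_one_kronecker_root {θ : Matrix κ κ ℂ} (hθ : θ.PosSemidef) :
    frobSq (((1 : Matrix ι ι ℂ) ⊗ₖ cfc (fun x : ℝ => x ^ (1 / 4 : ℝ)) θ) *
      ((1 : Matrix ι ι ℂ) ⊗ₖ cfc (fun x : ℝ => x ^ (1 / 4 : ℝ)) θ)) =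
      Fintype.card ι * θ.trace.re := by
  have hq : (cfc (fun x : ℝ => x ^ (1 / 4 : ℝ)) θ).IsHermitian := isHermitian_cfc _ _
  set t := cfc (fun x : ℝ => x ^ (1 / 4 : ℝ)) θ with ht
  have h4 : t * t * (t * t) = θ := by
    rw [ht, cfc_mul_cfc, cfc_mul_cfc]
    conv_rhs => rw [← cfc_id' ℝ θ hθ.isHermitian.isSelfAdjoint]
    refine cfc_congr_nonneg hθ fun x hx => ?_
    rw [← sq, ← sq, ← pow_mul, ← Real.rpow_natCast, ← Real.rpow_mul hx]
    norm_num
  rw [← Matrix.mul_kronecker_mul, Matrix.one_mul]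
  have h := trace_mul_conjTranspose_eq_frobSq ((1 : Matrix ι ι ℂ) ⊗ₖ (t * t))
  rw [Matrix.conjTranspose_kronecker, ← Matrix.mul_kronecker_mul, Matrix.trace_kronecker,
    Matrix.conjTranspose_mul, hq.eq, h4, Matrix.conjTranspose_one, Matrix.one_mul,
    Matrix.trace_one] at h
  have h' := congrArg Complex.re h
  rw [Complex.ofReal_re, Complex.mul_re] at h'
  simpa using h'.symm

/-- The content of a strict lower bound on a smooth Rényi-2 entropy. -/
lemma exists_of_lt_neg_smoothRenyiTwoDiv {ε x : ℝ} (hε : 0 < ε) {α β : Matrix ι ι ℂ}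
    (h : (x : EReal) < -smoothRenyiTwoDiv ε α β - ((Real.logb 2 (ε ^ (-4 : ℤ)) : ℝ) : EReal)) :
    ∃ α' : Matrix ι ι ℂ, IsSubnormalised α' ∧ traceNorm (α' - α) ≤ ε * α.trace.re ∧
      support α' ≤ support β ∧
      (2 : ℝ) ^ x * schattenTwo (pinvFourthRoot β * α' * pinvFourthRoot β) ^ 2 ≤ ε ^ 4 := by
  set L := Real.logb 2 (ε ^ (-4 : ℤ)) with hL
  have h1 : smoothRenyiTwoDiv ε α β < ((-(x + L) : ℝ) : EReal) := by
    have h2 : ((x + L : ℝ) : EReal) < -smoothRenyiTwoDiv ε α β := by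
      rw [EReal.coe_add]
      exact EReal.add_lt_of_lt_sub h
    rw [EReal.coe_neg]
    exact EReal.lt_neg_comm.1 h2
  -- Strictness of the inequality provides a competitor directly; attainment of the infimum plays no
  -- role.
  simp only [smoothRenyiTwoDiv, iInf_lt_iff] at h1
  obtain ⟨α', hα', hd, hlt⟩ := h1
  refine ⟨α', hα', hd, ?_⟩
  unfold renyiTwoDiv at hlt
  split_ifs at hlt with hs h0
  -- Divergence −∞: the norm is zero and the bound is trivial.
  · refine ⟨hs, ?_⟩
    rw [h0]; simp; positivity
  · refine ⟨hs, ?_⟩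
    set s := schattenTwo (pinvFourthRoot β * α' * pinvFourthRoot β)
    have hs0 : 0 < s := lt_of_le_of_ne (Real.sqrt_nonneg _) (Ne.symm h0)
    have hlt' : 2 * Real.logb 2 s < -(x + L) := by exact_mod_cast hlt
    have h3 : Real.logb 2 ((2 : ℝ) ^ x * s ^ 2) ≤ Real.logb 2 (ε ^ 4) := by
      rw [Real.logb_mul (by positivity) (by positivity), Real.logb_rpow (by norm_num) (by norm_num),
        Real.logb_pow]
      have : L = -Real.logb 2 (ε ^ 4) := by
        rw [hL, ← Real.logb_inv]; congr 1
      push_cast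
      linarith
    exact (Real.logb_le_logb (by norm_num) (by positivity) (by positivity)).1 h3
  · simp at hlt

end Divergence

/-! ### Second moments of random cube roots of unity -/

section Phases

variable {J : Type*} [Fintype J] [DecidableEq J]

/-- A family of cube roots of unity, indexed by their exponents. -/
def phase (s : J → ZMod 3) (j : J) : ℂ := ZMod.stdAddChar (s j)

lemma phase_mul_conj (s : J → ZMod 3) (j : J) : phase s j * conj (phase s j) = 1 := by
  rw [Complex.mul_conj, Complex.normSq_eq_norm_sq, phase, AddChar.norm_apply]; simp

/-- A nontrivial character of a finite group has mean zero. -/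
lemma expect_stdAddChar {l : (J → ZMod 3) →+ ZMod 3} (h : ∃ s, l s ≠ 0) :
    𝔼 s, (ZMod.stdAddChar (l s) : ℂ) = 0 := by
  have := (AddChar.expect_eq_zero_iff_ne_zero
    (ψ := (ZMod.stdAddChar (N := 3)).compAddMonoidHom l)).2 (by
      obtain ⟨s, hs⟩ := h
      intro h0
      have h1 := DFunLike.congr_fun h0 s
      refine hs (ZMod.injective_stdAddChar (N := 3) ?_)
      simpa using h1)
  simpa using this

/-- The centred products of two phases. -/
def phaseDev (s : J → ZMod 3) (p : J × J) : ℂ :=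
  phase s p.1 * conj (phase s p.2) - if p.1 = p.2 then 1 else 0

lemma phaseDev_diag (s : J → ZMod 3) (p : J × J) (h : p.1 = p.2) : phaseDev s p = 0 := by
  rw [phaseDev, ← h, phase_mul_conj]; simp

/-- The coordinate projections as additive maps. -/
def coordHom (j : J) : (J → ZMod 3) →+ ZMod 3 := Pi.evalAddMonoidHom (fun _ => ZMod 3) j

lemma phase_mul_conj_eq (s : J → ZMod 3) (j k : J) :
    phase s j * conj (phase s k) = ZMod.stdAddChar (s j - s k) := by
  rw [phase, phase, sub_eq_add_neg, AddChar.map_add_eq_mul, AddChar.map_neg_eq_conj]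

lemma expect_phaseDev (p : J × J) : 𝔼 s, phaseDev s p = 0 := by
  by_cases h : p.1 = p.2
  · simp [phaseDev_diag _ p h]
  · simp only [phaseDev, if_neg h, sub_zero, phase_mul_conj_eq]
    refine expect_stdAddChar (l := coordHom p.1 - coordHom p.2) ⟨Pi.single p.1 1, ?_⟩
    simp [coordHom, Ne.symm h]

/-- Off the diagonal both factors are characters, so the mean vanishes unless s p.1 − s p.2 − s q.1
+ s q.2 is identically zero. Random signs would not do, since modulo 2 the pairs (j, k) and (k, j)
define the same character; modulo 3 distinct ordered pairs are uncorrelated. -/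
lemma expect_phaseDev_mul (p q : J × J) :
    𝔼 s, phaseDev s p * conj (phaseDev s q) = if p = q ∧ p.1 ≠ p.2 then 1 else 0 := by
  by_cases hp : p.1 = p.2
  · simp [phaseDev_diag _ p hp, hp]
  by_cases hq : q.1 = q.2
  · have : ¬ (p = q ∧ p.1 ≠ p.2) := by rintro ⟨rfl, h⟩; exact h hq
    simp [phaseDev_diag _ q hq, this]
  have e : ∀ s, phaseDev s p * conj (phaseDev s q) =
      ZMod.stdAddChar ((coordHom p.1 - coordHom p.2 - (coordHom q.1 - coordHom q.2)) s) := by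
    intro s
    simp only [phaseDev, if_neg hp, if_neg hq, sub_zero, phase_mul_conj_eq]
    rw [← AddChar.map_neg_eq_conj, ← AddChar.map_add_eq_mul, ← sub_eq_add_neg]
    rfl
  simp only [e]
  by_cases hpq : p = q
  · subst hpq
    simp [hp]
  · rw [if_neg (fun h => hpq h.1)]
    refine expect_stdAddChar ?_
    obtain ⟨j, k⟩ := p
    obtain ⟨j', k'⟩ := q
    simp only [Prod.mk.injEq, not_and] at hpq hp hq
    by_cases h1 : j = j'
    · subst h1
      have hk := hpq rfl
      refine ⟨Pi.single k 1, ?_⟩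
      simp [coordHom, Ne.symm hk]
    · refine ⟨Pi.single j 1, ?_⟩
      by_cases h2 : k' = j
      -- When k' = j the coefficient of s j is 2, which is nonzero modulo 3.
      · simp [coordHom, Ne.symm hp, Ne.symm h1, h2]; decide
      · simp [coordHom, Ne.symm hp, Ne.symm h1, h2]

/-- A Parseval identity: injectivity of `p` keeps the centred products orthogonal, and diagonal
pairs drop out because their deviation is zero. -/
lemma expect_norm_sq_phaseDev {I : Type*} [Fintype I] {p : I → J × J}
    (hp : Function.Injective p) (c : I → ℂ) :
    𝔼 s, ‖∑ i, phaseDev s (p i) * c i‖ ^ 2 =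
      ∑ i, if (p i).1 ≠ (p i).2 then ‖c i‖ ^ 2 else 0 := by
  classical
  have h : ((𝔼 s, ‖∑ i, phaseDev s (p i) * c i‖ ^ 2 : ℝ) : ℂ) =
      ((∑ i, if (p i).1 ≠ (p i).2 then ‖c i‖ ^ 2 else 0 : ℝ) : ℂ) := by
    rw [Complex.ofReal_expect]
    have e : ∀ s, (((‖∑ i, phaseDev s (p i) * c i‖ ^ 2 : ℝ)) : ℂ) =
        ∑ i, ∑ j, (phaseDev s (p i) * conj (phaseDev s (p j))) * (c i * conj (c j)) := by
      intro s
      rw [← Complex.normSq_eq_norm_sq, ← Complex.mul_conj, map_sum, Finset.sum_mul_sum]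
      refine Finset.sum_congr rfl fun i _ => Finset.sum_congr rfl fun j _ => ?_
      rw [map_mul]; ring
    simp only [e]
    rw [Finset.expect_sum_comm]
    push_cast
    refine Finset.sum_congr rfl fun i _ => ?_
    rw [Finset.expect_sum_comm]
    simp only [← Finset.expect_mul, expect_phaseDev_mul]
    rw [Finset.sum_eq_single i]
    · by_cases h : (p i).1 = (p i).2
      · simp [h]
      · simp [h, Complex.mul_conj, Complex.normSq_eq_norm_sq]
    · intro j _ hji
      have : p i ≠ p j := fun h => hji (hp h).symm
      simp [this]
    · simp
  exact_mod_cast h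

lemma expect_norm_sq_phaseDev_le {I : Type*} [Fintype I] {p : I → J × J}
    (hp : Function.Injective p) (c : I → ℂ) :
    𝔼 s, ‖∑ i, phaseDev s (p i) * c i‖ ^ 2 ≤ ∑ i, ‖c i‖ ^ 2 := by
  rw [expect_norm_sq_phaseDev hp]
  refine Finset.sum_le_sum fun i _ => ?_
  split_ifs
  · exact le_rfl
  · positivity

/-- The bound for one family is used twice, the sum over the other family being absorbed into the
coefficients. -/
lemma expect_expect_norm_sq_phaseDev_le {J' I I' : Type*} [Fintype J'] [DecidableEq J']
    [Fintype I] [Fintype I']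
    {p : I → J × J} (hp : Function.Injective p) {p' : I' → J' × J'} (hp' : Function.Injective p')
    (c : I → I' → ℂ) :
    𝔼 s, 𝔼 s', ‖∑ i, ∑ i', phaseDev s (p i) * phaseDev s' (p' i') * c i i'‖ ^ 2 ≤
      ∑ i, ∑ i', ‖c i i'‖ ^ 2 := by
  have h1 : ∀ s : J → ZMod 3,
      𝔼 s', ‖∑ i, ∑ i', phaseDev s (p i) * phaseDev s' (p' i') * c i i'‖ ^ 2 ≤
        ∑ i', ‖∑ i, phaseDev s (p i) * c i i'‖ ^ 2 := by
    intro s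
    refine le_trans (le_of_eq ?_)
      (expect_norm_sq_phaseDev_le hp' (fun i' => ∑ i, phaseDev s (p i) * c i i'))
    refine Finset.expect_congr rfl fun s' _ => ?_
    congr 2
    rw [Finset.sum_comm]
    refine Finset.sum_congr rfl fun i' _ => ?_
    rw [Finset.mul_sum]
    refine Finset.sum_congr rfl fun i _ => ?_
    ring
  refine (Finset.expect_le_expect fun s _ => h1 s).trans ?_
  rw [Finset.expect_sum_comm, Finset.sum_comm (s := (Finset.univ : Finset I))]
  exact Finset.sum_le_sum fun i' _ => expect_norm_sq_phaseDev_le hp _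

end Phases

/-! ### First moment method and Jensen's inequality -/

section Expectation

variable {S : Type*} [Fintype S] [Nonempty S]

lemma exists_le_expect (f : S → ℝ) : ∃ s, f s ≤ 𝔼 s, f s := by
  by_contra! h
  have h1 : ∑ s : S, (𝔼 t, f t) < ∑ s, f s := Finset.sum_lt_sum_of_nonempty
    Finset.univ_nonempty fun s _ => h s
  rw [Finset.sum_const, Finset.card_univ, Fintype.card_smul_expect] at h1
  exact lt_irrefl _ h1

/-- Jensen's inequality for the square root. -/
lemma expect_le_sqrt_expect_sq (f : S → ℝ) : 𝔼 s, f s ≤ √(𝔼 s, f s ^ 2) := by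
  refine Real.le_sqrt_of_sq_le ?_
  rw [Fintype.expect_eq_sum_div_card, Fintype.expect_eq_sum_div_card, div_pow]
  have hc : (0 : ℝ) < Fintype.card S := by exact_mod_cast Fintype.card_pos
  rw [div_le_div_iff₀ (by positivity) hc]
  have h := sq_sum_le_card_mul_sum_sq (s := (Finset.univ : Finset S)) (f := f)
  rw [Finset.card_univ] at h
  nlinarith [Finset.sum_nonneg fun (i : S) (_ : i ∈ Finset.univ) => sq_nonneg (f i)]

end Expectation

/-! ### Uniformly random partitions into blocks of equal size -/

section RandomPartition

variable {R : Type*} [Fintype R] [DecidableEq R] {M : ℕ}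

/-- The indicator that `i` lies in the block `r` of the partition given by a permutation. -/
def blockInd (π : Equiv.Perm (R × Fin M)) (i : R × Fin M) (r : R) : ℂ :=
  if (π i).1 = r then 1 else 0

lemma sum_blockInd (π : Equiv.Perm (R × Fin M)) (i : R × Fin M) : ∑ r, blockInd π i r = 1 := by
  simp [blockInd]

/-- Every point shares its block with exactly M points, itself included. This double count
determines the pair probability. -/
lemma sum_same_block (π : Equiv.Perm (R × Fin M)) :
    ∑ i, ∑ j, (if (π i).1 = (π j).1 then (1 : ℝ) else 0) =
      Fintype.card (R × Fin M) * (M : ℝ) := by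
  have h1 : ∀ i : R × Fin M, ∑ j : R × Fin M, (if i.1 = j.1 then (1 : ℝ) else 0) = M := by
    intro i
    rw [Fintype.sum_prod_type, Finset.sum_comm]
    simp
  rw [Equiv.sum_comp π (fun i => ∑ j, if i.1 = (π j).1 then (1 : ℝ) else 0)]
  have h2 : ∀ i : R × Fin M, ∑ j, (if i.1 = (π j).1 then (1 : ℝ) else 0) = M := by
    intro i
    rw [Equiv.sum_comp π (fun j => if i.1 = j.1 then (1 : ℝ) else 0), h1]
  simp only [h2, Finset.sum_const, Finset.card_univ, nsmul_eq_mul]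

/-- The probability that two distinct points lie in the same block. -/
lemma exists_same_block_prob (hM : 0 < M) :
    ∃ ρ : ℝ, 0 ≤ ρ ∧ ρ * (Fintype.card (R × Fin M) - 1 : ℝ) ≤ M - 1 ∧
      ∀ i j : R × Fin M, i ≠ j →
        𝔼 π : Equiv.Perm (R × Fin M), (if (π i).1 = (π j).1 then (1 : ℝ) else 0) = ρ := by
  have hM1 : (1 : ℝ) ≤ M := by exact_mod_cast hM
  by_cases hne : ∃ i j : R × Fin M, i ≠ j
  swap
  · push Not at hne
    -- Without two distinct points, ρ = 0 is admissible because M ≥ 1.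
    refine ⟨0, le_rfl, by simpa using hM1, fun i j h => absurd (hne i j) h⟩
  obtain ⟨i₀, j₀, h₀⟩ := hne
  set ρ := 𝔼 π : Equiv.Perm (R × Fin M), (if (π i₀).1 = (π j₀).1 then (1 : ℝ) else 0) with hρ
  have hall : ∀ i j : R × Fin M, i ≠ j →
        𝔼 π : Equiv.Perm (R × Fin M), (if (π i).1 = (π j).1 then (1 : ℝ) else 0) = ρ := by
    intro i j hij
    -- Two-transitivity of the symmetric group carries one pair to the other, and right
    -- multiplication by τ preserves the uniform distribution.
    obtain ⟨τ, hτ1, hτ2⟩ := (MulAction.is_two_pretransitive_iff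
      (G := Equiv.Perm (R × Fin M)) (α := R × Fin M)).1
        (Equiv.Perm.isMultiplyPretransitive _ 2) h₀ hij
    rw [hρ]
    refine Fintype.expect_equiv (Equiv.mulRight τ) _ _ fun π => ?_
    simp only [Equiv.Perm.smul_def] at hτ1 hτ2
    simp [hτ1, hτ2]
  refine ⟨ρ, Finset.expect_nonneg fun _ _ => by split_ifs <;> norm_num, ?_, hall⟩
  set d : ℝ := ((Fintype.card (R × Fin M) : ℕ) : ℝ) with hd
  have hd0 : 0 < d := by
    rw [hd]; exact Nat.cast_pos.2 (Fintype.card_pos_iff.2 ⟨i₀⟩)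
  have h1 : 𝔼 π : Equiv.Perm (R × Fin M),
      ∑ i, ∑ j, (if (π i).1 = (π j).1 then (1 : ℝ) else 0) = d * M := by
    simp only [sum_same_block]
    exact Fintype.expect_const _
  have h2 : 𝔼 π : Equiv.Perm (R × Fin M),
      ∑ i, ∑ j, (if (π i).1 = (π j).1 then (1 : ℝ) else 0) = d * (1 + (d - 1) * ρ) := by
    rw [Finset.expect_sum_comm]
    have : ∀ i : R × Fin M, 𝔼 π : Equiv.Perm (R × Fin M),
        ∑ j, (if (π i).1 = (π j).1 then (1 : ℝ) else 0) = 1 + (d - 1) * ρ := by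
      intro i
      rw [Finset.expect_sum_comm, ← Finset.add_sum_erase _ _ (Finset.mem_univ i)]
      congr 1
      · simp
      · rw [Finset.sum_congr rfl (fun j hj => hall i j (Finset.ne_of_mem_erase hj).symm),
          Finset.sum_const, Finset.card_erase_of_mem (Finset.mem_univ i), nsmul_eq_mul,
          Finset.card_univ, Nat.cast_sub (Fintype.card_pos_iff.2 ⟨i₀⟩)]
        simp [hd]
    simp only [this, Finset.sum_const, Finset.card_univ, nsmul_eq_mul, hd]
  -- Two evaluations of the mean number of ordered pairs lying in a common block.
  have h3 : (1 + (d - 1) * ρ) = M := mul_left_cancel₀ hd0.ne' (h2.symm.trans h1)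
  linarith

/-- Only the pair probability ρ matters: the mean is S + ρ(T − S) with S = Σ|y i|² and T = |Σ y i|².
The sum T is kept separate, and not estimated through S, because it later becomes a trace or partial
trace of a traceless matrix. -/
lemma expect_blockSum_le (hM : 0 < M) (y : R × Fin M → ℂ) :
    𝔼 π : Equiv.Perm (R × Fin M), ∑ r, ‖∑ i, blockInd π i r * y i‖ ^ 2 ≤
      ∑ i, ‖y i‖ ^ 2 + (M - 1 : ℝ) / Fintype.card (R × Fin M) * ‖∑ i, y i‖ ^ 2 := by
  obtain ⟨ρ, hρ0, hρ1, hρ⟩ := exists_same_block_prob (R := R) hM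
  set d : ℝ := ((Fintype.card (R × Fin M) : ℕ) : ℝ) with hd
  set S := ∑ i, ‖y i‖ ^ 2 with hS
  set T := ‖∑ i, y i‖ ^ 2 with hT
  have hTS : T ≤ d * S := by
    have h1 : ‖∑ i, y i‖ ≤ ∑ i, ‖y i‖ := norm_sum_le _ _
    have h2 := sq_sum_le_card_mul_sum_sq (s := (Finset.univ : Finset (R × Fin M)))
      (f := fun i => ‖y i‖)
    rw [Finset.card_univ] at h2
    exact (pow_le_pow_left₀ (norm_nonneg _) h1 2).trans h2
  have hexp : ∀ π : Equiv.Perm (R × Fin M), ∑ r, ‖∑ i, blockInd π i r * y i‖ ^ 2 =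
      ∑ i, ∑ j, (if (π i).1 = (π j).1 then (1 : ℝ) else 0) * (y i * conj (y j)).re := by
    intro π
    have h1 : ∀ r, ‖∑ i, blockInd π i r * y i‖ ^ 2 =
        ∑ i, ∑ j, ((blockInd π i r * blockInd π j r) * (y i * conj (y j))).re := by
      intro r
      have : ((‖∑ i, blockInd π i r * y i‖ ^ 2 : ℝ) : ℂ) =
          ∑ i, ∑ j, (blockInd π i r * blockInd π j r) * (y i * conj (y j)) := by
        rw [← Complex.normSq_eq_norm_sq, ← Complex.mul_conj, map_sum, Finset.sum_mul_sum]
        refine Finset.sum_congr rfl fun i _ => Finset.sum_congr rfl fun j _ => ?_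
        have hc : conj (blockInd π j r) = blockInd π j r := by
          unfold blockInd; split_ifs <;> simp
        rw [map_mul, hc]; ring
      have h2 := congrArg Complex.re this
      rw [Complex.ofReal_re] at h2
      rw [h2]; simp only [Complex.re_sum]
    simp only [h1]
    rw [Finset.sum_comm]
    refine Finset.sum_congr rfl fun i _ => ?_
    rw [Finset.sum_comm]
    refine Finset.sum_congr rfl fun j _ => ?_
    rw [← Complex.re_sum, ← Finset.sum_mul]
    have : ∑ r, blockInd π i r * blockInd π j r = ((if (π i).1 = (π j).1 then (1 : ℝ) else 0 : ℝ) : ℂ) := by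
      simp only [blockInd, mul_ite, mul_one, mul_zero]
      rw [Finset.sum_ite_eq]; split_ifs <;> simp_all [eq_comm]
    rw [this, Complex.re_ofReal_mul]
  simp only [hexp]
  have hE : 𝔼 π : Equiv.Perm (R × Fin M),
      ∑ i, ∑ j, (if (π i).1 = (π j).1 then (1 : ℝ) else 0) * (y i * conj (y j)).re =
      S + ρ * (T - S) := by
    have hdiag : ∀ i, (y i * conj (y i)).re = ‖y i‖ ^ 2 := by
      intro i; rw [Complex.mul_conj, Complex.ofReal_re, Complex.normSq_eq_norm_sq]
    have hTsum : T = ∑ i, ∑ j, (y i * conj (y j)).re := by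
      have : ((T : ℝ) : ℂ) = ∑ i, ∑ j, y i * conj (y j) := by
        rw [hT, ← Complex.normSq_eq_norm_sq, ← Complex.mul_conj, map_sum, Finset.sum_mul_sum]
      have h2 := congrArg Complex.re this
      rw [Complex.ofReal_re] at h2
      rw [h2]; simp only [Complex.re_sum]
    have hi : ∀ i, 𝔼 π : Equiv.Perm (R × Fin M),
        ∑ j, (if (π i).1 = (π j).1 then (1 : ℝ) else 0) * (y i * conj (y j)).re =
        (1 - ρ) * ‖y i‖ ^ 2 + ρ * ∑ j, (y i * conj (y j)).re := by
      intro i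
      rw [Finset.expect_sum_comm]
      simp only [← Finset.expect_mul]
      rw [← Finset.add_sum_erase _ _ (Finset.mem_univ i),
        ← Finset.add_sum_erase _ (fun j => (y i * conj (y j)).re) (Finset.mem_univ i), hdiag,
        Finset.sum_congr rfl (fun j hj => by rw [hρ i j (Finset.ne_of_mem_erase hj).symm]),
        ← Finset.mul_sum]
      simp; ring
    rw [Finset.expect_sum_comm]
    simp only [hi]
    rw [Finset.sum_add_distrib, ← Finset.mul_sum, ← Finset.mul_sum, ← hS, ← hTsum]; ring
  rw [hE]
  rcases isEmpty_or_nonempty (R × Fin M) with hem | hne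
  · have hS0 : S = 0 := by simp [hS]
    have hT0 : T = 0 := by simp [hT]
    rw [hS0, hT0]; simp
  have hd0 : 0 < d := by
    rw [hd]; exact Nat.cast_pos.2 Fintype.card_pos
  have hT0 : 0 ≤ T := sq_nonneg _
  have h1 : T / d ≤ S := by rw [div_le_iff₀ hd0]; linarith
  -- Cauchy–Schwarz gives T/d ≤ S; with S replaced by T/d, the bound on ρ(d − 1) can be applied.
  have h2 : ρ * (T - S) ≤ ρ * (T - T / d) := mul_le_mul_of_nonneg_left (by linarith) hρ0
  have h3 : ρ * (T - T / d) = ρ * (d - 1) * (T / d) := by field_simp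
  have h4 : ρ * (d - 1) * (T / d) ≤ (M - 1) * (T / d) :=
    mul_le_mul_of_nonneg_right hρ1 (by positivity)
  have h5 : (M - 1 : ℝ) / d * T = (M - 1) * (T / d) := by ring
  linarith

end RandomPartition

/-! ### Random isometries onto block superpositions, and compression by them -/

section RandomIsometry

variable {R : Type*} [Fintype R] [DecidableEq R] {M : ℕ}

/-- The data of a random isometry `R → R × Fin M`: a random partition and random phases. -/
abbrev IsoSeed (R : Type*) (M : ℕ) : Type _ :=
  Equiv.Perm (R × Fin M) × (R × Fin M → ZMod 3)

/-- The isometry sending a basis vector to the superposition of its block, with phases. -/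
def blockIso (ω : IsoSeed R M) : Matrix (R × Fin M) R ℂ :=
  fun i r => ((√(M : ℝ))⁻¹ : ℝ) * (phase ω.2 i * blockInd ω.1 i r)

lemma blockIso_isometry (hM : 0 < M) (ω : IsoSeed R M) :
    (blockIso ω)ᴴ * blockIso ω = 1 := by
  ext r r'
  have hM0 : (M : ℂ) ≠ 0 := by exact_mod_cast hM.ne'
  have hs : (((√(M : ℝ))⁻¹ : ℝ) : ℂ) * (((√(M : ℝ))⁻¹ : ℝ) : ℂ) = (M : ℂ)⁻¹ := by
    rw [← Complex.ofReal_mul, ← mul_inv, Real.mul_self_sqrt (Nat.cast_nonneg _)]; simp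
  have h1 : ∀ i, conj (blockIso ω i r) * blockIso ω i r' =
      (M : ℂ)⁻¹ * (if (ω.1 i).1 = r ∧ r = r' then 1 else 0) := by
    intro i
    unfold blockIso
    have hp := phase_mul_conj ω.2 i
    rw [map_mul, map_mul, Complex.conj_ofReal]
    have hc : conj (blockInd ω.1 i r) * blockInd ω.1 i r' =
        if (ω.1 i).1 = r ∧ r = r' then 1 else 0 := by
      unfold blockInd
      by_cases h1 : (ω.1 i).1 = r
      · by_cases h2 : r = r'
        · simp [h1, h2]
        · simp [h1, h2]
      · simp [h1]
    rw [← hc, ← hs]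
    linear_combination ((((√(M : ℝ))⁻¹ : ℝ) : ℂ) * (((√(M : ℝ))⁻¹ : ℝ) : ℂ) *
      (conj (blockInd ω.1 i r) * blockInd ω.1 i r')) * hp
  rw [Matrix.mul_apply]
  simp only [Matrix.conjTranspose_apply, Complex.star_def, h1, ← Finset.mul_sum]
  rw [Equiv.sum_comp ω.1 (fun i => if i.1 = r ∧ r = r' then (1 : ℂ) else 0), Fintype.sum_prod_type,
    Finset.sum_comm]
  by_cases h : r = r'
  · subst h; simp [hM0]
  · simp [h]

/-- The compression of a kernel by the random isometry. -/
def squeeze (ω : IsoSeed R M) (x : R × Fin M → R × Fin M → ℂ) (r r' : R) : ℂ :=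
  ∑ i, ∑ k, conj (blockIso ω i r) * x i k * blockIso ω k r'

/-- Centring the phases isolates a mean-zero part. What remains comes from the diagonal of `x` and
survives only for r = r', since the blocks are disjoint. -/
lemma squeeze_eq (π : Equiv.Perm (R × Fin M)) (s : R × Fin M → ZMod 3)
    (x : R × Fin M → R × Fin M → ℂ) (r r' : R) :
    squeeze (π, s) x r r' = (M : ℂ)⁻¹ *
      ((∑ p : (R × Fin M) × (R × Fin M), phaseDev s p *
          (blockInd π p.2 r * blockInd π p.1 r' * x p.2 p.1)) +
        if r = r' then ∑ i, blockInd π i r * x i i else 0) := by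
  have hs : (((√(M : ℝ))⁻¹ : ℝ) : ℂ) * (((√(M : ℝ))⁻¹ : ℝ) : ℂ) = (M : ℂ)⁻¹ := by
    rw [← Complex.ofReal_mul, ← mul_inv, Real.mul_self_sqrt (Nat.cast_nonneg _)]; simp
  have hc : ∀ i r, conj (blockInd π i r) = blockInd π i r := by
    intro i r; unfold blockInd; split_ifs <;> simp
  have h1 : squeeze (π, s) x r r' = (M : ℂ)⁻¹ * ∑ k, ∑ i,
      phase s k * conj (phase s i) * (blockInd π i r * blockInd π k r' * x i k) := by
    rw [squeeze, Finset.sum_comm, Finset.mul_sum]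
    refine Finset.sum_congr rfl fun k _ => ?_
    rw [Finset.mul_sum]
    refine Finset.sum_congr rfl fun i _ => ?_
    unfold blockIso
    rw [map_mul, map_mul, hc, Complex.conj_ofReal, ← hs]; ring
  rw [h1]
  congr 1
  have h2 : ∀ k i, phase s k * conj (phase s i) = phaseDev s (k, i) + if k = i then 1 else 0 := by
    intro k i; simp [phaseDev]
  simp only [h2, add_mul, Finset.sum_add_distrib]
  rw [Fintype.sum_prod_type (fun p : (R × Fin M) × (R × Fin M) => phaseDev s p *
    (blockInd π p.2 r * blockInd π p.1 r' * x p.2 p.1))]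
  congr 1
  simp only [ite_mul, one_mul, zero_mul, Finset.sum_ite_eq, Finset.mem_univ, if_true]
  by_cases h : r = r'
  · subst h
    rw [if_pos rfl]
    refine Finset.sum_congr rfl fun i _ => ?_
    unfold blockInd; split_ifs <;> simp
  · rw [if_neg h]
    refine Finset.sum_eq_zero fun i _ => ?_
    unfold blockInd
    by_cases h1 : (π i).1 = r
    · simp [h1, h]
    · simp [h1]

/-- The deviations have mean zero, so the cross term with the constant vanishes. -/
lemma expect_norm_sq_add_const {J I : Type*} [Fintype J] [DecidableEq J] [Fintype I]
    {p : I → J × J} (c : I → ℂ) (b : ℂ) :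
    𝔼 s, ‖(∑ i, phaseDev s (p i) * c i) + b‖ ^ 2 =
      𝔼 s, ‖∑ i, phaseDev s (p i) * c i‖ ^ 2 + ‖b‖ ^ 2 := by
  have h0 : 𝔼 s, (∑ i, phaseDev s (p i) * c i) = 0 := by
    rw [Finset.expect_sum_comm]
    simp [← Finset.expect_mul, expect_phaseDev]
  have h1 : ∀ s : J → ZMod 3, ‖(∑ i, phaseDev s (p i) * c i) + b‖ ^ 2 =
      ‖∑ i, phaseDev s (p i) * c i‖ ^ 2 + ‖b‖ ^ 2 +
        2 * ((∑ i, phaseDev s (p i) * c i) * conj b).re := by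
    intro s
    rw [← Complex.normSq_eq_norm_sq, Complex.normSq_add, Complex.normSq_eq_norm_sq,
      Complex.normSq_eq_norm_sq]
  simp only [h1]
  rw [Finset.expect_add_distrib, Finset.expect_add_distrib, Fintype.expect_const,
    ← Finset.mul_expect]
  have h2 : 𝔼 s : J → ZMod 3, ((∑ i, phaseDev s (p i) * c i) * conj b).re = 0 := by
    rw [← Complex.re_expect, ← Finset.expect_mul, h0]; simp
  rw [h2]; ring

lemma norm_sq_blockInd_sum (π : Equiv.Perm (R × Fin M)) (i : R × Fin M) :
    ∑ r, ‖blockInd π i r‖ ^ 2 = 1 := by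
  have : ∀ r, ‖blockInd π i r‖ ^ 2 = if (π i).1 = r then (1 : ℝ) else 0 := by
    intro r; unfold blockInd; split_ifs <;> simp
  simp [this]

/-- The partition is fixed here. Each off-diagonal entry of `x` lands in exactly one pair of blocks
and is counted once; the diagonal enters only through its block sums. -/
lemma expect_phase_squeeze (π : Equiv.Perm (R × Fin M)) (x : R × Fin M → R × Fin M → ℂ) :
    𝔼 s, ∑ r, ∑ r', ‖squeeze (π, s) x r r'‖ ^ 2 = ((M : ℝ) ^ 2)⁻¹ *
      ((∑ p : (R × Fin M) × (R × Fin M), if p.1 ≠ p.2 then ‖x p.2 p.1‖ ^ 2 else 0) +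
        ∑ r, ‖∑ i, blockInd π i r * x i i‖ ^ 2) := by
  have h1 : ∀ r r', 𝔼 s, ‖squeeze (π, s) x r r'‖ ^ 2 = ((M : ℝ) ^ 2)⁻¹ *
      ((∑ p : (R × Fin M) × (R × Fin M), if p.1 ≠ p.2 then
        ‖blockInd π p.2 r‖ ^ 2 * ‖blockInd π p.1 r'‖ ^ 2 * ‖x p.2 p.1‖ ^ 2 else 0) +
        if r = r' then ‖∑ i, blockInd π i r * x i i‖ ^ 2 else 0) := by
    intro r r'
    simp only [squeeze_eq, norm_mul, mul_pow]
    rw [← Finset.mul_expect, expect_norm_sq_add_const (p := fun p => p),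
      expect_norm_sq_phaseDev (p := fun p => p) fun _ _ h => h]
    congr 1
    · simp
    · congr 1
      · refine Finset.sum_congr rfl fun p _ => ?_
        simp [mul_pow]
      · split_ifs <;> simp
  rw [Finset.expect_sum_comm]
  simp only [Finset.expect_sum_comm _ (Finset.univ : Finset R), h1]
  simp only [← Finset.mul_sum, Finset.sum_add_distrib]
  congr 2
  · have h2 : ∀ r : R, ∑ r', (∑ p : (R × Fin M) × (R × Fin M), if p.1 ≠ p.2 then
        ‖blockInd π p.2 r‖ ^ 2 * ‖blockInd π p.1 r'‖ ^ 2 * ‖x p.2 p.1‖ ^ 2 else 0) =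
        ∑ p : (R × Fin M) × (R × Fin M), if p.1 ≠ p.2 then
          ‖blockInd π p.2 r‖ ^ 2 * ‖x p.2 p.1‖ ^ 2 else 0 := by
      intro r
      rw [Finset.sum_comm]
      refine Finset.sum_congr rfl fun p _ => ?_
      split_ifs
      · rw [← Finset.sum_mul, ← Finset.mul_sum, norm_sq_blockInd_sum, mul_one]
      · simp
    simp only [h2]
    rw [Finset.sum_comm]
    refine Finset.sum_congr rfl fun p _ => ?_
    split_ifs
    · rw [← Finset.sum_mul, norm_sq_blockInd_sum, one_mul]
    · simp
  · simp

lemma expect_prod {S T : Type*} [Fintype S] [Fintype T] (f : S × T → ℝ) :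
    𝔼 ω, f ω = 𝔼 s, 𝔼 t, f (s, t) := by
  rw [← Finset.univ_product_univ, Finset.expect_product]

lemma expect_prod_complex {S T : Type*} [Fintype S] [Fintype T] (f : S × T → ℂ) :
    𝔼 ω, f ω = 𝔼 s, 𝔼 t, f (s, t) := by
  rw [← Finset.univ_product_univ, Finset.expect_product]

/-- Second moment of a random compression. -/
lemma expect_squeeze_le (hM : 0 < M) (x : R × Fin M → R × Fin M → ℂ) :
    𝔼 ω : IsoSeed R M, ∑ r, ∑ r', ‖squeeze ω x r r'‖ ^ 2 ≤ ((M : ℝ) ^ 2)⁻¹ *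
      (∑ i, ∑ k, ‖x i k‖ ^ 2 +
        (M - 1 : ℝ) / Fintype.card (R × Fin M) * ‖∑ i, x i i‖ ^ 2) := by
  rw [expect_prod]
  simp only [expect_phase_squeeze]
  rw [← Finset.mul_expect, Finset.expect_add_distrib, Fintype.expect_const]
  refine mul_le_mul_of_nonneg_left ?_ (by positivity)
  -- The partition affects only the diagonal block sums; the squares this produces complete the
  -- off-diagonal sum to all entries.
  have h1 := expect_blockSum_le (R := R) hM (fun i => x i i)
  have h2 : (∑ p : (R × Fin M) × (R × Fin M), if p.1 ≠ p.2 then ‖x p.2 p.1‖ ^ 2 else 0) +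
      ∑ i, ‖x i i‖ ^ 2 = ∑ i, ∑ k, ‖x i k‖ ^ 2 := by
    rw [Fintype.sum_prod_type (fun p : (R × Fin M) × (R × Fin M) =>
      if p.1 ≠ p.2 then ‖x p.2 p.1‖ ^ 2 else 0), Finset.sum_comm, ← Finset.sum_add_distrib]
    refine Finset.sum_congr rfl fun i _ => ?_
    rw [← Finset.sum_erase_add _ _ (Finset.mem_univ i),
      ← Finset.sum_erase_add _ (fun k => ‖x i k‖ ^ 2) (Finset.mem_univ i)]
    simp only [ne_eq, not_true_eq_false, if_false, add_zero]
    congr 1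
    refine Finset.sum_congr rfl fun k hk => ?_
    rw [if_pos (Finset.ne_of_mem_erase hk)]
  linarith

lemma expect_trace_squeeze (x : R × Fin M → R × Fin M → ℂ) :
    𝔼 ω : IsoSeed R M, ∑ r, squeeze ω x r r = (M : ℂ)⁻¹ * ∑ i, x i i := by
  rw [expect_prod_complex]
  have h1 : ∀ π : Equiv.Perm (R × Fin M),
      𝔼 s, ∑ r, squeeze (π, s) x r r = (M : ℂ)⁻¹ * ∑ i, x i i := by
    intro π
    rw [Finset.expect_sum_comm]
    simp only [squeeze_eq, if_true]
    have h2 : ∀ r, 𝔼 s : R × Fin M → ZMod 3, (M : ℂ)⁻¹ *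
        ((∑ p : (R × Fin M) × (R × Fin M), phaseDev s p *
          (blockInd π p.2 r * blockInd π p.1 r * x p.2 p.1)) + ∑ i, blockInd π i r * x i i) =
        (M : ℂ)⁻¹ * ∑ i, blockInd π i r * x i i := by
      intro r
      rw [← Finset.mul_expect, Finset.expect_add_distrib, Fintype.expect_const,
        Finset.expect_sum_comm]
      simp [← Finset.expect_mul, expect_phaseDev]
    simp only [h2]
    rw [← Finset.mul_sum, Finset.sum_comm]
    simp only [← Finset.sum_mul, sum_blockInd, one_mul]
  simp only [h1]
  exact Fintype.expect_const _

end RandomIsometry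

/-! ### Product compressions of a traceless matrix -/

section Product

variable {R S : Type*} [Fintype R] [DecidableEq R] [Fintype S] [DecidableEq S] {M : ℕ}

lemma trace_mul_kronecker_one {A B : Type*} [Fintype A] [Fintype B]
    [DecidableEq B] (X : Matrix (A × B) (A × B) ℂ) (P : Matrix A A ℂ) :
    (X * (P ⊗ₖ (1 : Matrix B B ℂ))).trace = (traceSnd X * P).trace := by
  simp only [Matrix.trace, Matrix.diag_apply, Matrix.mul_apply, Fintype.sum_prod_type, traceSnd,
    Finset.sum_mul]
  refine Finset.sum_congr rfl fun i _ => ?_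
  rw [Finset.sum_comm]
  refine Finset.sum_congr rfl fun k _ => ?_
  refine Finset.sum_congr rfl fun j _ => ?_
  simp [Matrix.one_apply]

lemma trace_mul_one_kronecker {A B : Type*} [Fintype A] [DecidableEq A] [Fintype B]
    (X : Matrix (A × B) (A × B) ℂ) (Q : Matrix B B ℂ) :
    (X * ((1 : Matrix A A ℂ) ⊗ₖ Q)).trace = (traceFst X * Q).trace := by
  simp only [Matrix.trace, Matrix.diag_apply, Matrix.mul_apply, Fintype.sum_prod_type, traceFst,
    Finset.sum_mul]
  rw [Finset.sum_comm]
  refine Finset.sum_congr rfl fun i _ => ?_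
  rw [Finset.sum_comm]
  conv_rhs => rw [Finset.sum_comm]
  rw [Finset.sum_comm]
  refine Finset.sum_congr rfl fun k _ => ?_
  rw [Finset.sum_comm]
  refine Finset.sum_congr rfl fun j _ => ?_
  simp [Matrix.one_apply]

/-- The squared norms of the two partial traces of a traceless matrix, suitably normalised, add up
to at most its squared Frobenius norm. -/
lemma sum_norm_sq_partialTrace_le {A B : Type*} [Fintype A] [DecidableEq A] [Fintype B]
    [DecidableEq B] [Nonempty A] [Nonempty B] (X : Matrix (A × B) (A × B) ℂ) (hX : X.trace = 0) :
    (∑ i, ∑ k, ‖∑ j, X (i, j) (k, j)‖ ^ 2) / Fintype.card B +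
      (∑ j, ∑ l, ‖∑ i, X (i, j) (i, l)‖ ^ 2) / Fintype.card A ≤ frobSq X := by
  set P : Matrix A A ℂ := fun i k => ∑ j, X (i, j) (k, j) with hP
  set Q : Matrix B B ℂ := fun j l => ∑ i, X (i, j) (i, l) with hQ
  have ha : (0 : ℝ) < Fintype.card A := by exact_mod_cast Fintype.card_pos
  have hb : (0 : ℝ) < Fintype.card B := by exact_mod_cast Fintype.card_pos
  have hPt : P.trace = 0 := by
    rw [← hX, Matrix.trace, Matrix.trace, Fintype.sum_prod_type]; rfl
  have hQt : Q.trace = 0 := by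
    rw [← hX, Matrix.trace, Matrix.trace, Fintype.sum_prod_type, Finset.sum_comm]; rfl
  set a : ℂ := (Fintype.card A : ℂ) with hacard
  set b : ℂ := (Fintype.card B : ℂ) with hbcard
  have ha0 : a ≠ 0 := by rw [hacard]; exact_mod_cast Fintype.card_ne_zero
  have hb0 : b ≠ 0 := by rw [hbcard]; exact_mod_cast Fintype.card_ne_zero
  -- As X is traceless, so are P and Q, and the two summands are orthogonal. Y is the component of X
  -- among the matrices P' ⊗ 1 + 1 ⊗ Q', and the claim is ‖Y‖² ≤ ‖X‖².
  set Y : Matrix (A × B) (A × B) ℂ := b⁻¹ • (P ⊗ₖ (1 : Matrix B B ℂ)) + a⁻¹ • ((1 : Matrix A A ℂ) ⊗ₖ Q)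
    with hY
  have hXY : (X * Yᴴ).trace = (b⁻¹ * frobSq P + a⁻¹ * frobSq Q : ℂ) := by
    simp only [hY, Matrix.conjTranspose_add, Matrix.conjTranspose_smul,
      Matrix.conjTranspose_kronecker, Matrix.conjTranspose_one, Matrix.mul_add, Matrix.mul_smul,
      Matrix.trace_add, Matrix.trace_smul, trace_mul_kronecker_one, trace_mul_one_kronecker,
      smul_eq_mul]
    rw [← trace_mul_conjTranspose_eq_frobSq, ← trace_mul_conjTranspose_eq_frobSq]
    simp [hacard, hbcard]; rfl
  have hYX : (Y * Xᴴ).trace = (b⁻¹ * frobSq P + a⁻¹ * frobSq Q : ℂ) := by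
    have h := congrArg star hXY
    rw [← Matrix.trace_conjTranspose, Matrix.conjTranspose_mul,
      Matrix.conjTranspose_conjTranspose] at h
    rw [h]; simp [hacard, hbcard]
  have hYY : (Y * Yᴴ).trace = (b⁻¹ * frobSq P + a⁻¹ * frobSq Q : ℂ) := by
    simp only [hY, Matrix.conjTranspose_add, Matrix.conjTranspose_smul,
      Matrix.conjTranspose_kronecker, Matrix.conjTranspose_one, Matrix.mul_add, Matrix.mul_smul,
      Matrix.add_mul, Matrix.smul_mul,
      Matrix.trace_add, Matrix.trace_smul, smul_eq_mul, ← Matrix.mul_kronecker_mul, Matrix.one_mul,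
      Matrix.mul_one, Matrix.trace_kronecker, hPt, hQt, Matrix.trace_conjTranspose,
      Matrix.trace_one, trace_mul_conjTranspose_eq_frobSq]
    simp only [← hacard, ← hbcard]
    have h1 : star a = a := by simp [hacard]
    have h2 : star b = b := by simp [hbcard]
    simp only [star_inv₀, h1, h2]
    field_simp
    simp
  have h := trace_mul_conjTranspose_eq_frobSq (X - Y)
  rw [Matrix.conjTranspose_sub, Matrix.sub_mul, Matrix.mul_sub, Matrix.mul_sub, Matrix.trace_sub,
    Matrix.trace_sub, Matrix.trace_sub, hXY, hYX, hYY, trace_mul_conjTranspose_eq_frobSq] at h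
  have h' : frobSq X - (frobSq P / Fintype.card B + frobSq Q / Fintype.card A) =
      frobSq (X - Y) := by
    have : ((frobSq X - (frobSq P / Fintype.card B + frobSq Q / Fintype.card A) : ℝ) : ℂ) =
        (frobSq (X - Y) : ℂ) := by
      rw [← h]; push_cast; rw [← hacard, ← hbcard]; ring
    exact_mod_cast this
  have h0 := frobSq_nonneg (X - Y)
  have e1 : ∑ i, ∑ k, ‖∑ j, X (i, j) (k, j)‖ ^ 2 = frobSq P := rfl
  have e2 : ∑ j, ∑ l, ‖∑ i, X (i, j) (i, l)‖ ^ 2 = frobSq Q := rfl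
  rw [e1, e2]
  linarith

lemma compress_apply (ω : IsoSeed R M) (ω' : IsoSeed S M)
    (X : Matrix ((R × Fin M) × (S × Fin M)) ((R × Fin M) × (S × Fin M)) ℂ) (p q : R × S) :
    ((blockIso ω ⊗ₖ blockIso ω')ᴴ * X * (blockIso ω ⊗ₖ blockIso ω')) p q =
      squeeze ω (fun i k => squeeze ω' (fun j l => X (i, j) (k, l)) p.2 q.2) p.1 q.1 := by
  rw [Matrix.mul_assoc, Matrix.mul_apply]
  simp only [Matrix.mul_apply, squeeze, Matrix.conjTranspose_apply, Finset.mul_sum, Finset.sum_mul,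
    Matrix.kroneckerMap_apply]
  rw [Fintype.sum_prod_type (γ := ℂ) (α₁ := R × Fin M)]
  refine Finset.sum_congr rfl fun i _ => ?_
  simp only [Fintype.sum_prod_type (γ := ℂ) (α₁ := R × Fin M) (α₂ := S × Fin M)]
  rw [Finset.sum_comm]
  refine Finset.sum_congr rfl fun k _ => ?_
  refine Finset.sum_congr rfl fun j _ => ?_
  refine Finset.sum_congr rfl fun l _ => ?_
  simp only [Complex.star_def, map_mul]
  ring

/-- Random product compressions of a traceless matrix are small. -/
lemma expect_compress_le (hM : 0 < M) [Nonempty R] [Nonempty S]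
    (X : Matrix ((R × Fin M) × (S × Fin M)) ((R × Fin M) × (S × Fin M)) ℂ) (hX : X.trace = 0) :
    𝔼 ω' : IsoSeed S M, 𝔼 ω : IsoSeed R M,
      frobSq ((blockIso ω ⊗ₖ blockIso ω')ᴴ * X * (blockIso ω ⊗ₖ blockIso ω')) ≤
        frobSq X / M ^ 3 := by
  have : NeZero M := ⟨hM.ne'⟩
  have hM0 : (0 : ℝ) < M := by exact_mod_cast hM
  have hM1 : (1 : ℝ) ≤ M := by exact_mod_cast hM
  set dA : ℝ := ((Fintype.card (R × Fin M) : ℕ) : ℝ) with hdA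
  set dB : ℝ := ((Fintype.card (S × Fin M) : ℕ) : ℝ) with hdB
  have hdA0 : 0 < dA := by rw [hdA]; exact Nat.cast_pos.2 Fintype.card_pos
  have hdB0 : 0 < dB := by rw [hdB]; exact Nat.cast_pos.2 Fintype.card_pos
  -- The two local compressions are averaged in turn. A matrix P ⊗ 1 shows that for product
  -- compressions the power M⁻³, rather than M⁻⁴, is the right order.
  have h1 : ∀ ω' : IsoSeed S M, 𝔼 ω : IsoSeed R M,
      frobSq ((blockIso ω ⊗ₖ blockIso ω')ᴴ * X * (blockIso ω ⊗ₖ blockIso ω')) ≤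
      ((M : ℝ) ^ 2)⁻¹ * (∑ i, ∑ k, ∑ s, ∑ s', ‖squeeze ω' (fun j l => X (i, j) (k, l)) s s'‖ ^ 2 +
        (M - 1 : ℝ) / dA * ∑ s, ∑ s', ‖squeeze ω' (fun j l => ∑ i, X (i, j) (i, l)) s s'‖ ^ 2) := by
    intro ω'
    have h2 : ∀ ω : IsoSeed R M,
        frobSq ((blockIso ω ⊗ₖ blockIso ω')ᴴ * X * (blockIso ω ⊗ₖ blockIso ω')) =
        ∑ s, ∑ s', ∑ r, ∑ r',
          ‖squeeze ω (fun i k => squeeze ω' (fun j l => X (i, j) (k, l)) s s') r r'‖ ^ 2 := by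
      intro ω
      simp only [frobSq, compress_apply, Fintype.sum_prod_type]
      rw [Finset.sum_comm]
      refine Finset.sum_congr rfl fun s _ => ?_
      conv_rhs => rw [Finset.sum_comm]
      refine Finset.sum_congr rfl fun r _ => ?_
      rw [Finset.sum_comm]
    have h3 : ∀ s s', ∑ i, squeeze ω' (fun j l => X (i, j) (i, l)) s s' =
        squeeze ω' (fun j l => ∑ i, X (i, j) (i, l)) s s' := by
      intro s s'
      simp only [squeeze, Finset.mul_sum, Finset.sum_mul]
      rw [Finset.sum_comm]
      refine Finset.sum_congr rfl fun j _ => ?_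
      rw [Finset.sum_comm]
    simp only [h2]
    simp only [Finset.expect_sum_comm _ (Finset.univ : Finset S)]
    refine (Finset.sum_le_sum fun s _ => Finset.sum_le_sum fun s' _ =>
      expect_squeeze_le hM _).trans (le_of_eq ?_)
    simp only [h3, ← Finset.mul_sum, Finset.sum_add_distrib]
    congr 2
    have e1 : ∀ F : S → S → (R × Fin M) → (R × Fin M) → ℝ,
        ∑ s, ∑ s', ∑ i, ∑ k, F s s' i k = ∑ i, ∑ k, ∑ s, ∑ s', F s s' i k := by
      intro F
      have : ∀ s, ∑ s', ∑ i, ∑ k, F s s' i k = ∑ i, ∑ k, ∑ s', F s s' i k := by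
        intro s
        rw [Finset.sum_comm]
        refine Finset.sum_congr rfl fun i _ => ?_
        rw [Finset.sum_comm]
      simp only [this]
      rw [Finset.sum_comm]
      refine Finset.sum_congr rfl fun i _ => ?_
      rw [Finset.sum_comm]
    exact e1 _
  refine (Finset.expect_le_expect fun ω' _ => h1 ω').trans ?_
  rw [← Finset.mul_expect, Finset.expect_add_distrib, ← Finset.mul_expect]
  have h4 : 𝔼 ω' : IsoSeed S M, ∑ i, ∑ k, ∑ s, ∑ s',
      ‖squeeze ω' (fun j l => X (i, j) (k, l)) s s'‖ ^ 2 ≤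
      ((M : ℝ) ^ 2)⁻¹ * (frobSq X + (M - 1 : ℝ) / dB * ∑ i, ∑ k, ‖∑ j, X (i, j) (k, j)‖ ^ 2) := by
    rw [Finset.expect_sum_comm]
    simp only [Finset.expect_sum_comm _ (Finset.univ : Finset (R × Fin M))]
    refine (Finset.sum_le_sum fun i _ => Finset.sum_le_sum fun k _ =>
      expect_squeeze_le hM _).trans (le_of_eq ?_)
    simp only [← Finset.mul_sum, Finset.sum_add_distrib]
    congr 2
    simp only [frobSq]
    rw [Fintype.sum_prod_type (γ := ℝ) (α₁ := R × Fin M)]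
    refine Finset.sum_congr rfl fun i _ => ?_
    rw [Finset.sum_comm]
    refine Finset.sum_congr rfl fun j _ => ?_
    rw [Fintype.sum_prod_type (γ := ℝ) (α₁ := R × Fin M)]
  -- Here the full trace of X appears, and it is zero.
  have h5 : 𝔼 ω' : IsoSeed S M, ∑ s, ∑ s',
      ‖squeeze ω' (fun j l => ∑ i, X (i, j) (i, l)) s s'‖ ^ 2 ≤
      ((M : ℝ) ^ 2)⁻¹ * ∑ j, ∑ l, ‖∑ i, X (i, j) (i, l)‖ ^ 2 := by
    refine (expect_squeeze_le hM _).trans (le_of_eq ?_)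
    have : ∑ j, ∑ i, X (i, j) (i, j) = 0 := by
      rw [Finset.sum_comm, ← hX, Matrix.trace,
        Fintype.sum_prod_type (γ := ℂ) (α₁ := R × Fin M)]
      rfl
    rw [this]; simp
  have h6 := sum_norm_sq_partialTrace_le X hX
  set P := ∑ i, ∑ k, ‖∑ j, X (i, j) (k, j)‖ ^ 2
  set Q := ∑ j, ∑ l, ‖∑ i, X (i, j) (i, l)‖ ^ 2
  have h7 : (M - 1 : ℝ) / dA * 𝔼 ω' : IsoSeed S M, ∑ s, ∑ s',
      ‖squeeze ω' (fun j l => ∑ i, X (i, j) (i, l)) s s'‖ ^ 2 ≤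
      (M - 1 : ℝ) / dA * (((M : ℝ) ^ 2)⁻¹ * Q) :=
    mul_le_mul_of_nonneg_left h5 (div_nonneg (by linarith) hdA0.le)
  refine (mul_le_mul_of_nonneg_left (add_le_add h4 h7) (by positivity)).trans ?_
  -- Both partial trace terms together cost at most (M − 1)‖X‖². With ‖X‖² itself this makes M‖X‖²,
  -- which lowers M⁻⁴ to M⁻³.
  have h8 : (M - 1 : ℝ) * (P / dB + Q / dA) ≤ (M - 1) * frobSq X :=
    mul_le_mul_of_nonneg_left h6 (by linarith)
  have e : ((M : ℝ) ^ 2)⁻¹ * (((M : ℝ) ^ 2)⁻¹ * (frobSq X + (M - 1 : ℝ) / dB * P) +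
      (M - 1 : ℝ) / dA * (((M : ℝ) ^ 2)⁻¹ * Q)) =
      ((M : ℝ) ^ 4)⁻¹ * (frobSq X + (M - 1) * (P / dB + Q / dA)) := by
    field_simp
    ring
  rw [e]
  have e2 : frobSq X / (M : ℝ) ^ 3 = ((M : ℝ) ^ 4)⁻¹ * (frobSq X + (M - 1) * frobSq X) := by
    field_simp; ring
  rw [e2]
  exact mul_le_mul_of_nonneg_left (by linarith) (by positivity)

/-- Needed because the error of a subcode contains a term linear in the trace of the compression,
which has to disappear on average. -/
lemma expect_trace_compress
    (X : Matrix ((R × Fin M) × (S × Fin M)) ((R × Fin M) × (S × Fin M)) ℂ) (hX : X.trace = 0) :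
    𝔼 ω' : IsoSeed S M, 𝔼 ω : IsoSeed R M,
      ((blockIso ω ⊗ₖ blockIso ω')ᴴ * X * (blockIso ω ⊗ₖ blockIso ω')).trace = 0 := by
  have h1 : ∀ ω' : IsoSeed S M, 𝔼 ω : IsoSeed R M,
      ((blockIso ω ⊗ₖ blockIso ω')ᴴ * X * (blockIso ω ⊗ₖ blockIso ω')).trace =
      (M : ℂ)⁻¹ * ∑ s, squeeze ω' (fun j l => ∑ i, X (i, j) (i, l)) s s := by
    intro ω'
    have h2 : ∀ ω : IsoSeed R M,
        ((blockIso ω ⊗ₖ blockIso ω')ᴴ * X * (blockIso ω ⊗ₖ blockIso ω')).trace =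
        ∑ s, ∑ r, squeeze ω (fun i k => squeeze ω' (fun j l => X (i, j) (k, l)) s s) r r := by
      intro ω
      simp only [Matrix.trace, Matrix.diag_apply, compress_apply, Fintype.sum_prod_type]
      rw [Finset.sum_comm]
    simp only [h2]
    rw [Finset.expect_sum_comm]
    simp only [expect_trace_squeeze]
    rw [← Finset.mul_sum]
    congr 1
    refine Finset.sum_congr rfl fun s _ => ?_
    simp only [squeeze, Finset.mul_sum, Finset.sum_mul]
    rw [Finset.sum_comm]
    refine Finset.sum_congr rfl fun j _ => ?_
    rw [Finset.sum_comm]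
  simp only [h1]
  rw [← Finset.mul_expect, expect_trace_squeeze]
  have : ∑ j, ∑ i, X (i, j) (i, j) = 0 := by
    rw [Finset.sum_comm, ← hX, Matrix.trace, Fintype.sum_prod_type (γ := ℂ) (α₁ := R × Fin M)]
    rfl
  rw [this]; simp

end Product

/-! ### Invariance of the Frobenius norm under isometries -/

section Invariance

variable {m n p : Type*} [Fintype m] [Fintype n] [Fintype p]

lemma frobSq_isometry_mul [DecidableEq n] {B : Matrix m n ℂ} (hB : Bᴴ * B = 1)
    (A : Matrix n p ℂ) : frobSq (B * A) = frobSq A := by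
  have h := trace_conjTranspose_mul_eq_frobSq (B * A)
  rw [Matrix.conjTranspose_mul, Matrix.mul_assoc, ← Matrix.mul_assoc Bᴴ, hB, Matrix.one_mul,
    trace_conjTranspose_mul_eq_frobSq] at h
  exact_mod_cast h.symm

lemma frobSq_mul_coisometry [DecidableEq n] {C : Matrix n p ℂ} (hC : C * Cᴴ = 1)
    (A : Matrix m n ℂ) : frobSq (A * C) = frobSq A := by
  rw [← frobSq_conjTranspose, Matrix.conjTranspose_mul,
    frobSq_isometry_mul (by rw [Matrix.conjTranspose_conjTranspose, hC]), frobSq_conjTranspose]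

lemma frobSq_diagonal [DecidableEq n] (d : n → ℝ) :
    frobSq (Matrix.diagonal (fun i => (d i : ℂ))) = ∑ i, d i ^ 2 := by
  have h := trace_mul_conjTranspose_eq_frobSq (Matrix.diagonal (fun i => (d i : ℂ)))
  rw [Matrix.diagonal_conjTranspose, Matrix.diagonal_mul_diagonal, Matrix.trace_diagonal] at h
  have h2 : ((∑ i, d i ^ 2 : ℝ) : ℂ) = (frobSq (Matrix.diagonal (fun i => (d i : ℂ))) : ℂ) := by
    rw [← h]; push_cast; simp [sq]
  exact_mod_cast h2.symm

end Invariance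

/-! ### Smoothing an input state by a contraction -/

section Truncation

variable {a : Type*} [Fintype a] [DecidableEq a]

/-- A smoothing of a state can be realised by a contraction commuting with the state. -/
lemma exists_truncation {ρ α : Matrix a a ℂ} (hρ : ρ.PosSemidef) (hρ1 : ρ.trace.re = 1)
    (hα : α.PosSemidef) {ε : ℝ} (h : traceNorm (α - ρ) ≤ ε) :
    ∃ K : Matrix a a ℂ, K.IsHermitian ∧ (1 - K * K).PosSemidef ∧
      1 - ε ≤ (K * ρ * K).trace.re ∧ frobSq (K * ρ * K) ≤ frobSq α := by
  obtain ⟨U, hU1, hU2, hρU⟩ := exists_diagonalization hρ.isHermitian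
  set r := hρ.isHermitian.eigenvalues with hr
  have hr0 : ∀ i, 0 ≤ r i := hρ.eigenvalues_nonneg
  set p : a → ℝ := fun i => ((Uᴴ * α * U) i i).re with hp
  have hp0 : ∀ i, 0 ≤ p i := fun i =>
    PosSemidef.re_diag_nonneg (hα.conjTranspose_mul_mul_same U) i
  -- p is the diagonal of α in an eigenbasis of ρ. Capping it by the eigenvalues r makes √(q/r) at
  -- most one; where r i = 0 also q i = 0, so the default value of the quotient does no harm.
  set q : a → ℝ := fun i => min (p i) (r i) with hq
  have hq0 : ∀ i, 0 ≤ q i := fun i => le_min (hp0 i) (hr0 i)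
  set k : a → ℝ := fun i => √(q i / r i) with hk
  have hkr : ∀ i, k i * r i * k i = q i := by
    intro i
    have h1 : k i * r i * k i = (k i * k i) * r i := by ring
    rw [h1, hk, Real.mul_self_sqrt (div_nonneg (hq0 i) (hr0 i))]
    rcases eq_or_ne (r i) 0 with h0 | h0
    · simp [hq, h0, hp0 i]
    · field_simp
  have hk1 : ∀ i, k i * k i ≤ 1 := by
    intro i
    rw [hk, Real.mul_self_sqrt (div_nonneg (hq0 i) (hr0 i))]
    exact div_le_one_of_le₀ (min_le_right _ _) (hr0 i)
  have hconj : ∀ f g : a → ℝ, (U * Matrix.diagonal (fun i => (f i : ℂ)) * Uᴴ) *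
      (U * Matrix.diagonal (fun i => (g i : ℂ)) * Uᴴ) =
      U * Matrix.diagonal (fun i => ((f i * g i : ℝ) : ℂ)) * Uᴴ := by
    intro f g
    simp only [Matrix.mul_assoc]
    rw [← Matrix.mul_assoc Uᴴ U, hU1, Matrix.one_mul, ← Matrix.mul_assoc (Matrix.diagonal _),
      Matrix.diagonal_mul_diagonal]
    simp
  set K := U * Matrix.diagonal (fun i => (k i : ℂ)) * Uᴴ with hK
  have hKρK : K * ρ * K = U * Matrix.diagonal (fun i => (q i : ℂ)) * Uᴴ := by
    rw [hρU, hK, hconj, hconj]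
    simp only [hkr]
  refine ⟨K, ?_, ?_, ?_, ?_⟩
  · rw [Matrix.IsHermitian, hK, Matrix.conjTranspose_mul, Matrix.conjTranspose_mul,
      Matrix.conjTranspose_conjTranspose, Matrix.diagonal_conjTranspose, Matrix.mul_assoc]
    congr 3
    ext i; simp
  · have h1 : (1 : Matrix a a ℂ) - K * K =
        U * Matrix.diagonal (fun i => ((1 - k i * k i : ℝ) : ℂ)) * Uᴴ := by
      have h2 : (Matrix.diagonal (fun i => ((1 - k i * k i : ℝ) : ℂ)) : Matrix a a ℂ) =
          1 - Matrix.diagonal (fun i => ((k i * k i : ℝ) : ℂ)) := by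
        rw [← Matrix.diagonal_one, Matrix.diagonal_sub]
        congr 1; ext i; simp
      rw [hK, hconj, h2, Matrix.mul_sub, Matrix.sub_mul, Matrix.mul_one, hU2]
    rw [h1]
    refine Matrix.PosSemidef.mul_mul_conjTranspose_same (Matrix.PosSemidef.diagonal fun i => ?_) _
    have := hk1 i
    simp only [Pi.zero_apply]
    exact_mod_cast (by linarith : (0 : ℝ) ≤ 1 - k i * k i)
  · have ht : (K * ρ * K).trace = ((∑ i, q i : ℝ) : ℂ) := by
      rw [hKρK, Matrix.trace_mul_comm, ← Matrix.mul_assoc, hU1, Matrix.one_mul,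
        Matrix.trace_diagonal]
      push_cast; rfl
    have hρt : ∑ i, r i = 1 := by
      have := hρ.isHermitian.trace_eq_sum_eigenvalues
      rw [this] at hρ1
      simpa using hρ1
    have hpin := sum_abs_diag_le (hα.isHermitian.sub hρ.isHermitian) hU2
    have hd : ∀ i, ((Uᴴ * (α - ρ) * U) i i).re = p i - r i := by
      intro i
      have h2 : Uᴴ * ρ * U = Matrix.diagonal (fun i => (r i : ℂ)) := by
        conv_lhs => rw [hρU]
        rw [Matrix.mul_assoc, Matrix.mul_assoc, hU1, Matrix.mul_one, ← Matrix.mul_assoc, hU1,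
          Matrix.one_mul]
      rw [Matrix.mul_sub, Matrix.sub_mul, Matrix.sub_apply, h2, Complex.sub_re]
      simp [hp]
    simp only [hd] at hpin
    rw [ht, Complex.ofReal_re]
    -- min(p, r) ≥ r − |p − r|, and pinching bounds Σ|p − r| by the trace norm of α − ρ.
    have : ∑ i, (r i - |p i - r i|) ≤ ∑ i, q i := by
      refine Finset.sum_le_sum fun i _ => le_min ?_ ?_
      · linarith [neg_abs_le (p i - r i)]
      · linarith [abs_nonneg (p i - r i)]
    rw [Finset.sum_sub_distrib] at this
    linarith
  -- Σ q² ≤ Σ p², and the squared diagonal of α is part of its squared Frobenius norm.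
  · rw [hKρK, frobSq_mul_coisometry (by rw [Matrix.conjTranspose_conjTranspose, hU1]),
      frobSq_isometry_mul hU1, frobSq_diagonal,
      ← frobSq_mul_coisometry (C := U) hU2 α,
      ← frobSq_isometry_mul (B := Uᴴ) (by rw [Matrix.conjTranspose_conjTranspose, hU2]),
      ← Matrix.mul_assoc]
    refine Finset.sum_le_sum fun i _ => ?_
    refine le_trans ?_ (Finset.single_le_sum (f := fun j => ‖(Uᴴ * α * U) i j‖ ^ 2)
      (fun _ _ => sq_nonneg _) (Finset.mem_univ i))
    refine pow_le_pow_left₀ (hq0 i) ((min_le_left _ _).trans ?_) 2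
    exact Complex.re_le_norm _

end Truncation

/-! ### Polar decomposition and nearby isometries -/

section Polar

variable {x j : Type*} [Fintype x] [DecidableEq x] [Fintype j] [DecidableEq j]

/-- A matrix with orthogonal columns factors through an isometry. -/
lemma exists_isometry_of_orthogonal_columns (hcard : Fintype.card j ≤ Fintype.card x)
    (V : Matrix x j ℂ) (l : j → ℝ) (hl : ∀ i, 0 ≤ l i)
    (hV : Vᴴ * V = Matrix.diagonal (fun i => (l i : ℂ))) :
    ∃ B : Matrix x j ℂ, Bᴴ * B = 1 ∧ V = B * Matrix.diagonal (fun i => ((√(l i) : ℝ) : ℂ)) := by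
  classical
  obtain ⟨e⟩ := Function.Embedding.nonempty_of_card_le hcard
  let v : j → EuclideanSpace ℂ x := fun k => WithLp.toLp 2 (fun i => V i k)
  have hinner : ∀ k k', inner ℂ (v k) (v k') = if k = k' then (l k : ℂ) else 0 := by
    intro k k'
    have := congrFun (congrFun hV k) k'
    rw [Matrix.mul_apply, Matrix.diagonal_apply] at this
    rw [← this]
    simp [v, PiLp.inner_apply, mul_comm]
  -- Normalised columns, placed at the positions given by `e`. Columns with l k = 0 vanish; their
  -- positions are filled when the orthonormal family on `s` is extended to a basis.
  let f : x → EuclideanSpace ℂ x := fun y =>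
    if h : ∃ k, e k = y then ((√(l h.choose) : ℝ) : ℂ)⁻¹ • v h.choose else 0
  have hf : ∀ k, f (e k) = ((√(l k) : ℝ) : ℂ)⁻¹ • v k := by
    intro k
    have h : ∃ k', e k' = e k := ⟨k, rfl⟩
    have h2 : h.choose = k := e.injective h.choose_spec
    simp only [f, dif_pos h, h2]
  let s : Set x := {y | ∃ k, e k = y ∧ l k ≠ 0}
  have hon : Orthonormal ℂ (s.domRestrict f) := by
    rw [orthonormal_iff_ite]
    rintro ⟨_, k, rfl, hk⟩ ⟨_, k', rfl, hk'⟩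
    change inner ℂ (f (e k)) (f (e k')) = _
    simp only [hf, inner_smul_left, inner_smul_right, hinner, Subtype.mk.injEq,
      e.injective.eq_iff]
    by_cases h : k = k'
    · subst h
      have h0 : ((√(l k) : ℝ) : ℂ) ≠ 0 := by
        rw [Complex.ofReal_ne_zero]; exact (Real.sqrt_pos.2 (lt_of_le_of_ne (hl k) hk.symm)).ne'
      simp only [if_true, map_inv₀, Complex.conj_ofReal]
      have h1 : (l k : ℂ) = ((√(l k) : ℝ) : ℂ) * ((√(l k) : ℝ) : ℂ) := by
        rw [← Complex.ofReal_mul, Real.mul_self_sqrt (hl k)]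
      rw [h1]; field_simp
    · simp [h]
  obtain ⟨b, hb⟩ := hon.exists_orthonormalBasis_extension_of_card_eq (by simp)
  refine ⟨Matrix.of fun i k => b (e k) i, ?_, ?_⟩
  · ext k k'
    have h1 := orthonormal_iff_ite.1 b.orthonormal (e k) (e k')
    rw [Matrix.mul_apply, Matrix.one_apply]
    simp only [e.injective.eq_iff] at h1
    rw [← h1]
    simp [PiLp.inner_apply, mul_comm]
  · ext i k
    rw [Matrix.mul_diagonal, Matrix.of_apply]
    by_cases hk : l k = 0
    · have h1 : v k = 0 := by
        rw [← inner_self_eq_zero (𝕜 := ℂ), hinner, if_pos rfl, hk]; simp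
      have h2 : V i k = 0 := by
        have := congrArg (fun w : EuclideanSpace ℂ x => w i) h1
        simpa [v] using this
      simp [hk, h2]
    · have h0 : ((√(l k) : ℝ) : ℂ) ≠ 0 := by
        rw [Complex.ofReal_ne_zero]; exact (Real.sqrt_pos.2 (lt_of_le_of_ne (hl k) (Ne.symm hk))).ne'
      rw [hb (e k) ⟨k, rfl, hk⟩, hf]
      simp only [PiLp.smul_apply, smul_eq_mul, v]
      field_simp

/-- A matrix whose Gram matrix is close to a multiple of the identity is close to an isometry. -/
lemma exists_isometry_close (hcard : Fintype.card j ≤ Fintype.card x) (V : Matrix x j ℂ)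
    {c : ℝ} (hc : 0 < c) :
    ∃ W : Matrix x j ℂ, Wᴴ * W = 1 ∧
      frobSq (((√c : ℝ) : ℂ)⁻¹ • V - W) ≤ frobSq (Vᴴ * V - (c : ℂ) • 1) / c ^ 2 := by
  have hG : (Vᴴ * V).PosSemidef := Matrix.posSemidef_conjTranspose_mul_self V
  obtain ⟨U, hU1, hU2, hV⟩ := exists_diagonalization hG.isHermitian
  set l := hG.isHermitian.eigenvalues with hl
  have hl0 : ∀ i, 0 ≤ l i := hG.eigenvalues_nonneg
  have hdiag : (V * U)ᴴ * (V * U) = Matrix.diagonal (fun i => (l i : ℂ)) := by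
    rw [Matrix.conjTranspose_mul, Matrix.mul_assoc, ← Matrix.mul_assoc Vᴴ, hV]
    simp only [Matrix.mul_assoc]
    rw [hU1, Matrix.mul_one, ← Matrix.mul_assoc, hU1, Matrix.one_mul]
  obtain ⟨B, hB, hVB⟩ := exists_isometry_of_orthogonal_columns hcard (V * U) l hl0 hdiag
  -- Polar decomposition: V is the isometry B Uᴴ times the square root of its Gram matrix, and B Uᴴ
  -- is the isometry sought.
  have hV' : V = B * Matrix.diagonal (fun i => ((√(l i) : ℝ) : ℂ)) * Uᴴ := by
    rw [← hVB, Matrix.mul_assoc, hU2, Matrix.mul_one]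
  have hsc : 0 < √c := Real.sqrt_pos.2 hc
  have hUU : Uᴴ * Uᴴᴴ = 1 := by rw [Matrix.conjTranspose_conjTranspose, hU1]
  refine ⟨B * Uᴴ, ?_, ?_⟩
  · rw [Matrix.conjTranspose_mul, Matrix.conjTranspose_conjTranspose, Matrix.mul_assoc,
      ← Matrix.mul_assoc Bᴴ, hB, Matrix.one_mul, hU2]
  · have h1 : ((√c : ℝ) : ℂ)⁻¹ • V - B * Uᴴ =
        B * Matrix.diagonal (fun i => (((√c)⁻¹ * √(l i) - 1 : ℝ) : ℂ)) * Uᴴ := by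
      have h2 : (Matrix.diagonal (fun i => (((√c)⁻¹ * √(l i) - 1 : ℝ) : ℂ)) : Matrix j j ℂ) =
          ((√c : ℝ) : ℂ)⁻¹ • Matrix.diagonal (fun i => ((√(l i) : ℝ) : ℂ)) - 1 := by
        rw [← Matrix.diagonal_one, ← Matrix.diagonal_smul, Matrix.diagonal_sub]
        congr 1; ext i; simp
      rw [h2, Matrix.mul_sub, Matrix.sub_mul, Matrix.mul_one, Matrix.mul_smul, Matrix.smul_mul,
        ← hV']
    have h3 : Vᴴ * V - (c : ℂ) • 1 = U * Matrix.diagonal (fun i => ((l i - c : ℝ) : ℂ)) * Uᴴ := by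
      have h2 : (Matrix.diagonal (fun i => ((l i - c : ℝ) : ℂ)) : Matrix j j ℂ) =
          Matrix.diagonal (fun i => (l i : ℂ)) - (c : ℂ) • 1 := by
        rw [← Matrix.diagonal_one, ← Matrix.diagonal_smul, Matrix.diagonal_sub]
        congr 1; ext i; simp
      rw [h2, Matrix.mul_sub, Matrix.sub_mul, ← hV, Matrix.mul_smul, Matrix.smul_mul,
        Matrix.mul_one, hU2]
    rw [h1, h3, frobSq_mul_coisometry hUU, frobSq_mul_coisometry hUU, frobSq_isometry_mul hB,
      frobSq_isometry_mul hU1, frobSq_diagonal, frobSq_diagonal, Finset.sum_div]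
    refine Finset.sum_le_sum fun i _ => ?_
    set y := √(l i)
    have hy : 0 ≤ y := Real.sqrt_nonneg _
    have hly : l i = y ^ 2 := (Real.sq_sqrt (hl0 i)).symm
    set z := √c
    have hcz : c = z ^ 2 := (Real.sq_sqrt hc.le).symm
    rw [hly, hcz]
    have e : z⁻¹ * y - 1 = (y - z) / z := by field_simp
    rw [e, div_pow, div_le_div_iff₀ (by positivity) (by positivity)]
    -- This is (√u − 1)² ≤ (u − 1)² for u = l i / c, cleared of denominators.
    have : (y ^ 2 - z ^ 2) ^ 2 * z ^ 2 - (y - z) ^ 2 * (z ^ 2) ^ 2 =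
        (y - z) ^ 2 * z ^ 2 * (y * (y + 2 * z)) := by ring
    have h5 : 0 ≤ (y - z) ^ 2 * z ^ 2 * (y * (y + 2 * z)) := by positivity
    linarith

end Polar

/-! ### Superoperators as kernels; complete positivity -/

section Kernels

/-- The kernel of a superoperator from matrices over `a` to matrices over `r`. -/
abbrev Ker (r a : Type*) : Type _ := r → r → a → a → ℂ

variable {r s a b μ : Type*} [Fintype r] [DecidableEq r] [Fintype s] [DecidableEq s]
  [Fintype a] [DecidableEq a] [Fintype b] [DecidableEq b] [Fintype μ] [DecidableEq μ]

/-- The superoperator with kernel `t`, tensored with the identity. -/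
def lift (t : Ker r a) (X : Matrix (a × μ) (a × μ) ℂ) : Matrix (r × μ) (r × μ) ℂ :=
  fun p q => ∑ y, ∑ y', t p.1 q.1 y y' * X (y, p.2) (y', q.2)

/-- The kernel of a tensor product of superoperators. -/
def kerProd (t : Ker r a) (u : Ker s b) : Ker (r × s) (a × b) :=
  fun p q y y' => t p.1 q.1 y.1 y'.1 * u p.2 q.2 y.2 y'.2

/-- Complete positivity of a kernel: its Choi matrix is positive semidefinite. -/
def IsCP (t : Ker r a) : Prop :=
  (Matrix.of fun p q : r × a => t p.1 q.1 p.2 q.2).PosSemidef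

lemma lift_add (t t' : Ker r a) (X : Matrix (a × μ) (a × μ) ℂ) :
    lift (t + t') X = lift t X + lift t' X := by
  ext p q
  simp [lift, add_mul, Finset.sum_add_distrib]

lemma lift_sub (t t' : Ker r a) (X : Matrix (a × μ) (a × μ) ℂ) :
    lift (t - t') X = lift t X - lift t' X := by
  ext p q
  simp [lift, sub_mul, Finset.sum_sub_distrib]

lemma lift_add_right (t : Ker r a) (X Y : Matrix (a × μ) (a × μ) ℂ) :
    lift t (X + Y) = lift t X + lift t Y := by
  ext p q
  simp [lift, mul_add, Finset.sum_add_distrib]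

lemma lift_sub_right (t : Ker r a) (X Y : Matrix (a × μ) (a × μ) ℂ) :
    lift t (X - Y) = lift t X - lift t Y := by
  ext p q
  simp [lift, mul_sub, Finset.sum_sub_distrib]

lemma kronecker_one_conj_apply (A : Matrix r a ℂ) (X : Matrix (a × μ) (a × μ) ℂ)
    (p q : r × μ) :
    ((A ⊗ₖ (1 : Matrix μ μ ℂ)) * X * (A ⊗ₖ (1 : Matrix μ μ ℂ))ᴴ) p q =
      ∑ y, ∑ y', A p.1 y * conj (A q.1 y') * X (y, p.2) (y', q.2) := by
  simp only [Matrix.mul_apply, Matrix.conjTranspose_apply, Matrix.kroneckerMap_apply,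
    Fintype.sum_prod_type, Matrix.one_apply, mul_ite, mul_one, mul_zero, ite_mul, zero_mul,
    Finset.sum_ite_eq, Finset.mem_univ, if_true, Complex.star_def, apply_ite conj, map_zero]
  rw [Finset.sum_comm]
  simp only [Finset.sum_mul]
  refine Finset.sum_congr rfl fun y _ => Finset.sum_congr rfl fun y' _ => ?_
  ring

lemma exists_eq_conjTranspose_mul_self {A : Matrix a a ℂ} (hA : A.PosSemidef) :
    ∃ B : Matrix a a ℂ, A = Bᴴ * B := by
  obtain ⟨R, H, hR, -, hRR, -, -⟩ := exists_sqrt_pinv hA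
  exact ⟨R, by rw [hR.isHermitian.eq, hRR]⟩

/-- A factorisation BᴴB of the Choi matrix supplies Kraus operators. -/
lemma IsCP.posSemidef_lift {t : Ker r a} (ht : IsCP t) {X : Matrix (a × μ) (a × μ) ℂ}
    (hX : X.PosSemidef) : (lift t X).PosSemidef := by
  obtain ⟨B, hB⟩ := exists_eq_conjTranspose_mul_self ht
  have h : lift t X = ∑ k, ((Matrix.of fun i y => conj (B k (i, y)) : Matrix r a ℂ) ⊗ₖ
      (1 : Matrix μ μ ℂ)) * X *
      ((Matrix.of fun i y => conj (B k (i, y)) : Matrix r a ℂ) ⊗ₖ (1 : Matrix μ μ ℂ))ᴴ := by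
    ext p q
    rw [Matrix.sum_apply]
    simp only [kronecker_one_conj_apply, Matrix.of_apply, Complex.conj_conj]
    rw [Finset.sum_comm, lift]
    refine Finset.sum_congr rfl fun y _ => ?_
    rw [Finset.sum_comm]
    refine Finset.sum_congr rfl fun y' _ => ?_
    rw [← Finset.sum_mul]
    congr 1
    have := congrFun (congrFun hB (p.1, y)) (q.1, y')
    rw [Matrix.of_apply, Matrix.mul_apply] at this
    simpa using this
  rw [h]
  exact Matrix.posSemidef_sum _ fun k _ => hX.mul_mul_conjTranspose_same _

lemma IsCP.add {t t' : Ker r a} (ht : IsCP t) (ht' : IsCP t') : IsCP (t + t') :=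
  Matrix.PosSemidef.add ht ht'

lemma IsCP.kerProd {t : Ker r a} {u : Ker s b} (ht : IsCP t) (hu : IsCP u) :
    IsCP (kerProd t u) :=
  (Matrix.PosSemidef.kronecker ht hu).submatrix
    (fun p : (r × s) × (a × b) => ((p.1.1, p.2.1), (p.1.2, p.2.2)))

/-- Regrouping the four products by sign gives a difference of positive matrices. This handles the
part of a state removed by smoothing, where no cancellation between t and t' is available. -/
lemma traceNorm_lift_sub_le {t t' : Ker r a} (ht : IsCP t) (ht' : IsCP t')
    {P N : Matrix (a × μ) (a × μ) ℂ} (hP : P.PosSemidef) (hN : N.PosSemidef) :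
    traceNorm (lift (t - t') (P - N)) ≤ (lift (t + t') (P + N)).trace.re := by
  have h : lift (t - t') (P - N) = (lift t P + lift t' N) - (lift t N + lift t' P) := by
    rw [lift_sub, lift_sub_right, lift_sub_right]; abel
  rw [h]
  refine (traceNorm_sub_le ((ht.posSemidef_lift hP).add (ht'.posSemidef_lift hN))
    ((ht.posSemidef_lift hN).add (ht'.posSemidef_lift hP))).trans (le_of_eq ?_)
  rw [lift_add, lift_add_right, lift_add_right]
  simp only [Matrix.trace_add, Complex.add_re]; ring

/-- The completely depolarising kernel. -/
def kerBar : Ker r a := fun i i' y y' =>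
  (Fintype.card r : ℂ)⁻¹ * ((if i = i' then 1 else 0) * (if y = y' then 1 else 0))

lemma isCP_kerBar : IsCP (kerBar : Ker r a) := by
  have h : (Matrix.of fun p q : r × a => (kerBar : Ker r a) p.1 q.1 p.2 q.2) =
      (Fintype.card r : ℂ)⁻¹ • (1 : Matrix (r × a) (r × a) ℂ) := by
    ext p q
    simp only [kerBar, Matrix.of_apply, Matrix.smul_apply, Matrix.one_apply, smul_eq_mul,
      Prod.ext_iff]
    by_cases h1 : p.1 = q.1 <;> by_cases h2 : p.2 = q.2 <;> simp [h1, h2]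
  rw [IsCP, h]
  refine Matrix.PosSemidef.one.smul ?_
  rw [← Complex.ofReal_natCast, ← Complex.ofReal_inv]
  exact_mod_cast inv_nonneg.2 (Nat.cast_nonneg _)

lemma kerProd_kerBar : kerProd (kerBar : Ker r a) (kerBar : Ker s b) = kerBar := by
  funext p q y y'
  simp only [kerProd, kerBar, Fintype.card_prod, Nat.cast_mul, mul_inv, Prod.ext_iff]
  by_cases h1 : p.1 = q.1 <;> by_cases h2 : p.2 = q.2 <;> by_cases h3 : y.1 = y'.1 <;>
    by_cases h4 : y.2 = y'.2 <;> simp [h1, h2, h3, h4]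

lemma trace_lift (t : Ker r a) (X : Matrix (a × μ) (a × μ) ℂ) :
    (lift t X).trace = ∑ i, ∑ m, ∑ y, ∑ y', t i i y y' * X (y, m) (y', m) := by
  simp [Matrix.trace, lift, Fintype.sum_prod_type]

lemma trace_lift_kerBar [Nonempty r] (X : Matrix (a × μ) (a × μ) ℂ) :
    (lift (kerBar : Ker r a) X).trace = X.trace := by
  rw [trace_lift]
  have h0 : (Fintype.card r : ℂ) ≠ 0 := by exact_mod_cast Fintype.card_ne_zero
  simp only [kerBar, if_true, mul_ite, mul_one, mul_zero, ite_mul, zero_mul,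
    Finset.sum_ite_eq, Finset.mem_univ, Finset.sum_const, Finset.card_univ, nsmul_eq_mul]
  simp only [← Finset.mul_sum, ← mul_assoc]
  rw [mul_inv_cancel₀ h0, one_mul, Matrix.trace, Fintype.sum_prod_type, Finset.sum_comm]
  rfl

lemma expect_trace_lift {S : Type*} [Fintype S] {t : S → Ker r a} {t' : Ker r a}
    (h : ∀ i i' y y', 𝔼 σ, t σ i i' y y' = t' i i' y y') (X : Matrix (a × μ) (a × μ) ℂ) :
    𝔼 σ, (lift (t σ) X).trace.re = (lift t' X).trace.re := by
  rw [← Complex.re_expect]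
  congr 1
  simp only [trace_lift]
  rw [Finset.expect_sum_comm]
  refine Finset.sum_congr rfl fun i _ => ?_
  rw [Finset.expect_sum_comm]
  refine Finset.sum_congr rfl fun m _ => ?_
  rw [Finset.expect_sum_comm]
  refine Finset.sum_congr rfl fun y _ => ?_
  rw [Finset.expect_sum_comm]
  refine Finset.sum_congr rfl fun y' _ => ?_
  rw [← Finset.expect_mul, h]

lemma one_kronecker_conj_apply (w : Matrix μ μ ℂ) (Y : Matrix (a × μ) (a × μ) ℂ)
    (p q : a × μ) :
    (((1 : Matrix a a ℂ) ⊗ₖ w) * Y * ((1 : Matrix a a ℂ) ⊗ₖ w)) p q =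
      ∑ m, ∑ m', w p.2 m * w m' q.2 * Y (p.1, m) (q.1, m') := by
  simp only [Matrix.mul_apply, Matrix.kroneckerMap_apply, Fintype.sum_prod_type,
    Matrix.one_apply, ite_mul, one_mul, zero_mul, mul_ite, mul_zero]
  rw [Finset.sum_eq_single q.1]
  · simp only [if_true]
    conv_rhs => rw [Finset.sum_comm]
    refine Finset.sum_congr rfl fun m' _ => ?_
    rw [Finset.sum_eq_single p.1]
    · simp only [if_true, Finset.sum_mul]
      refine Finset.sum_congr rfl fun m _ => ?_
      ring
    · intro x _ hx; simp [Ne.symm hx]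
    · simp
  · intro x _ hx; simp [hx]
  · simp

/-- A weight on the environment passes through a superoperator acting on the other factor. -/
lemma lift_one_kronecker_conj (t : Ker r a) (w : Matrix μ μ ℂ) (X : Matrix (a × μ) (a × μ) ℂ) :
    lift t (((1 : Matrix a a ℂ) ⊗ₖ w) * X * ((1 : Matrix a a ℂ) ⊗ₖ w)) =
      ((1 : Matrix r r ℂ) ⊗ₖ w) * lift t X * ((1 : Matrix r r ℂ) ⊗ₖ w) := by
  ext p q
  rw [one_kronecker_conj_apply]
  simp only [lift, one_kronecker_conj_apply, Finset.mul_sum]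
  have e : ∀ F : a → a → μ → μ → ℂ,
      ∑ y, ∑ y', ∑ m, ∑ m', F y y' m m' = ∑ m, ∑ m', ∑ y, ∑ y', F y y' m m' := by
    intro F
    have : ∀ y, ∑ y', ∑ m, ∑ m', F y y' m m' = ∑ m, ∑ m', ∑ y', F y y' m m' := by
      intro y
      rw [Finset.sum_comm]
      refine Finset.sum_congr rfl fun m _ => ?_
      rw [Finset.sum_comm]
    simp only [this]
    rw [Finset.sum_comm]
    refine Finset.sum_congr rfl fun m _ => ?_
    rw [Finset.sum_comm]
  rw [e]
  refine Finset.sum_congr rfl fun m _ => Finset.sum_congr rfl fun m' _ =>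
    Finset.sum_congr rfl fun y _ => Finset.sum_congr rfl fun y' _ => ?_
  ring

/-- Hermitian-preserving kernels. -/
def IsHermKer (t : Ker r a) : Prop := ∀ i i' y y', conj (t i i' y y') = t i' i y' y

lemma IsCP.isHermKer {t : Ker r a} (ht : IsCP t) : IsHermKer t := by
  intro i i' y y'
  have := ht.isHermitian.apply (i', y') (i, y)
  simpa using this

lemma IsHermKer.sub {t t' : Ker r a} (ht : IsHermKer t) (ht' : IsHermKer t') :
    IsHermKer (t - t') := by
  intro i i' y y'
  simp [ht i i' y y', ht' i i' y y']

lemma IsHermKer.kerProd {t : Ker r a} {u : Ker s b} (ht : IsHermKer t) (hu : IsHermKer u) :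
    IsHermKer (kerProd t u) := by
  intro i i' y y'
  simp [QMAC.kerProd, ht i.1 i'.1 y.1 y'.1, hu i.2 i'.2 y.2 y'.2]

lemma IsHermKer.isHermitian_lift {t : Ker r a} (ht : IsHermKer t) {X : Matrix (a × μ) (a × μ) ℂ}
    (hX : X.IsHermitian) : (lift t X).IsHermitian := by
  ext p q
  rw [Matrix.conjTranspose_apply]
  simp only [lift, Complex.star_def, map_sum, map_mul, ht _ _ _ _]
  rw [Finset.sum_comm]
  refine Finset.sum_congr rfl fun y _ => Finset.sum_congr rfl fun y' _ => ?_
  congr 1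
  have := hX.apply (y, p.2) (y', q.2)
  simpa using this

end Kernels

/-! ### The random encoding map and its deviation from the depolarising map -/

section RandomKernel

variable {r s f g a b μ : Type*} [Fintype r] [DecidableEq r] [Fintype s] [DecidableEq s]
  [Fintype f] [DecidableEq f] [Fintype g] [DecidableEq g]
  [Fintype a] [DecidableEq a] [Fintype b] [DecidableEq b] [Fintype μ] [DecidableEq μ]

/-- The kernel of `X ↦ D⁻¹ Tr_f (G X Gᴴ)` for the matrix `G` of phases. -/
def kerRand (σ : a × (r × f) → ZMod 3) : Ker r a := fun i i' y y' =>
  ((Fintype.card r : ℂ) * Fintype.card f)⁻¹ *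
    ∑ k, phase σ (y, (i, k)) * conj (phase σ (y', (i', k)))

lemma isCP_kerRand (σ : a × (r × f) → ZMod 3) : IsCP (kerRand σ) := by
  have h : (Matrix.of fun p q : r × a => kerRand σ p.1 q.1 p.2 q.2) =
      ((Fintype.card r : ℂ) * Fintype.card f)⁻¹ •
        ∑ k, Matrix.vecMulVec (fun p : r × a => phase σ (p.2, (p.1, k)))
          (star fun p : r × a => phase σ (p.2, (p.1, k))) := by
    ext p q
    simp [kerRand, Matrix.sum_apply, Matrix.vecMulVec_apply]
  rw [IsCP, h]
  refine (Matrix.posSemidef_sum _ fun k _ => Matrix.posSemidef_vecMulVec_self_star _).smul ?_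
  rw [← Complex.ofReal_natCast, ← Complex.ofReal_natCast, ← Complex.ofReal_mul,
    ← Complex.ofReal_inv]
  exact_mod_cast inv_nonneg.2 (by positivity)

/-- The deviation of the random kernel from its mean. -/
def kerDev (σ : a × (r × f) → ZMod 3) : Ker r a := kerRand σ - kerBar

/-- The mean of a phase product is the indicator of equal indices, and these indicators sum over k
to the depolarising kernel; only centred products are left. -/
lemma kerDev_eq [Nonempty f] (σ : a × (r × f) → ZMod 3) (i i' : r) (y y' : a) :
    kerDev σ i i' y y' = ((Fintype.card r : ℂ) * Fintype.card f)⁻¹ *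
      ∑ k, phaseDev σ ((y, (i, k)), (y', (i', k))) := by
  have h0 : (Fintype.card f : ℂ) ≠ 0 := by exact_mod_cast Fintype.card_ne_zero
  simp only [kerDev, Pi.sub_apply, kerRand, phaseDev, Finset.sum_sub_distrib, mul_sub, kerBar]
  congr 1
  simp only [Prod.mk.injEq, and_true, Finset.sum_const, Finset.card_univ, nsmul_eq_mul]
  by_cases h1 : i = i' <;> by_cases h2 : y = y' <;> simp [h1, h2, h0, mul_comm]

lemma expect_kerRand [Nonempty f] (i i' : r) (y y' : a) :
    𝔼 σ : a × (r × f) → ZMod 3, kerRand σ i i' y y' = kerBar i i' y y' := by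
  have h : 𝔼 σ : a × (r × f) → ZMod 3, kerDev σ i i' y y' = 0 := by
    simp only [kerDev_eq]
    rw [← Finset.mul_expect, Finset.expect_sum_comm]
    simp [expect_phaseDev]
  simp only [kerDev, Pi.sub_apply] at h
  rw [Finset.expect_sub_distrib, Fintype.expect_const, sub_eq_zero] at h
  exact h

lemma isHermKer_kerDev (σ : a × (r × f) → ZMod 3) : IsHermKer (kerDev σ) :=
  (isCP_kerRand σ).isHermKer.sub isCP_kerBar.isHermKer

lemma norm_sq_inv_card_mul : ‖((Fintype.card r : ℂ) * Fintype.card f)⁻¹‖ ^ 2 =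
    (((Fintype.card r : ℝ) * Fintype.card f) ^ 2)⁻¹ := by
  rw [norm_inv, norm_mul, Complex.norm_natCast, Complex.norm_natCast, inv_pow]

lemma sum_sum_block (X : Matrix (a × μ) (a × μ) ℂ) :
    ∑ p : r × μ, ∑ q : r × μ, ∑ y, ∑ y', ‖X (y, p.2) (y', q.2)‖ ^ 2 =
      (Fintype.card r : ℝ) ^ 2 * frobSq X := by
  simp only [frobSq, Fintype.sum_prod_type, Finset.sum_const, Finset.card_univ, nsmul_eq_mul,
    ← Finset.mul_sum]
  rw [← mul_assoc, sq]
  congr 1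
  rw [Finset.sum_comm]
  conv_rhs => rw [Finset.sum_comm]
  rw [Finset.sum_comm]
  refine Finset.sum_congr rfl fun m _ => ?_
  rw [Finset.sum_comm]
  refine Finset.sum_congr rfl fun y _ => ?_
  rw [Finset.sum_comm]

/-- Second moment of the deviation kernel. -/
lemma expect_frobSq_lift_kerDev_le [Nonempty r] [Nonempty f] (X : Matrix (a × μ) (a × μ) ℂ) :
    𝔼 σ : a × (r × f) → ZMod 3, frobSq (lift (kerDev σ) X) ≤ frobSq X / Fintype.card f := by
  have hr : (0 : ℝ) < Fintype.card r := by exact_mod_cast Fintype.card_pos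
  have hf : (0 : ℝ) < Fintype.card f := by exact_mod_cast Fintype.card_pos
  have h1 : ∀ p q : r × μ, 𝔼 σ : a × (r × f) → ZMod 3, ‖lift (kerDev σ) X p q‖ ^ 2 ≤
      ((((Fintype.card r : ℝ) * Fintype.card f) ^ 2)⁻¹ * Fintype.card f) *
        ∑ y, ∑ y', ‖X (y, p.2) (y', q.2)‖ ^ 2 := by
    intro p q
    have h2 : ∀ σ : a × (r × f) → ZMod 3, lift (kerDev σ) X p q =
        ((Fintype.card r : ℂ) * Fintype.card f)⁻¹ *
          ∑ i : (a × a) × f, phaseDev σ ((i.1.1, (p.1, i.2)), (i.1.2, (q.1, i.2))) *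
            X (i.1.1, p.2) (i.1.2, q.2) := by
      intro σ
      simp only [lift, kerDev_eq, Fintype.sum_prod_type, Finset.mul_sum, Finset.sum_mul, mul_assoc]
    simp only [h2, norm_mul, mul_pow, norm_sq_inv_card_mul]
    rw [← Finset.mul_expect, mul_assoc]
    refine mul_le_mul_of_nonneg_left ?_ (by positivity)
    -- For fixed output indices, distinct (y, y', k) give distinct pairs of phases, so each entry of
    -- X occurs in |f| uncorrelated terms. Against the normalisation (|r||f|)⁻² this leaves |f|⁻¹
    -- once the |r|² output positions are summed.
    refine (expect_norm_sq_phaseDev_le (p := fun i : (a × a) × f =>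
      ((i.1.1, (p.1, i.2)), (i.1.2, (q.1, i.2)))) ?_ _).trans (le_of_eq ?_)
    · rintro ⟨⟨y, y'⟩, k⟩ ⟨⟨z, z'⟩, l⟩ h
      simp only [Prod.mk.injEq, true_and] at h
      simp [h]
    · simp only [Fintype.sum_prod_type, Finset.sum_const, Finset.card_univ, nsmul_eq_mul,
        ← Finset.mul_sum]
  rw [show (fun σ : a × (r × f) → ZMod 3 => frobSq (lift (kerDev σ) X)) =
    fun σ => ∑ p, ∑ q, ‖lift (kerDev σ) X p q‖ ^ 2 from rfl, Finset.expect_sum_comm]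
  simp only [Finset.expect_sum_comm _ (Finset.univ : Finset (r × μ))]
  refine (Finset.sum_le_sum fun p _ => Finset.sum_le_sum fun q _ => h1 p q).trans (le_of_eq ?_)
  simp only [← Finset.mul_sum]
  rw [sum_sum_block]
  field_simp

/-- Second moment of the product of two deviation kernels. -/
lemma expect_frobSq_lift_kerProd_kerDev_le [Nonempty r] [Nonempty f] [Nonempty s] [Nonempty g]
    (X : Matrix ((a × b) × μ) ((a × b) × μ) ℂ) :
    𝔼 σ : a × (r × f) → ZMod 3, 𝔼 τ : b × (s × g) → ZMod 3,
      frobSq (lift (kerProd (kerDev σ) (kerDev τ)) X) ≤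
        frobSq X / (Fintype.card f * Fintype.card g) := by
  have hr : (0 : ℝ) < Fintype.card r := by exact_mod_cast Fintype.card_pos
  have hf : (0 : ℝ) < Fintype.card f := by exact_mod_cast Fintype.card_pos
  have hs : (0 : ℝ) < Fintype.card s := by exact_mod_cast Fintype.card_pos
  have hg : (0 : ℝ) < Fintype.card g := by exact_mod_cast Fintype.card_pos
  have h1 : ∀ p q : (r × s) × μ, 𝔼 σ : a × (r × f) → ZMod 3, 𝔼 τ : b × (s × g) → ZMod 3,
      ‖lift (kerProd (kerDev σ) (kerDev τ)) X p q‖ ^ 2 ≤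
      ((((Fintype.card r : ℝ) * Fintype.card f) ^ 2)⁻¹ *
        (((Fintype.card s : ℝ) * Fintype.card g) ^ 2)⁻¹ * (Fintype.card f * Fintype.card g)) *
        ∑ y, ∑ y', ‖X (y, p.2) (y', q.2)‖ ^ 2 := by
    intro p q
    have h2 : ∀ (σ : a × (r × f) → ZMod 3) (τ : b × (s × g) → ZMod 3),
        lift (kerProd (kerDev σ) (kerDev τ)) X p q =
        (((Fintype.card r : ℂ) * Fintype.card f)⁻¹ * ((Fintype.card s : ℂ) * Fintype.card g)⁻¹) *
          ∑ i : (a × a) × f, ∑ j : (b × b) × g,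
            phaseDev σ ((i.1.1, (p.1.1, i.2)), (i.1.2, (q.1.1, i.2))) *
            phaseDev τ ((j.1.1, (p.1.2, j.2)), (j.1.2, (q.1.2, j.2))) *
            X ((i.1.1, j.1.1), p.2) ((i.1.2, j.1.2), q.2) := by
      intro σ τ
      have e1 : lift (kerProd (kerDev σ) (kerDev τ)) X p q =
          ∑ i : a × a, ∑ j : b × b, kerDev σ p.1.1 q.1.1 i.1 i.2 * kerDev τ p.1.2 q.1.2 j.1 j.2 *
            X ((i.1, j.1), p.2) ((i.2, j.2), q.2) := by
        simp only [lift, kerProd, Fintype.sum_prod_type]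
        refine Finset.sum_congr rfl fun y _ => ?_
        rw [Finset.sum_comm]
      rw [e1, Finset.mul_sum, Fintype.sum_prod_type (α₂ := f)]
      refine Finset.sum_congr rfl fun i _ => ?_
      simp only [Fintype.sum_prod_type (α₂ := g), kerDev_eq]
      conv_rhs => rw [← Finset.mul_sum, Finset.sum_comm, Finset.mul_sum]
      refine Finset.sum_congr rfl fun j _ => ?_
      simp only [Finset.mul_sum, Finset.sum_mul]
      rw [Finset.sum_comm]
      refine Finset.sum_congr rfl fun k _ => ?_
      refine Finset.sum_congr rfl fun l _ => ?_
      ring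
    simp only [h2, norm_mul, mul_pow, norm_sq_inv_card_mul]
    simp only [← Finset.mul_expect]
    rw [mul_assoc (_ * _)]
    refine mul_le_mul_of_nonneg_left ?_ (by positivity)
    refine (expect_expect_norm_sq_phaseDev_le (p := fun i : (a × a) × f =>
      ((i.1.1, (p.1.1, i.2)), (i.1.2, (q.1.1, i.2)))) (p' := fun j : (b × b) × g =>
      ((j.1.1, (p.1.2, j.2)), (j.1.2, (q.1.2, j.2)))) ?_ ?_ _).trans (le_of_eq ?_)
    · rintro ⟨⟨y, y'⟩, k⟩ ⟨⟨z, z'⟩, l⟩ h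
      simp only [Prod.mk.injEq, true_and] at h
      simp [h]
    · rintro ⟨⟨y, y'⟩, k⟩ ⟨⟨z, z'⟩, l⟩ h
      simp only [Prod.mk.injEq, true_and] at h
      simp [h]
    · simp only [Fintype.sum_prod_type, Finset.sum_const, Finset.card_univ, nsmul_eq_mul,
        ← Finset.mul_sum]
      rw [mul_left_comm, ← mul_assoc]
      congr 1
      refine Finset.sum_congr rfl fun y _ => ?_
      rw [Finset.sum_comm]
  have h3 : ∀ (σ : a × (r × f) → ZMod 3), (𝔼 τ : b × (s × g) → ZMod 3,
      frobSq (lift (kerProd (kerDev σ) (kerDev τ)) X)) = ∑ p, ∑ q, 𝔼 τ : b × (s × g) → ZMod 3,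
        ‖lift (kerProd (kerDev σ) (kerDev τ)) X p q‖ ^ 2 := by
    intro σ
    simp only [← Finset.expect_sum_comm]
    rfl
  simp only [h3]
  simp only [Finset.expect_sum_comm _ (Finset.univ : Finset ((r × s) × μ))]
  refine (Finset.sum_le_sum fun p _ => Finset.sum_le_sum fun q _ => h1 p q).trans (le_of_eq ?_)
  simp only [← Finset.mul_sum]
  rw [sum_sum_block, Fintype.card_prod]
  push_cast
  field_simp

end RandomKernel

/-! ### Contractions -/

section Contraction

variable {a b m : Type*} [Fintype a] [DecidableEq a] [Fintype b] [DecidableEq b]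
  [Fintype m] [DecidableEq m]

lemma sub_kronecker (A A' : Matrix a a ℂ) (B : Matrix b b ℂ) :
    (A - A') ⊗ₖ B = A ⊗ₖ B - A' ⊗ₖ B := by
  ext p q; simp [sub_mul]

lemma kronecker_sub (A : Matrix a a ℂ) (B B' : Matrix b b ℂ) :
    A ⊗ₖ (B - B') = A ⊗ₖ B - A ⊗ₖ B' := by
  ext p q; simp [mul_sub]

lemma isHermitian_one_kronecker {w : Matrix b b ℂ} (hw : w.IsHermitian) :
    ((1 : Matrix a a ℂ) ⊗ₖ w).IsHermitian := by
  rw [Matrix.IsHermitian, Matrix.conjTranspose_kronecker, Matrix.conjTranspose_one, hw.eq]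

/-- Contractions: `Gᴴ G ≤ 1`. -/
def IsContraction (G : Matrix a a ℂ) : Prop := (1 - Gᴴ * G).PosSemidef

lemma isContraction_one : IsContraction (1 : Matrix a a ℂ) := by
  simpa [IsContraction] using Matrix.PosSemidef.zero

/-- 1 − GᴴG ⊗ G'ᴴG' splits as (1 − GᴴG) ⊗ 1 + GᴴG ⊗ (1 − G'ᴴG'). -/
lemma IsContraction.kronecker {G : Matrix a a ℂ} {G' : Matrix b b ℂ} (hG : IsContraction G)
    (hG' : IsContraction G') : IsContraction (G ⊗ₖ G') := by
  have e : (1 : Matrix (a × b) (a × b) ℂ) - (G ⊗ₖ G')ᴴ * (G ⊗ₖ G') =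
      (1 - Gᴴ * G) ⊗ₖ (1 : Matrix b b ℂ) + (Gᴴ * G) ⊗ₖ (1 - G'ᴴ * G') := by
    rw [Matrix.conjTranspose_kronecker, ← Matrix.mul_kronecker_mul, sub_kronecker,
      kronecker_sub, Matrix.one_kronecker_one]
    abel
  rw [IsContraction, e]
  exact (Matrix.PosSemidef.kronecker hG Matrix.PosSemidef.one).add
    (Matrix.PosSemidef.kronecker (Matrix.posSemidef_conjTranspose_mul_self G) hG')

/-- Completes the contraction to a two-outcome measurement, so that the weight lost by truncation
can be tracked. -/
lemma IsContraction.exists_complement {G : Matrix a a ℂ} (hG : IsContraction G) :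
    ∃ L : Matrix a a ℂ, Gᴴ * G + Lᴴ * L = 1 := by
  obtain ⟨L, hL⟩ := exists_eq_conjTranspose_mul_self hG
  exact ⟨L, by rw [← hL]; abel⟩

lemma IsContraction.frobSq_mul_le {G : Matrix a a ℂ} (hG : IsContraction G) (Z : Matrix a m ℂ) :
    frobSq (G * Z) ≤ frobSq Z := by
  have h : ((frobSq Z : ℝ) : ℂ) - (frobSq (G * Z) : ℝ) = (Zᴴ * (1 - Gᴴ * G) * Z).trace := by
    rw [← trace_conjTranspose_mul_eq_frobSq, ← trace_conjTranspose_mul_eq_frobSq,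
      Matrix.conjTranspose_mul, Matrix.mul_sub, Matrix.sub_mul, Matrix.trace_sub]
    simp only [Matrix.mul_one, Matrix.mul_assoc]
  have h2 := PosSemidef.re_trace_nonneg (Matrix.PosSemidef.conjTranspose_mul_mul_same hG Z)
  rw [← h, ← Complex.ofReal_sub, Complex.ofReal_re] at h2
  linarith

lemma IsContraction.frobSq_conj_le {G : Matrix a a ℂ} (hG : IsContraction G) (Z : Matrix a a ℂ) :
    frobSq (G * Z * Gᴴ) ≤ frobSq Z := by
  rw [Matrix.mul_assoc]
  refine (hG.frobSq_mul_le _).trans ?_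
  rw [← frobSq_conjTranspose, Matrix.conjTranspose_mul, Matrix.conjTranspose_conjTranspose]
  refine (hG.frobSq_mul_le _).trans ?_
  rw [frobSq_conjTranspose]

lemma IsContraction.re_trace_conj_le {G P : Matrix a a ℂ} (hG : IsContraction G)
    (hP : P.PosSemidef) : (G * P * Gᴴ).trace.re ≤ P.trace.re := by
  obtain ⟨B, rfl⟩ := exists_eq_conjTranspose_mul_self hP
  have e : G * (Bᴴ * B) * Gᴴ = (G * Bᴴ) * (G * Bᴴ)ᴴ := by
    rw [Matrix.conjTranspose_mul, Matrix.conjTranspose_conjTranspose]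
    simp only [Matrix.mul_assoc]
  rw [e, trace_mul_conjTranspose_eq_frobSq, trace_conjTranspose_mul_eq_frobSq, Complex.ofReal_re,
    Complex.ofReal_re, ← frobSq_conjTranspose B]
  exact hG.frobSq_mul_le _

end Contraction

/-! ### From second moments to trace norms of smoothed states -/

section Smoothing

variable {r a μ S : Type*} [Fintype r] [DecidableEq r] [Fintype a] [DecidableEq a]
  [Fintype μ] [DecidableEq μ] [Fintype S] [Nonempty S]

/-- A random difference of completely positive maps with small second moment nearly annihilates,
in trace norm, every state that is close to one with small weighted Frobenius norm. -/
lemma expect_traceNorm_lift_le {u v : S → Ker r a} (hu : ∀ σ, IsCP (u σ)) (hv : ∀ σ, IsCP (v σ))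
    {k η δ : ℝ} (hk : 0 ≤ k)
    (htr : ∀ X : Matrix (a × μ) (a × μ) ℂ,
      𝔼 σ, (lift (u σ + v σ) X).trace.re = k * X.trace.re)
    (hη : ∀ X : Matrix (a × μ) (a × μ) ℂ, 𝔼 σ, frobSq (lift (u σ - v σ) X) ≤ η * frobSq X)
    (hη0 : 0 ≤ η)
    {G : Matrix a a ℂ} (hG : IsContraction G) {ρ T : Matrix (a × μ) (a × μ) ℂ}
    (hρ : ρ.IsHermitian) (hT : T.IsHermitian) {θ : Matrix μ μ ℂ} (hθ : θ.PosSemidef)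
    (hθ1 : θ.trace.re = 1)
    (hδ : traceNorm (((1 : Matrix a a ℂ) ⊗ₖ cfc (fun x : ℝ => x ^ (1 / 4 : ℝ)) θ) * T *
        ((1 : Matrix a a ℂ) ⊗ₖ cfc (fun x : ℝ => x ^ (1 / 4 : ℝ)) θ) - ρ) ≤ δ) :
    𝔼 σ, traceNorm (lift (u σ - v σ)
      ((G ⊗ₖ (1 : Matrix μ μ ℂ)) * ρ * (G ⊗ₖ (1 : Matrix μ μ ℂ))ᴴ)) ≤
      k * δ + √(Fintype.card r * (η * frobSq T)) := by
  set w := cfc (fun x : ℝ => x ^ (1 / 4 : ℝ)) θ with hw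
  have hwH : w.IsHermitian := isHermitian_cfc _ _
  have h1w : ((1 : Matrix a a ℂ) ⊗ₖ w).IsHermitian := isHermitian_one_kronecker hwH
  set g := G ⊗ₖ (1 : Matrix μ μ ℂ) with hg
  have hgc : IsContraction g := hG.kronecker isContraction_one
  -- The truncation acts on the reference and the weight on the environment, so the two do not
  -- interfere.
  have hcomm : g * ((1 : Matrix a a ℂ) ⊗ₖ w) = ((1 : Matrix a a ℂ) ⊗ₖ w) * g := by
    rw [hg, ← Matrix.mul_kronecker_mul, ← Matrix.mul_kronecker_mul]; simp
  have hcomm' : ((1 : Matrix a a ℂ) ⊗ₖ w) * gᴴ = gᴴ * ((1 : Matrix a a ℂ) ⊗ₖ w) := by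
    have := congrArg Matrix.conjTranspose hcomm
    rwa [Matrix.conjTranspose_mul, Matrix.conjTranspose_mul, h1w.eq] at this
  have hτH : (((1 : Matrix a a ℂ) ⊗ₖ w) * T * ((1 : Matrix a a ℂ) ⊗ₖ w)).IsHermitian := by
    have := Matrix.isHermitian_mul_mul_conjTranspose ((1 : Matrix a a ℂ) ⊗ₖ w) hT
    rwa [h1w.eq] at this
  obtain ⟨P, N, hP, hN, hPN, -, htPN⟩ := exists_posPart_negPart (hτH.sub hρ)
  have hP' := hP.mul_mul_conjTranspose_same g
  have hN' := hN.mul_mul_conjTranspose_same g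
  have hT' : (g * T * gᴴ).IsHermitian := Matrix.isHermitian_mul_mul_conjTranspose g hT
  -- ρ is the weighted smooth part minus a Hermitian error P − N of trace norm at most δ.
  have hdec : g * ρ * gᴴ =
      ((1 : Matrix a a ℂ) ⊗ₖ w) * (g * T * gᴴ) * ((1 : Matrix a a ℂ) ⊗ₖ w) +
      (g * N * gᴴ - g * P * gᴴ) := by
    have e1 : ρ = ((1 : Matrix a a ℂ) ⊗ₖ w) * T * ((1 : Matrix a a ℂ) ⊗ₖ w) - (P - N) := by
      rw [← hPN]; abel
    have e2 : g * (((1 : Matrix a a ℂ) ⊗ₖ w) * T * ((1 : Matrix a a ℂ) ⊗ₖ w)) * gᴴ =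
        ((1 : Matrix a a ℂ) ⊗ₖ w) * (g * T * gᴴ) * ((1 : Matrix a a ℂ) ⊗ₖ w) := by
      calc _ = (g * ((1 : Matrix a a ℂ) ⊗ₖ w)) * T * (((1 : Matrix a a ℂ) ⊗ₖ w) * gᴴ) := by
            simp only [Matrix.mul_assoc]
        _ = _ := by rw [hcomm, hcomm']; simp only [Matrix.mul_assoc]
    rw [e1, Matrix.mul_sub, Matrix.sub_mul, e2, Matrix.mul_sub, Matrix.sub_mul]
    abel
  -- The smooth part is treated by weighted Cauchy–Schwarz, the error part by complete positivity
  -- alone.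
  have hpt : ∀ σ, traceNorm (lift (u σ - v σ) (g * ρ * gᴴ)) ≤
      √(Fintype.card r) * frob (lift (u σ - v σ) (g * T * gᴴ)) +
      (lift (u σ + v σ) (g * N * gᴴ + g * P * gᴴ)).trace.re := by
    intro σ
    have hK : IsHermKer (u σ - v σ) := (hu σ).isHermKer.sub (hv σ).isHermKer
    rw [hdec, lift_add_right]
    refine (traceNorm_add_le (hK.isHermitian_lift ?_) (hK.isHermitian_lift
      (hN'.isHermitian.sub hP'.isHermitian))).trans (add_le_add ?_
      (traceNorm_lift_sub_le (hu σ) (hv σ) hN' hP'))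
    · have := Matrix.isHermitian_mul_mul_conjTranspose ((1 : Matrix a a ℂ) ⊗ₖ w) hT'
      rwa [h1w.eq] at this
    · rw [lift_one_kronecker_conj]
      refine (traceNorm_conj_le (isHermitian_one_kronecker hwH) (hK.isHermitian_lift hT')).trans (le_of_eq ?_)
      rw [mul_comm]
      congr 1
      rw [frob, hw, frobSq_one_kronecker_root hθ, hθ1, mul_one]
  -- Jensen's inequality passes from the second moment to the mean, and the contraction does not
  -- increase the Frobenius norm of T.
  have hE1 : 𝔼 σ, frob (lift (u σ - v σ) (g * T * gᴴ)) ≤ √(η * frobSq T) := by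
    refine (expect_le_sqrt_expect_sq _).trans (Real.sqrt_le_sqrt ?_)
    simp only [sq_frob]
    exact (hη _).trans (mul_le_mul_of_nonneg_left (hgc.frobSq_conj_le T) hη0)
  refine (Finset.expect_le_expect fun σ _ => hpt σ).trans ?_
  rw [Finset.expect_add_distrib, ← Finset.mul_expect, htr, Real.sqrt_mul (Nat.cast_nonneg _),
    add_comm]
  refine add_le_add (mul_le_mul_of_nonneg_left ?_ hk)
    (mul_le_mul_of_nonneg_left hE1 (Real.sqrt_nonneg _))
  rw [Matrix.trace_add, Complex.add_re]
  linarith [hgc.re_trace_conj_le hP, hgc.re_trace_conj_le hN]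

end Smoothing

/-! ### Marginals and local operations -/

section Marginals

variable {r s a b e μ : Type*} [Fintype r] [DecidableEq r] [Fintype s] [DecidableEq s]
  [Fintype a] [DecidableEq a] [Fintype b] [DecidableEq b] [Fintype μ] [DecidableEq μ]

/-- Conjugation by `Z ⊗ Y ⊗ 1`. -/
def localConj (Z : Matrix a a ℂ) (Y : Matrix b b ℂ) (X : Matrix ((a × b) × μ) ((a × b) × μ) ℂ) :
    Matrix ((a × b) × μ) ((a × b) × μ) ℂ :=
  ((Z ⊗ₖ Y) ⊗ₖ (1 : Matrix μ μ ℂ)) * X * ((Z ⊗ₖ Y) ⊗ₖ (1 : Matrix μ μ ℂ))ᴴ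

/-- The marginal on the first and third tensor factors. -/
def margAE (X : Matrix ((a × b) × μ) ((a × b) × μ) ℂ) : Matrix (a × μ) (a × μ) ℂ :=
  traceSnd (X.submatrix (fun p : (a × μ) × b => ((p.1.1, p.2), p.1.2))
    (fun p => ((p.1.1, p.2), p.1.2)))

/-- The marginal on the second and third tensor factors. -/
def margBE (X : Matrix ((a × b) × μ) ((a × b) × μ) ℂ) : Matrix (b × μ) (b × μ) ℂ :=
  traceSnd (X.submatrix (fun p : (b × μ) × a => ((p.2, p.1.1), p.1.2))
    (fun p => ((p.2, p.1.1), p.1.2)))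

/-- Tensoring with the maximally mixed state of `s`. -/
def withMixed {k n : Type*} (s : Type*) [Fintype s] [DecidableEq s] (e : k ≃ s × n)
    (Z : Matrix n n ℂ) : Matrix k k ℂ :=
  (((Fintype.card s : ℂ)⁻¹ • (1 : Matrix s s ℂ)) ⊗ₖ Z).submatrix e e

variable {k n : Type*} [Fintype k] [DecidableEq k] [Fintype n] [DecidableEq n]

lemma posSemidef_withMixed (e : k ≃ s × n) {Z : Matrix n n ℂ} (hZ : Z.PosSemidef) :
    (withMixed s e Z).PosSemidef := by
  refine Matrix.PosSemidef.submatrix (Matrix.PosSemidef.kronecker (Matrix.PosSemidef.one.smul ?_)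
    hZ) _
  rw [← Complex.ofReal_natCast, ← Complex.ofReal_inv]
  exact_mod_cast inv_nonneg.2 (Nat.cast_nonneg _)

lemma trace_withMixed [Nonempty s] (e : k ≃ s × n) (Z : Matrix n n ℂ) :
    (withMixed s e Z).trace = Z.trace := by
  have h0 : (Fintype.card s : ℂ) ≠ 0 := by exact_mod_cast Fintype.card_ne_zero
  have h1 : (withMixed s e Z).trace =
      (((Fintype.card s : ℂ)⁻¹ • (1 : Matrix s s ℂ)) ⊗ₖ Z).trace :=
    Equiv.sum_comp e fun i => (((Fintype.card s : ℂ)⁻¹ • (1 : Matrix s s ℂ)) ⊗ₖ Z) i i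
  rw [h1, Matrix.trace_kronecker, Matrix.trace_smul, Matrix.trace_one, smul_eq_mul,
    inv_mul_cancel₀ h0, one_mul]

lemma traceNorm_withMixed_le [Nonempty s] (e : k ≃ s × n) {Z : Matrix n n ℂ}
    (hZ : Z.IsHermitian) : traceNorm (withMixed s e Z) ≤ traceNorm Z := by
  obtain ⟨P, N, hP, hN, h, -, ht⟩ := exists_posPart_negPart hZ
  have e1 : withMixed s e Z = withMixed s e P - withMixed s e N := by
    rw [h, withMixed, kronecker_sub, Matrix.submatrix_sub]; rfl
  rw [e1, ← ht]
  refine (traceNorm_sub_le (posSemidef_withMixed e hP) (posSemidef_withMixed e hN)).trans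
    (le_of_eq ?_)
  rw [trace_withMixed, trace_withMixed]

/-- Moving the second factor to the front. -/
def sndFront (r s μ : Type*) : (r × s) × μ ≃ s × (r × μ) :=
  ⟨fun p => (p.1.2, (p.1.1, p.2)), fun p => ((p.2.1, p.1), p.2.2), fun _ => rfl, fun _ => rfl⟩

/-- Reassociation of a triple product. -/
def fstFront (r s μ : Type*) : (r × s) × μ ≃ r × (s × μ) :=
  ⟨fun p => (p.1.1, (p.1.2, p.2)), fun p => ((p.1, p.2.1), p.2.2), fun _ => rfl, fun _ => rfl⟩

/-- A depolarised factor is traced out, so only a marginal of X remains. This is what permits each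
marginal its own smoothing. -/
lemma lift_kerProd_kerBar (t : Ker r a) (X : Matrix ((a × b) × μ) ((a × b) × μ) ℂ) :
    lift (kerProd t (kerBar : Ker s b)) X =
      withMixed s (sndFront r s μ) (lift t (margAE X)) := by
  ext p q
  simp only [lift, kerProd, kerBar, withMixed, margAE, traceSnd, Matrix.submatrix_apply,
    Matrix.kroneckerMap_apply, Matrix.smul_apply, Matrix.one_apply, sndFront, Equiv.coe_fn_mk,
    Fintype.sum_prod_type, smul_eq_mul, mul_ite, mul_one, mul_zero, ite_mul, zero_mul,
    Finset.sum_ite_eq, Finset.mem_univ, if_true, Finset.mul_sum]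
  refine Finset.sum_congr rfl fun y _ => ?_
  rw [Finset.sum_comm]
  refine Finset.sum_congr rfl fun y' _ => Finset.sum_congr rfl fun z _ => ?_
  split_ifs <;> ring

lemma lift_kerBar_kerProd (t : Ker s b) (X : Matrix ((a × b) × μ) ((a × b) × μ) ℂ) :
    lift (kerProd (kerBar : Ker r a) t) X =
      withMixed r (fstFront r s μ) (lift t (margBE X)) := by
  ext p q
  simp only [lift, kerProd, kerBar, withMixed, margBE, traceSnd, Matrix.submatrix_apply,
    Matrix.kroneckerMap_apply, Matrix.smul_apply, Matrix.one_apply, fstFront, Equiv.coe_fn_mk,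
    Fintype.sum_prod_type, smul_eq_mul, mul_ite, mul_one, mul_zero, ite_mul, zero_mul,
    Finset.mul_sum]
  rw [Finset.sum_comm]
  refine Finset.sum_congr rfl fun z _ => ?_
  rw [Finset.sum_congr rfl fun y _ => Finset.sum_comm, Finset.sum_comm]
  refine Finset.sum_congr rfl fun z' _ => Finset.sum_congr rfl fun y _ => ?_
  rw [Finset.sum_eq_single y (fun x _ hx => by simp [Ne.symm hx]) (by simp)]
  simp only [if_true]
  split_ifs <;> ring

lemma localConj_apply (Z : Matrix a a ℂ) (Y : Matrix b b ℂ)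
    (X : Matrix ((a × b) × μ) ((a × b) × μ) ℂ) (p q : (a × b) × μ) :
    localConj Z Y X p q = ∑ x, ∑ y, ∑ x', ∑ y', (Z p.1.1 x * Y p.1.2 y) *
      conj (Z q.1.1 x' * Y q.1.2 y') * X ((x, y), p.2) ((x', y'), q.2) := by
  rw [localConj, kronecker_one_conj_apply]
  simp only [Fintype.sum_prod_type, Matrix.kroneckerMap_apply]

/-- Instruments on the discarded factor do not affect the marginal. -/
lemma margAE_localConj_add {K L : Matrix b b ℂ} (h : Kᴴ * K + Lᴴ * L = 1) (Z : Matrix a a ℂ)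
    (X : Matrix ((a × b) × μ) ((a × b) × μ) ℂ) :
    margAE (localConj Z K X) + margAE (localConj Z L X) =
      (Z ⊗ₖ (1 : Matrix μ μ ℂ)) * margAE X * (Z ⊗ₖ (1 : Matrix μ μ ℂ))ᴴ := by
  have key : ∀ y y' : b, ∑ z, (K z y * conj (K z y') + L z y * conj (L z y')) =
      if y = y' then 1 else 0 := by
    intro y y'
    have := congrFun (congrFun h y') y
    simp only [Matrix.add_apply, Matrix.mul_apply, Matrix.conjTranspose_apply, Complex.star_def,
      ← Finset.sum_add_distrib, Matrix.one_apply] at this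
    simp only [eq_comm (a := y), ← this]
    exact Finset.sum_congr rfl fun z _ => by ring
  ext p q
  rw [kronecker_one_conj_apply]
  simp only [Matrix.add_apply, margAE, traceSnd, Matrix.submatrix_apply, localConj_apply,
    ← Finset.sum_add_distrib]
  rw [Finset.sum_comm]
  refine Finset.sum_congr rfl fun x _ => ?_
  calc _ = ∑ y, ∑ x', ∑ y', Z p.1 x * conj (Z q.1 x') * X ((x, y), p.2) ((x', y'), q.2) *
        ∑ z, (K z y * conj (K z y') + L z y * conj (L z y')) := by
        rw [Finset.sum_comm]
        refine Finset.sum_congr rfl fun y _ => ?_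
        rw [Finset.sum_comm]
        refine Finset.sum_congr rfl fun x' _ => ?_
        rw [Finset.sum_comm]
        refine Finset.sum_congr rfl fun y' _ => ?_
        rw [Finset.mul_sum]
        refine Finset.sum_congr rfl fun z _ => ?_
        simp only [map_mul]
        ring
    _ = _ := by
        simp only [key, mul_ite, mul_one, mul_zero, Finset.sum_ite_eq, Finset.mem_univ, if_true]
        rw [Finset.sum_comm]
        simp only [Finset.mul_sum]

lemma margBE_localConj_add {K L : Matrix a a ℂ} (h : Kᴴ * K + Lᴴ * L = 1) (Z : Matrix b b ℂ)
    (X : Matrix ((a × b) × μ) ((a × b) × μ) ℂ) :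
    margBE (localConj K Z X) + margBE (localConj L Z X) =
      (Z ⊗ₖ (1 : Matrix μ μ ℂ)) * margBE X * (Z ⊗ₖ (1 : Matrix μ μ ℂ))ᴴ := by
  -- Exchanging the two senders reduces the claim to `margAE`.
  have sw : ∀ (Z : Matrix a a ℂ) (Y : Matrix b b ℂ), margBE (localConj Z Y X) =
      margAE (localConj Y Z (X.submatrix (Prod.map Prod.swap id) (Prod.map Prod.swap id))) := by
    intro Z Y
    ext p q
    simp only [margAE, margBE, traceSnd, Matrix.submatrix_apply, localConj_apply, Prod.map_apply,
      Prod.swap_prod_mk, id]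
    refine Finset.sum_congr rfl fun z _ => ?_
    rw [Finset.sum_comm]
    refine Finset.sum_congr rfl fun y _ => Finset.sum_congr rfl fun x _ => ?_
    rw [Finset.sum_comm]
    refine Finset.sum_congr rfl fun y' _ => Finset.sum_congr rfl fun x' _ => ?_
    rw [mul_comm (Z _ _), mul_comm (Z _ _)]
  rw [sw, sw, margAE_localConj_add h]
  rfl

end Marginals

/-! ### Decoupling the environment from both references -/

section Decoupling

variable {r s f g a b μ : Type*} [Fintype r] [DecidableEq r] [Fintype s] [DecidableEq s]
  [Fintype f] [DecidableEq f] [Fintype g] [DecidableEq g]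
  [Fintype a] [DecidableEq a] [Fintype b] [DecidableEq b] [Fintype μ] [DecidableEq μ]

lemma lift_kerBar_conj_add {K L : Matrix a a ℂ} (h : Kᴴ * K + Lᴴ * L = 1)
    (X : Matrix (a × μ) (a × μ) ℂ) :
    lift (kerBar : Ker r a) ((K ⊗ₖ (1 : Matrix μ μ ℂ)) * X * (K ⊗ₖ (1 : Matrix μ μ ℂ))ᴴ) +
      lift kerBar ((L ⊗ₖ (1 : Matrix μ μ ℂ)) * X * (L ⊗ₖ (1 : Matrix μ μ ℂ))ᴴ) =
      lift kerBar X := by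
  have key : ∀ y y' : a, ∑ z, (K z y * conj (K z y') + L z y * conj (L z y')) =
      if y = y' then 1 else 0 := by
    intro y y'
    have := congrFun (congrFun h y') y
    simp only [Matrix.add_apply, Matrix.mul_apply, Matrix.conjTranspose_apply, Complex.star_def,
      ← Finset.sum_add_distrib, Matrix.one_apply] at this
    simp only [eq_comm (a := y), ← this]
    exact Finset.sum_congr rfl fun z _ => by ring
  ext p q
  simp only [Matrix.add_apply, lift, kronecker_one_conj_apply, kerBar, mul_ite, mul_one, mul_zero,
    ite_mul, zero_mul, Finset.sum_ite_eq, Finset.mem_univ, if_true, ← Finset.sum_add_distrib]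
  split_ifs with hpq
  · simp only [← mul_add, ← Finset.mul_sum, ← Finset.sum_add_distrib]
    congr 1
    calc _ = ∑ y, ∑ y', X (y, p.2) (y', q.2) *
          ∑ z, (K z y * conj (K z y') + L z y * conj (L z y')) := by
          rw [Finset.sum_comm]
          refine Finset.sum_congr rfl fun y _ => ?_
          rw [Finset.sum_comm]
          refine Finset.sum_congr rfl fun y' _ => ?_
          rw [Finset.mul_sum]
          exact Finset.sum_congr rfl fun z _ => by ring
      _ = _ := by
          simp only [key, mul_ite, mul_one, mul_zero, Finset.sum_ite_eq, Finset.mem_univ, if_true]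
  · simp

lemma expect_kerProd {S T : Type*} [Fintype S] [Fintype T] (t : S → Ker r a) (u : T → Ker s b)
    (i i' : r × s) (y y' : a × b) :
    𝔼 ω : S × T, kerProd (t ω.1) (u ω.2) i i' y y' =
      (𝔼 σ, t σ i.1 i'.1 y.1 y'.1) * 𝔼 τ, u τ i.2 i'.2 y.2 y'.2 := by
  rw [expect_prod_complex, Finset.expect_mul]
  refine Finset.expect_congr rfl fun σ _ => ?_
  rw [Finset.mul_expect]
  rfl

/-- Two completely positive terms occur with each sign; this accounts for the constant 4 in front of
the smoothing error of the joint state. -/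
lemma kerProd_kerDev (σ : a × (r × f) → ZMod 3) (τ : b × (s × g) → ZMod 3) :
    kerProd (kerDev σ) (kerDev τ) =
      (kerProd (kerRand σ) (kerRand τ) + kerProd kerBar kerBar) -
        (kerProd (kerRand σ) kerBar + kerProd kerBar (kerRand τ)) := by
  funext i i' y y'
  simp only [kerProd, kerDev, Pi.sub_apply, Pi.add_apply]
  ring

variable [Nonempty r] [Nonempty s] [Nonempty f] [Nonempty g]

lemma expect_trace_lift_kerProd_left (X : Matrix ((a × b) × μ) ((a × b) × μ) ℂ) :
    𝔼 σ : (a × (r × f) → ZMod 3) × (b × (s × g) → ZMod 3),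
      (lift (kerProd (kerRand σ.1) (kerBar : Ker s b)) X).trace.re = X.trace.re := by
  rw [expect_trace_lift (t' := kerProd (kerBar : Ker r a) (kerBar : Ker s b)), kerProd_kerBar,
    trace_lift_kerBar]
  intro i i' y y'
  rw [expect_kerProd (fun σ => kerRand σ) (fun _ => kerBar), expect_kerRand, Fintype.expect_const]
  rfl

lemma expect_trace_lift_kerProd_right (X : Matrix ((a × b) × μ) ((a × b) × μ) ℂ) :
    𝔼 σ : (a × (r × f) → ZMod 3) × (b × (s × g) → ZMod 3),
      (lift (kerProd (kerBar : Ker r a) (kerRand σ.2)) X).trace.re = X.trace.re := by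
  rw [expect_trace_lift (t' := kerProd (kerBar : Ker r a) (kerBar : Ker s b)), kerProd_kerBar,
    trace_lift_kerBar]
  intro i i' y y'
  rw [expect_kerProd (fun _ => kerBar) (fun τ => kerRand τ), expect_kerRand, Fintype.expect_const]
  rfl

lemma expect_trace_lift_kerProd_both (X : Matrix ((a × b) × μ) ((a × b) × μ) ℂ) :
    𝔼 σ : (a × (r × f) → ZMod 3) × (b × (s × g) → ZMod 3),
      (lift (kerProd (kerRand σ.1) (kerRand σ.2)) X).trace.re = X.trace.re := by
  rw [expect_trace_lift (t' := kerProd (kerBar : Ker r a) (kerBar : Ker s b)), kerProd_kerBar,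
    trace_lift_kerBar]
  intro i i' y y'
  rw [expect_kerProd (fun σ => kerRand σ) (fun τ => kerRand τ), expect_kerRand, expect_kerRand]
  rfl

/-- The random maps with truncated input against the completely depolarising map. -/
lemma lift_kerProd_kerRand_sub {KA LA : Matrix a a ℂ} {KB LB : Matrix b b ℂ}
    (hA : KAᴴ * KA + LAᴴ * LA = 1) (hB : KBᴴ * KB + LBᴴ * LB = 1)
    (ρ : Matrix ((a × b) × μ) ((a × b) × μ) ℂ)
    (σ : a × (r × f) → ZMod 3) (τ : b × (s × g) → ZMod 3) :
    lift (kerProd (kerRand σ) (kerRand τ)) (localConj KA KB ρ) - lift kerBar ρ =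
      lift (kerProd (kerDev σ) (kerDev τ)) (localConj KA KB ρ) +
      (withMixed s (sndFront r s μ) (lift (kerDev σ)
        ((KA ⊗ₖ (1 : Matrix μ μ ℂ)) * margAE ρ * (KA ⊗ₖ (1 : Matrix μ μ ℂ))ᴴ)) +
      (withMixed r (fstFront r s μ) (lift (kerDev τ)
        ((KB ⊗ₖ (1 : Matrix μ μ ℂ)) * margBE ρ * (KB ⊗ₖ (1 : Matrix μ μ ℂ))ᴴ)) -
      (lift (kerProd (kerRand σ) kerBar) (localConj KA LB ρ) +
        lift (kerProd kerBar (kerRand τ)) (localConj LA KB ρ) +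
        lift kerBar (localConj LA LB ρ)))) := by
  have wadd : ∀ {k n : Type _} [Fintype k] [DecidableEq k] [Fintype n] [DecidableEq n]
      (e : k ≃ s × n) (X Y : Matrix n n ℂ),
      withMixed s e (X + Y) = withMixed s e X + withMixed s e Y := by
    intro k n _ _ _ _ e X Y
    rw [withMixed, Matrix.kronecker_add, Matrix.submatrix_add]; rfl
  have wadd' : ∀ {k n : Type _} [Fintype k] [DecidableEq k] [Fintype n] [DecidableEq n]
      (e : k ≃ r × n) (X Y : Matrix n n ℂ),
      withMixed r e (X + Y) = withMixed r e X + withMixed r e Y := by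
    intro k n _ _ _ _ e X Y
    rw [withMixed, Matrix.kronecker_add, Matrix.submatrix_add]; rfl
  -- Adding Bob's complementary outcome turns the marginal of the doubly truncated state into the
  -- truncated marginal of ρ itself, to which the smoothing of that marginal applies.
  have hl : ∀ t : Ker r a, lift (kerProd t (kerBar : Ker s b)) (localConj KA KB ρ) +
      lift (kerProd t kerBar) (localConj KA LB ρ) = withMixed s (sndFront r s μ) (lift t
        ((KA ⊗ₖ (1 : Matrix μ μ ℂ)) * margAE ρ * (KA ⊗ₖ (1 : Matrix μ μ ℂ))ᴴ)) := by
    intro t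
    rw [← margAE_localConj_add hB, lift_add_right, wadd, ← lift_kerProd_kerBar,
      ← lift_kerProd_kerBar]
  have hr : ∀ (Z : Matrix b b ℂ) (t : Ker s b),
      lift (kerProd (kerBar : Ker r a) t) (localConj KA Z ρ) +
      lift (kerProd kerBar t) (localConj LA Z ρ) = withMixed r (fstFront r s μ) (lift t
        ((Z ⊗ₖ (1 : Matrix μ μ ℂ)) * margBE ρ * (Z ⊗ₖ (1 : Matrix μ μ ℂ))ᴴ)) := by
    intro Z t
    rw [← margBE_localConj_add hA, lift_add_right, wadd', ← lift_kerBar_kerProd,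
      ← lift_kerBar_kerProd]
  -- The four measurement outcomes together restore the depolarised untruncated state.
  have hbb : lift (kerBar : Ker (r × s) (a × b)) (localConj KA KB ρ) +
      lift kerBar (localConj LA KB ρ) +
      (lift kerBar (localConj KA LB ρ) + lift kerBar (localConj LA LB ρ)) = lift kerBar ρ := by
    rw [← kerProd_kerBar, hr, hr, ← wadd', lift_kerBar_conj_add hB, ← lift_kerBar_kerProd]
  have hlF := hl (kerRand σ)
  have hlB := hl kerBar
  have hrF := hr KB (kerRand τ)
  have hrB := hr KB kerBar
  rw [kerProd_kerBar] at hlB hrB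
  rw [kerProd_kerDev, lift_sub, lift_add, lift_add, kerProd_kerBar]
  have wsub : withMixed s (sndFront r s μ) (lift (kerDev σ)
      ((KA ⊗ₖ (1 : Matrix μ μ ℂ)) * margAE ρ * (KA ⊗ₖ (1 : Matrix μ μ ℂ))ᴴ)) =
      withMixed s (sndFront r s μ) (lift (kerRand σ)
      ((KA ⊗ₖ (1 : Matrix μ μ ℂ)) * margAE ρ * (KA ⊗ₖ (1 : Matrix μ μ ℂ))ᴴ)) -
      withMixed s (sndFront r s μ) (lift kerBar
      ((KA ⊗ₖ (1 : Matrix μ μ ℂ)) * margAE ρ * (KA ⊗ₖ (1 : Matrix μ μ ℂ))ᴴ)) := by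
    rw [eq_sub_iff_add_eq, ← wadd, ← lift_add, kerDev, sub_add_cancel]
  have wsub' : withMixed r (fstFront r s μ) (lift (kerDev τ)
      ((KB ⊗ₖ (1 : Matrix μ μ ℂ)) * margBE ρ * (KB ⊗ₖ (1 : Matrix μ μ ℂ))ᴴ)) =
      withMixed r (fstFront r s μ) (lift (kerRand τ)
      ((KB ⊗ₖ (1 : Matrix μ μ ℂ)) * margBE ρ * (KB ⊗ₖ (1 : Matrix μ μ ℂ))ᴴ)) -
      withMixed r (fstFront r s μ) (lift kerBar
      ((KB ⊗ₖ (1 : Matrix μ μ ℂ)) * margBE ρ * (KB ⊗ₖ (1 : Matrix μ μ ℂ))ᴴ)) := by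
    rw [eq_sub_iff_add_eq, ← wadd', ← lift_add, kerDev, sub_add_cancel]
  rw [wsub, wsub', ← hlF, ← hlB, ← hrF, ← hrB, ← hbb]
  abel

/-- The four outcomes of the two local measurements have total weight Tr ρ; the three other than
(KA, KB) are the truncation loss. -/
lemma re_trace_localConj_add {KA LA : Matrix a a ℂ} {KB LB : Matrix b b ℂ}
    (hA : KAᴴ * KA + LAᴴ * LA = 1) (hB : KBᴴ * KB + LBᴴ * LB = 1)
    (ρ : Matrix ((a × b) × μ) ((a × b) × μ) ℂ) :
    (localConj KA LB ρ).trace.re + (localConj LA KB ρ).trace.re +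
      (localConj LA LB ρ).trace.re = ρ.trace.re - (localConj KA KB ρ).trace.re := by
  have e : ∀ (Z : Matrix a a ℂ) (Y : Matrix b b ℂ), (localConj Z Y ρ).trace =
      (((Zᴴ * Z) ⊗ₖ (Yᴴ * Y)) ⊗ₖ (1 : Matrix μ μ ℂ) * ρ).trace := by
    intro Z Y
    rw [localConj, Matrix.trace_mul_cycle, Matrix.conjTranspose_kronecker,
      Matrix.conjTranspose_kronecker, ← Matrix.mul_kronecker_mul, ← Matrix.mul_kronecker_mul,
      Matrix.conjTranspose_one, Matrix.one_mul]
  have h : (localConj KA KB ρ).trace + (localConj KA LB ρ).trace + ((localConj LA KB ρ).trace +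
      (localConj LA LB ρ).trace) = ρ.trace := by
    simp only [e]
    rw [← Matrix.trace_add, ← Matrix.trace_add, ← Matrix.trace_add, ← Matrix.add_mul,
      ← Matrix.add_mul, ← Matrix.add_mul, ← Matrix.add_kronecker, ← Matrix.add_kronecker,
      ← Matrix.add_kronecker, ← Matrix.kronecker_add, ← Matrix.kronecker_add,
      ← Matrix.add_kronecker, hA, hB, Matrix.one_kronecker_one, Matrix.one_kronecker_one,
      Matrix.one_mul]
  have := congrArg Complex.re h
  simp only [Complex.add_re] at this
  linarith

lemma isHermitian_withMixed {k n : Type*} (e : k ≃ s × n) {Z : Matrix n n ℂ}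
    (hZ : Z.IsHermitian) : (withMixed s e Z).IsHermitian := by
  refine Matrix.IsHermitian.submatrix ?_ e
  rw [Matrix.IsHermitian, Matrix.conjTranspose_kronecker, hZ.eq, Matrix.conjTranspose_smul,
    Matrix.conjTranspose_one]
  simp

lemma posSemidef_margAE {ρ : Matrix ((a × b) × μ) ((a × b) × μ) ℂ} (hρ : ρ.PosSemidef) :
    (margAE ρ).PosSemidef := by
  have e : margAE ρ = ∑ z, ρ.submatrix (fun p : a × μ => ((p.1, z), p.2))
      (fun p : a × μ => ((p.1, z), p.2)) := by
    ext p q; simp [margAE, traceSnd, Matrix.sum_apply]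
  rw [e]
  exact Matrix.posSemidef_sum _ fun z _ => hρ.submatrix _

lemma posSemidef_margBE {ρ : Matrix ((a × b) × μ) ((a × b) × μ) ℂ} (hρ : ρ.PosSemidef) :
    (margBE ρ).PosSemidef := by
  have e : margBE ρ = ∑ z, ρ.submatrix (fun p : b × μ => ((z, p.1), p.2))
      (fun p : b × μ => ((z, p.1), p.2)) := by
    ext p q; simp [margBE, traceSnd, Matrix.sum_apply]
  rw [e]
  exact Matrix.posSemidef_sum _ fun z _ => hρ.submatrix _

lemma traceNorm_add_add_sub_le {n : Type*} [Fintype n] [DecidableEq n] {A B C P : Matrix n n ℂ}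
    (hA : A.IsHermitian) (hB : B.IsHermitian) (hC : C.IsHermitian) (hP : P.PosSemidef) :
    traceNorm (A + (B + (C - P))) ≤
      traceNorm A + (traceNorm B + (traceNorm C + P.trace.re)) := by
  refine (traceNorm_add_le hA (hB.add (hC.sub hP.isHermitian))).trans (add_le_add le_rfl ?_)
  refine (traceNorm_add_le hB (hC.sub hP.isHermitian)).trans (add_le_add le_rfl ?_)
  rw [sub_eq_add_neg]
  refine (traceNorm_add_le hC hP.isHermitian.neg).trans (add_le_add le_rfl ?_)
  rw [traceNorm_neg hP.isHermitian]
  exact traceNorm_posSemidef_le hP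

lemma traceNorm_lift_kerProd_kerRand_sub_le {KA LA : Matrix a a ℂ} {KB LB : Matrix b b ℂ}
    (hA : KAᴴ * KA + LAᴴ * LA = 1) (hB : KBᴴ * KB + LBᴴ * LB = 1)
    {ρ : Matrix ((a × b) × μ) ((a × b) × μ) ℂ} (hρ : ρ.PosSemidef)
    (σ : a × (r × f) → ZMod 3) (τ : b × (s × g) → ZMod 3) :
    traceNorm (lift (kerProd (kerRand σ) (kerRand τ)) (localConj KA KB ρ) - lift kerBar ρ) ≤
      traceNorm (lift (kerProd (kerDev σ) (kerDev τ)) (localConj KA KB ρ)) +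
      (traceNorm (lift (kerDev σ)
        ((KA ⊗ₖ (1 : Matrix μ μ ℂ)) * margAE ρ * (KA ⊗ₖ (1 : Matrix μ μ ℂ))ᴴ)) +
      (traceNorm (lift (kerDev τ)
        ((KB ⊗ₖ (1 : Matrix μ μ ℂ)) * margBE ρ * (KB ⊗ₖ (1 : Matrix μ μ ℂ))ᴴ)) +
      ((lift (kerProd (kerRand σ) (kerBar : Ker s b)) (localConj KA LB ρ)).trace.re +
        (lift (kerProd (kerBar : Ker r a) (kerRand τ)) (localConj LA KB ρ)).trace.re +
        (localConj LA LB ρ).trace.re))) := by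
  have hconj : ∀ (Z : Matrix a a ℂ) (Y : Matrix b b ℂ), (localConj Z Y ρ).PosSemidef :=
    fun Z Y => hρ.mul_mul_conjTranspose_same _
  have hHA := Matrix.isHermitian_mul_mul_conjTranspose (KA ⊗ₖ (1 : Matrix μ μ ℂ))
    (posSemidef_margAE hρ).isHermitian
  have hHB := Matrix.isHermitian_mul_mul_conjTranspose (KB ⊗ₖ (1 : Matrix μ μ ℂ))
    (posSemidef_margBE hρ).isHermitian
  have w1 := (isHermKer_kerDev σ).isHermitian_lift hHA
  have w2 := (isHermKer_kerDev τ).isHermitian_lift hHB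
  have h0 := ((isHermKer_kerDev σ).kerProd (isHermKer_kerDev τ)).isHermitian_lift
    (hconj KA KB).isHermitian
  have p1 := ((isCP_kerRand σ).kerProd (isCP_kerBar (r := s) (a := b))).posSemidef_lift
    (hconj KA LB)
  have p2 := ((isCP_kerBar (r := r) (a := a)).kerProd (isCP_kerRand τ)).posSemidef_lift
    (hconj LA KB)
  have p3 := (isCP_kerBar (r := r × s) (a := a × b)).posSemidef_lift (hconj LA LB)
  rw [lift_kerProd_kerRand_sub hA hB]
  refine (traceNorm_add_add_sub_le h0 (isHermitian_withMixed _ w1) (isHermitian_withMixed _ w2)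
    ((p1.add p2).add p3)).trans ?_
  refine add_le_add le_rfl (add_le_add (traceNorm_withMixed_le _ w1)
    (add_le_add (traceNorm_withMixed_le _ w2) (le_of_eq ?_)))
  rw [Matrix.trace_add, Matrix.trace_add, Complex.add_re, Complex.add_re, trace_lift_kerBar]

/-- Decoupling: the environment is nearly independent of the references, on average over the
random phases. -/
theorem expect_traceNorm_decoupling_le {ρ : Matrix ((a × b) × μ) ((a × b) × μ) ℂ}
    (hρ : ρ.PosSemidef) (hρ1 : ρ.trace.re = 1) {KA : Matrix a a ℂ} {KB : Matrix b b ℂ}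
    (hKA : IsContraction KA) (hKB : IsContraction KB)
    {θ : Matrix μ μ ℂ} (hθ : θ.PosSemidef) (hθ1 : θ.trace.re = 1) {ε : ℝ}
    {T : Matrix ((a × b) × μ) ((a × b) × μ) ℂ} {TA : Matrix (a × μ) (a × μ) ℂ}
    {TB : Matrix (b × μ) (b × μ) ℂ} (hT : T.IsHermitian) (hTA : TA.IsHermitian)
    (hTB : TB.IsHermitian)
    (h : traceNorm (((1 : Matrix (a × b) (a × b) ℂ) ⊗ₖ cfc (fun x : ℝ => x ^ (1 / 4 : ℝ)) θ) * T *
        ((1 : Matrix (a × b) (a × b) ℂ) ⊗ₖ cfc (fun x : ℝ => x ^ (1 / 4 : ℝ)) θ) - ρ) ≤ ε)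
    (hA : traceNorm (((1 : Matrix a a ℂ) ⊗ₖ cfc (fun x : ℝ => x ^ (1 / 4 : ℝ)) θ) * TA *
        ((1 : Matrix a a ℂ) ⊗ₖ cfc (fun x : ℝ => x ^ (1 / 4 : ℝ)) θ) - margAE ρ) ≤ ε)
    (hB : traceNorm (((1 : Matrix b b ℂ) ⊗ₖ cfc (fun x : ℝ => x ^ (1 / 4 : ℝ)) θ) * TB *
        ((1 : Matrix b b ℂ) ⊗ₖ cfc (fun x : ℝ => x ^ (1 / 4 : ℝ)) θ) - margBE ρ) ≤ ε) :
    𝔼 σ : (a × (r × f) → ZMod 3) × (b × (s × g) → ZMod 3),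
      traceNorm (lift (kerProd (kerRand σ.1) (kerRand σ.2)) (localConj KA KB ρ) -
        lift kerBar ρ) ≤
      8 * ε + (1 - (localConj KA KB ρ).trace.re) +
        (√((Fintype.card r * Fintype.card s) * ((Fintype.card f * Fintype.card g : ℝ)⁻¹ * frobSq T)) +
        √(Fintype.card r * ((Fintype.card f : ℝ)⁻¹ * frobSq TA)) +
        √(Fintype.card s * ((Fintype.card g : ℝ)⁻¹ * frobSq TB))) := by
  obtain ⟨LA, hLA⟩ := hKA.exists_complement
  obtain ⟨LB, hLB⟩ := hKB.exists_complement
  have hmA := posSemidef_margAE hρ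
  have hmB := posSemidef_margBE hρ
  refine (Finset.expect_le_expect fun σ _ =>
    traceNorm_lift_kerProd_kerRand_sub_le hLA hLB hρ σ.1 σ.2).trans ?_
  simp only [Finset.expect_add_distrib]
  rw [expect_trace_lift_kerProd_left, expect_trace_lift_kerProd_right, Fintype.expect_const,
    re_trace_localConj_add hLA hLB, hρ1]
  -- The joint term contributes 4ε and each single-sender term, `b2` and `b3`, contributes 2ε, which
  -- makes 8ε.
  have b1 : 𝔼 σ : (a × (r × f) → ZMod 3) × (b × (s × g) → ZMod 3),
      traceNorm (lift (kerProd (kerDev σ.1) (kerDev σ.2)) (localConj KA KB ρ)) ≤ 4 * ε +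
      √((Fintype.card r * Fintype.card s) *
        ((Fintype.card f * Fintype.card g : ℝ)⁻¹ * frobSq T)) := by
    have := expect_traceNorm_lift_le (S := (a × (r × f) → ZMod 3) × (b × (s × g) → ZMod 3))
      (u := fun σ => kerProd (kerRand σ.1) (kerRand σ.2) +
        kerProd (kerBar : Ker r a) (kerBar : Ker s b))
      (v := fun σ => kerProd (kerRand σ.1) kerBar + kerProd kerBar (kerRand σ.2))
      (k := 4) (η := (Fintype.card f * Fintype.card g : ℝ)⁻¹)
      (fun σ => ((isCP_kerRand σ.1).kerProd (isCP_kerRand σ.2)).add (isCP_kerBar.kerProd isCP_kerBar))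
      (fun σ => ((isCP_kerRand σ.1).kerProd isCP_kerBar).add
        (isCP_kerBar.kerProd (isCP_kerRand σ.2))) (by norm_num) ?_ ?_ (by positivity)
      (hKA.kronecker hKB) hρ.isHermitian hT hθ hθ1 h
    · simp only [← kerProd_kerDev, Fintype.card_prod, Nat.cast_mul] at this
      exact this
    · intro X
      simp only [lift_add, Matrix.trace_add, Complex.add_re, Finset.expect_add_distrib]
      rw [expect_trace_lift_kerProd_left, expect_trace_lift_kerProd_right,
        expect_trace_lift_kerProd_both, kerProd_kerBar, trace_lift_kerBar, Fintype.expect_const]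
      ring
    · intro X
      simp only [← kerProd_kerDev]
      rw [expect_prod, inv_mul_eq_div]
      exact expect_frobSq_lift_kerProd_kerDev_le X
  have b2 : 𝔼 σ : (a × (r × f) → ZMod 3) × (b × (s × g) → ZMod 3),
      traceNorm (lift (kerDev σ.1)
        ((KA ⊗ₖ (1 : Matrix μ μ ℂ)) * margAE ρ * (KA ⊗ₖ (1 : Matrix μ μ ℂ))ᴴ)) ≤ 2 * ε +
      √(Fintype.card r * ((Fintype.card f : ℝ)⁻¹ * frobSq TA)) := by
    refine expect_traceNorm_lift_le (S := (a × (r × f) → ZMod 3) × (b × (s × g) → ZMod 3))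
      (u := fun σ => kerRand σ.1) (v := fun σ => kerBar)
      (fun σ => isCP_kerRand σ.1) (fun σ => isCP_kerBar) (by norm_num) ?_ ?_ (by positivity)
      hKA hmA.isHermitian hTA hθ hθ1 hA
    · intro X
      simp only [lift_add, Matrix.trace_add, Complex.add_re, Finset.expect_add_distrib]
      rw [expect_prod]
      simp only [Fintype.expect_const]
      rw [expect_trace_lift expect_kerRand, trace_lift_kerBar]
      ring
    · intro X
      rw [expect_prod, inv_mul_eq_div]
      simp only [Fintype.expect_const]
      exact expect_frobSq_lift_kerDev_le X
  have b3 : 𝔼 σ : (a × (r × f) → ZMod 3) × (b × (s × g) → ZMod 3),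
      traceNorm (lift (kerDev σ.2)
        ((KB ⊗ₖ (1 : Matrix μ μ ℂ)) * margBE ρ * (KB ⊗ₖ (1 : Matrix μ μ ℂ))ᴴ)) ≤ 2 * ε +
      √(Fintype.card s * ((Fintype.card g : ℝ)⁻¹ * frobSq TB)) := by
    refine expect_traceNorm_lift_le (S := (a × (r × f) → ZMod 3) × (b × (s × g) → ZMod 3))
      (u := fun σ => kerRand σ.2) (v := fun σ => kerBar)
      (fun σ => isCP_kerRand σ.2) (fun σ => isCP_kerBar) (by norm_num) ?_ ?_ (by positivity)
      hKB hmB.isHermitian hTB hθ hθ1 hB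
    · intro X
      simp only [lift_add, Matrix.trace_add, Complex.add_re, Finset.expect_add_distrib]
      rw [expect_prod]
      simp only [Fintype.expect_const]
      rw [expect_trace_lift expect_kerRand, trace_lift_kerBar]
      ring
    · intro X
      rw [expect_prod, inv_mul_eq_div]
      simp only [Fintype.expect_const]
      exact expect_frobSq_lift_kerDev_le X
  linarith

end Decoupling

/-! ### Amplitude matrices of encoded states -/

section Amplitudes

variable {r s f g a b c e n m : Type*} [Fintype r] [DecidableEq r] [Fintype s] [DecidableEq s]
  [Fintype f] [DecidableEq f] [Fintype g] [DecidableEq g] [Fintype n] [DecidableEq n]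
  [Fintype a] [DecidableEq a] [Fintype b] [DecidableEq b] [Fintype c] [DecidableEq c]
  [Fintype e] [DecidableEq e] [Fintype m] [DecidableEq m]

/-- The reduced state on input reference and environment of the vectors `Z`. -/
def envState (Z : Matrix (c × e) n ℂ) : Matrix (n × e) (n × e) ℂ :=
  fun p q => ∑ k, Z (k, p.2) p.1 * conj (Z (k, q.2) q.1)

/-- The amplitudes of the state produced by the (normalised) encoders `P` and `Q`, with the
references and the environment as row index and the receiver's registers as column index. -/
def outputAmp (U : Matrix (c × e) (a × b) ℂ) (P : Matrix a (r × f) ℂ) (Q : Matrix b (s × g) ℂ) :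
    Matrix ((r × s) × e) (c × (f × g)) ℂ :=
  fun p q => (U * (P ⊗ₖ Q)) (q.1, p.2) ((p.1.1, q.2.1), (p.1.2, q.2.2))

lemma frobSq_kronecker (P : Matrix a m ℂ) (Q : Matrix b n ℂ) :
    frobSq (P ⊗ₖ Q) = frobSq P * frobSq Q := by
  simp only [frobSq, Fintype.sum_prod_type, Matrix.kroneckerMap_apply, norm_mul, mul_pow,
    Finset.sum_mul_sum]

lemma frobSq_outputAmp {U : Matrix (c × e) (a × b) ℂ} (hU : Uᴴ * U = 1) (P : Matrix a (r × f) ℂ)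
    (Q : Matrix b (s × g) ℂ) : frobSq (outputAmp U P Q) = frobSq P * frobSq Q := by
  rw [← frobSq_kronecker, ← frobSq_isometry_mul hU]
  let φ : ((r × s) × e) × (c × (f × g)) ≃ (c × e) × ((r × f) × (s × g)) :=
    ⟨fun p => ((p.2.1, p.1.2), ((p.1.1.1, p.2.2.1), (p.1.1.2, p.2.2.2))),
      fun p => (((p.2.1.1, p.2.2.1), p.1.2), (p.1.1, (p.2.1.2, p.2.2.2))),
      fun _ => rfl, fun _ => rfl⟩
  have h := Equiv.sum_comp φ fun p => ‖(U * (P ⊗ₖ Q)) p.1 p.2‖ ^ 2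
  exact (Fintype.sum_prod_type' fun p q => ‖outputAmp U P Q p q‖ ^ 2).symm.trans
    (h.trans (Fintype.sum_prod_type' fun p q => ‖(U * (P ⊗ₖ Q)) p q‖ ^ 2))

lemma outputAmp_add_left (U : Matrix (c × e) (a × b) ℂ) (P P' : Matrix a (r × f) ℂ)
    (Q : Matrix b (s × g) ℂ) :
    outputAmp U (P + P') Q = outputAmp U P Q + outputAmp U P' Q := by
  ext p q
  simp [outputAmp, Matrix.add_kronecker, Matrix.mul_add]

lemma outputAmp_add_right (U : Matrix (c × e) (a × b) ℂ) (P : Matrix a (r × f) ℂ)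
    (Q Q' : Matrix b (s × g) ℂ) :
    outputAmp U P (Q + Q') = outputAmp U P Q + outputAmp U P Q' := by
  ext p q
  simp [outputAmp, Matrix.kronecker_add, Matrix.mul_add]

lemma outputAmp_smul (U : Matrix (c × e) (a × b) ℂ) (z w : ℂ) (P : Matrix a (r × f) ℂ)
    (Q : Matrix b (s × g) ℂ) :
    outputAmp U (z • P) (w • Q) = (z * w) • outputAmp U P Q := by
  ext p q
  simp [outputAmp, Matrix.smul_kronecker, Matrix.kronecker_smul, mul_assoc, mul_left_comm w]

lemma frob_outputAmp {U : Matrix (c × e) (a × b) ℂ} (hU : Uᴴ * U = 1) (P : Matrix a (r × f) ℂ)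
    (Q : Matrix b (s × g) ℂ) : frob (outputAmp U P Q) = frob P * frob Q := by
  rw [frob, frobSq_outputAmp hU, Real.sqrt_mul (frobSq_nonneg _)]; rfl

/-- Perturbing the encoders. -/
lemma traceNorm_outputAmp_sub_le {U : Matrix (c × e) (a × b) ℂ} (hU : Uᴴ * U = 1)
    {P P' : Matrix a (r × f) ℂ} {Q Q' : Matrix b (s × g) ℂ} (hP : frob P = 1) (hQ : frob Q = 1) :
    traceNorm (outputAmp U P Q * (outputAmp U P Q)ᴴ - outputAmp U P' Q' * (outputAmp U P' Q')ᴴ) ≤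
      (1 + frob (P - P')) ^ 2 * (1 + frob (Q - Q')) ^ 2 - 1 := by
  refine (traceNorm_mul_conjTranspose_sub_le _ _).trans ?_
  -- Telescoping over the two encoders; 2z + z² = (1 + z)² − 1 then produces the squares in the
  -- statement.
  have hx : frob (outputAmp U P Q - outputAmp U P' Q') ≤
      (1 + frob (P - P')) * (1 + frob (Q - Q')) - 1 := by
    have e1 : outputAmp U P Q - outputAmp U P' Q' =
        outputAmp U (P - P') Q + outputAmp U P' (Q - Q') := by
      have h1 : outputAmp U P Q = outputAmp U (P - P') Q + outputAmp U P' Q := by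
        rw [← outputAmp_add_left, sub_add_cancel]
      have h2 : outputAmp U P' Q = outputAmp U P' (Q - Q') + outputAmp U P' Q' := by
        rw [← outputAmp_add_right, sub_add_cancel]
      rw [h1, h2]; abel
    have hP' : frob P' ≤ 1 + frob (P - P') := by
      have : P' = P + -(P - P') := by abel
      have hn : frob (-(P - P')) = frob (P - P') := by rw [frob, frobSq_neg, frob]
      calc frob P' = frob (P + -(P - P')) := by rw [← this]
        _ ≤ frob P + frob (-(P - P')) := frob_add_le _ _
        _ = _ := by rw [hP, hn]
    rw [e1]
    refine (frob_add_le _ _).trans ?_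
    rw [frob_outputAmp hU, frob_outputAmp hU, hQ]
    nlinarith [mul_le_mul_of_nonneg_right hP' (frob_nonneg (Q - Q'))]
  rw [frob_outputAmp hU, hP, hQ]
  have h0 := frob_nonneg (outputAmp U P Q - outputAmp U P' Q')
  have h1 : (1 + frob (outputAmp U P Q - outputAmp U P' Q')) ^ 2 ≤
      ((1 + frob (P - P')) * (1 + frob (Q - Q'))) ^ 2 := by
    apply pow_le_pow_left₀ (by linarith)
    linarith
  rw [mul_pow] at h1
  linarith

/-- The matrix of random phases. -/
def phaseMat (σ : a × n → ZMod 3) : Matrix a n ℂ := fun y j => phase σ (y, j)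

/-- Transpose trick: encoding with A times the phase matrix has the same effect on references and
environment as the random map applied to the reference of the state with amplitudes A. The registers
f and g belong to the receiver and are traced out here. -/
lemma lift_kerRand_envState (U : Matrix (c × e) (a × b) ℂ) (A : Matrix a a ℂ) (B : Matrix b b ℂ)
    (σ : a × (r × f) → ZMod 3) (τ : b × (s × g) → ZMod 3) :
    lift (kerProd (kerRand σ) (kerRand τ)) (envState (U * (A ⊗ₖ B))) =
      (((Fintype.card r : ℂ) * Fintype.card f)⁻¹ * ((Fintype.card s : ℂ) * Fintype.card g)⁻¹) •
        (outputAmp U (A * phaseMat σ) (B * phaseMat τ) *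
          (outputAmp U (A * phaseMat σ) (B * phaseMat τ))ᴴ) := by
  set Z := U * (A ⊗ₖ B) with hZ
  have hamp : ∀ p q, outputAmp U (A * phaseMat σ) (B * phaseMat τ) p q =
      ∑ y : a × b, Z (q.1, p.2) y * (phase σ (y.1, (p.1.1, q.2.1)) *
        phase τ (y.2, (p.1.2, q.2.2))) := by
    intro p q
    rw [outputAmp, Matrix.mul_kronecker_mul, ← Matrix.mul_assoc, ← hZ, Matrix.mul_apply]
    rfl
  ext p q
  rw [Matrix.smul_apply, Matrix.mul_apply, smul_eq_mul]
  simp only [Matrix.conjTranspose_apply, hamp, Complex.star_def, map_sum, map_mul,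
    Finset.sum_mul_sum, lift, kerProd, kerRand, envState]
  conv_rhs => rw [Finset.sum_comm, Finset.mul_sum]
  refine Finset.sum_congr rfl fun y _ => ?_
  conv_rhs => rw [Finset.sum_comm, Finset.mul_sum]
  refine Finset.sum_congr rfl fun y' _ => ?_
  simp only [Fintype.sum_prod_type]
  rw [mul_mul_mul_comm, mul_assoc, Finset.sum_mul_sum]
  congr 1
  rw [mul_comm, Finset.sum_mul]
  refine Finset.sum_congr rfl fun k _ => ?_
  rw [Finset.mul_sum]
  refine Finset.sum_congr rfl fun i _ => ?_
  rw [Finset.mul_sum]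
  refine Finset.sum_congr rfl fun j _ => ?_
  ring

/-- An operator on the reference acts as its transpose on the amplitudes. -/
lemma conj_envState (Z : Matrix (c × e) n ℂ) (A : Matrix n n ℂ) :
    (A ⊗ₖ (1 : Matrix e e ℂ)) * envState Z * (A ⊗ₖ (1 : Matrix e e ℂ))ᴴ = envState (Z * Aᵀ) := by
  ext p q
  rw [kronecker_one_conj_apply]
  simp only [envState, Matrix.mul_apply, Matrix.transpose_apply, map_sum, map_mul,
    Finset.sum_mul_sum]
  simp only [Finset.mul_sum]
  rw [Finset.sum_congr rfl fun y _ => Finset.sum_comm, Finset.sum_comm]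
  refine Finset.sum_congr rfl fun k _ => Finset.sum_congr rfl fun y _ =>
    Finset.sum_congr rfl fun y' _ => ?_
  ring

lemma trace_envState (Z : Matrix (c × e) n ℂ) : (envState Z).trace = (frobSq Z : ℂ) := by
  rw [← trace_conjTranspose_mul_eq_frobSq]
  simp only [Matrix.trace, Matrix.diag_apply, envState, Matrix.mul_apply,
    Matrix.conjTranspose_apply, Fintype.sum_prod_type, Complex.star_def]
  refine Finset.sum_congr rfl fun i _ => ?_
  rw [Finset.sum_comm]
  exact Finset.sum_congr rfl fun i _ => Finset.sum_congr rfl fun i _ => mul_comm _ _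

lemma posSemidef_envState (Z : Matrix (c × e) n ℂ) : (envState Z).PosSemidef := by
  have h : envState Z = (Matrix.of fun (p : n × e) k => Z (k, p.2) p.1) *
      (Matrix.of fun (p : n × e) k => Z (k, p.2) p.1)ᴴ := by
    ext p q
    simp [envState, Matrix.mul_apply]
  rw [h]
  exact Matrix.posSemidef_self_mul_conjTranspose _

end Amplitudes

/-! ### Concentration of the Gram matrix of a random encoder -/

section RandomEncoder

variable {a n : Type*} [Fintype a] [DecidableEq a] [Fintype n] [DecidableEq n]

/-- Equal phases contribute exactly ‖B‖² times the identity to the Gram matrix; the rest is a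
combination of centred products. -/
lemma gram_phaseMat_sub (B : Matrix a a ℂ) (σ : a × n → ZMod 3) (j j' : n) :
    ((B * phaseMat σ)ᴴ * (B * phaseMat σ) - ((frobSq B : ℝ) : ℂ) • (1 : Matrix n n ℂ)) j j' =
      ∑ i : a × a, phaseDev σ ((i.2, j'), (i.1, j)) * (Bᴴ * B) i.1 i.2 := by
  rw [Matrix.conjTranspose_mul, Matrix.mul_assoc, ← Matrix.mul_assoc Bᴴ,
    ← trace_conjTranspose_mul_eq_frobSq]
  set q := Bᴴ * B
  simp only [Matrix.sub_apply, Matrix.mul_apply, Matrix.smul_apply, Matrix.one_apply,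
    Matrix.conjTranspose_apply, phaseMat, phaseDev, Fintype.sum_prod_type, sub_mul,
    Finset.sum_sub_distrib, smul_eq_mul, Matrix.trace, Matrix.diag_apply, Prod.mk.injEq]
  congr 1
  · refine Finset.sum_congr rfl fun y _ => ?_
    rw [Finset.mul_sum]
    refine Finset.sum_congr rfl fun y' _ => ?_
    simp only [Complex.star_def]
    ring
  · by_cases h : j' = j
    · subst h; simp
    · simp [h, Ne.symm h]

/-- Random phases make the columns of an encoder nearly orthonormal. -/
lemma expect_frobSq_gram_sub_le (B : Matrix a a ℂ) :
    𝔼 σ : a × n → ZMod 3, frobSq ((B * phaseMat σ)ᴴ * (B * phaseMat σ) -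
      ((frobSq B : ℝ) : ℂ) • (1 : Matrix n n ℂ)) ≤
      (Fintype.card n : ℝ) ^ 2 * frobSq (Bᴴ * B) := by
  have h1 : ∀ j j' : n, 𝔼 σ : a × n → ZMod 3, ‖((B * phaseMat σ)ᴴ * (B * phaseMat σ) -
      ((frobSq B : ℝ) : ℂ) • (1 : Matrix n n ℂ)) j j'‖ ^ 2 ≤ frobSq (Bᴴ * B) := by
    intro j j'
    simp only [gram_phaseMat_sub]
    refine (expect_norm_sq_phaseDev_le (p := fun i : a × a => ((i.2, j'), (i.1, j))) ?_ _).trans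
      (le_of_eq ?_)
    · rintro ⟨x, y⟩ ⟨x', y'⟩ h
      simp only [Prod.mk.injEq, and_true] at h
      simp [h]
    · rw [Fintype.sum_prod_type]; rfl
  have h2 : 𝔼 σ : a × n → ZMod 3, frobSq ((B * phaseMat σ)ᴴ * (B * phaseMat σ) -
      ((frobSq B : ℝ) : ℂ) • (1 : Matrix n n ℂ)) = ∑ j, ∑ j', 𝔼 σ : a × n → ZMod 3,
      ‖((B * phaseMat σ)ᴴ * (B * phaseMat σ) -
      ((frobSq B : ℝ) : ℂ) • (1 : Matrix n n ℂ)) j j'‖ ^ 2 := by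
    simp only [← Finset.expect_sum_comm]; rfl
  rw [h2]
  refine (Finset.sum_le_sum fun j _ => Finset.sum_le_sum fun j' _ => h1 j j').trans (le_of_eq ?_)
  simp only [Finset.sum_const, Finset.card_univ, nsmul_eq_mul]
  ring

/-- The random encoders are close to isometries. -/
lemma exists_isometry_family [Nonempty n] {B : Matrix a a ℂ} {h : ℝ} (hB : 0 < frobSq B)
    (hcard : Fintype.card n ≤ Fintype.card a) (hh : 0 ≤ h)
    (hBh : Fintype.card n * frobSq (Bᴴ * B) ≤ h ^ 2 * frobSq B ^ 2) :
    ∃ W : (a × n → ZMod 3) → Matrix a n ℂ, (∀ σ, (W σ)ᴴ * W σ = 1) ∧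
      𝔼 σ, (1 + frob (((√(Fintype.card n : ℝ) : ℝ) : ℂ)⁻¹ • W σ -
        ((√(frobSq B * Fintype.card n) : ℝ) : ℂ)⁻¹ • (B * phaseMat σ))) ^ 2 ≤ (1 + h) ^ 2 := by
  have hn : (0 : ℝ) < Fintype.card n := by exact_mod_cast Fintype.card_pos
  choose W hW hWc using fun σ : a × n → ZMod 3 =>
    exists_isometry_close hcard (B * phaseMat σ) hB
  refine ⟨W, hW, ?_⟩
  set u : (a × n → ZMod 3) → ℝ := fun σ => frob (((√(Fintype.card n : ℝ) : ℝ) : ℂ)⁻¹ • W σ -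
    ((√(frobSq B * Fintype.card n) : ℝ) : ℂ)⁻¹ • (B * phaseMat σ)) with hu
  have hu2 : ∀ σ, u σ ^ 2 ≤ (Fintype.card n : ℝ)⁻¹ * (frobSq ((B * phaseMat σ)ᴴ * (B * phaseMat σ) -
      ((frobSq B : ℝ) : ℂ) • (1 : Matrix n n ℂ)) / frobSq B ^ 2) := by
    intro σ
    have e1 : ((√(Fintype.card n : ℝ) : ℝ) : ℂ)⁻¹ • W σ -
        ((√(frobSq B * Fintype.card n) : ℝ) : ℂ)⁻¹ • (B * phaseMat σ) =
        (-((√(Fintype.card n : ℝ) : ℝ) : ℂ)⁻¹) •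
          (((√(frobSq B) : ℝ) : ℂ)⁻¹ • (B * phaseMat σ) - W σ) := by
      rw [smul_sub, smul_smul, Real.sqrt_mul (frobSq_nonneg B), Complex.ofReal_mul, mul_inv,
        neg_mul, mul_comm, neg_smul, neg_smul]
      abel
    rw [hu]
    simp only
    rw [sq_frob, e1, frobSq_smul, norm_neg, norm_inv, Complex.norm_real, Real.norm_eq_abs,
      abs_of_nonneg (Real.sqrt_nonneg _), inv_pow, Real.sq_sqrt hn.le]
    exact mul_le_mul_of_nonneg_left (hWc σ) (by positivity)
  -- The squared Gram deviation has mean at most n²‖BᴴB‖² and is divided by n‖B‖⁴, which `hBh`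
  -- compares with h².
  have hE2 : 𝔼 σ, u σ ^ 2 ≤ h ^ 2 := by
    refine (Finset.expect_le_expect fun σ _ => hu2 σ).trans ?_
    rw [← Finset.mul_expect, ← Finset.expect_div]
    have h3 := expect_frobSq_gram_sub_le (n := n) B
    rw [inv_mul_le_iff₀ hn, div_le_iff₀ (by positivity)]
    refine h3.trans ?_
    rw [sq, mul_assoc, mul_assoc]
    exact mul_le_mul_of_nonneg_left hBh hn.le
  have hE1 : 𝔼 σ, u σ ≤ h := by
    refine (expect_le_sqrt_expect_sq u).trans ?_
    rw [Real.sqrt_le_left hh]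
    exact hE2
  have e2 : ∀ σ, (1 + u σ) ^ 2 = 1 + 2 * u σ + u σ ^ 2 := fun σ => by ring
  rw [Finset.expect_congr rfl fun σ _ => e2 σ]
  simp only [Finset.expect_add_distrib, ← Finset.mul_expect, Fintype.expect_const]
  nlinarith

end RandomEncoder

/-! ### Existence of good isometric encoders -/

section Encoders

variable {r s f g a b c e n m : Type*} [Fintype r] [DecidableEq r] [Fintype s] [DecidableEq s]
  [Fintype f] [DecidableEq f] [Fintype g] [DecidableEq g]
  [Fintype a] [DecidableEq a] [Fintype b] [DecidableEq b] [Fintype c] [DecidableEq c]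
  [Fintype e] [DecidableEq e] [Nonempty r] [Nonempty s] [Nonempty f] [Nonempty g]

lemma frob_normalised_isometry [Fintype n] [DecidableEq n] [Nonempty n] {W : Matrix a n ℂ}
    (hW : Wᴴ * W = 1) : frob (((√(Fintype.card n : ℝ) : ℝ) : ℂ)⁻¹ • W) = 1 := by
  have hn : (0 : ℝ) < Fintype.card n := by exact_mod_cast Fintype.card_pos
  have h1 : frobSq W = Fintype.card n := by
    have := trace_conjTranspose_mul_eq_frobSq W
    rw [hW, Matrix.trace_one] at this
    exact_mod_cast this.symm
  rw [frob_smul, frob, h1, norm_inv, Complex.norm_real, Real.norm_eq_abs,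
    abs_of_nonneg (Real.sqrt_nonneg _), inv_mul_cancel₀ (by positivity)]

/-- Existence of isometric encoders whose environment state is close to `ζ`. -/
theorem exists_encoders {U : Matrix (c × e) (a × b) ℂ} (hU : Uᴴ * U = 1)
    {A : Matrix a a ℂ} {B : Matrix b b ℂ} (hA : 0 < frobSq A) (hB : 0 < frobSq B) {h δ : ℝ}
    (hh : 0 ≤ h) (hcA : Fintype.card (r × f) ≤ Fintype.card a)
    (hcB : Fintype.card (s × g) ≤ Fintype.card b)
    (hAh : Fintype.card (r × f) * frobSq (Aᴴ * A) ≤ h ^ 2 * frobSq A ^ 2)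
    (hBh : Fintype.card (s × g) * frobSq (Bᴴ * B) ≤ h ^ 2 * frobSq B ^ 2)
    {ζ : Matrix ((r × s) × e) ((r × s) × e) ℂ} (hζ : ζ.IsHermitian)
    (hδ : 𝔼 σ : (a × (r × f) → ZMod 3) × (b × (s × g) → ZMod 3),
      traceNorm (lift (kerProd (kerRand σ.1) (kerRand σ.2)) (envState (U * (A ⊗ₖ B))) - ζ) ≤ δ) :
    ∃ (WA : Matrix a (r × f) ℂ) (WB : Matrix b (s × g) ℂ), WAᴴ * WA = 1 ∧ WBᴴ * WB = 1 ∧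
      ∀ Ψ, Ψ = outputAmp U (((√(Fintype.card (r × f) : ℝ) : ℝ) : ℂ)⁻¹ • WA)
        (((√(Fintype.card (s × g) : ℝ) : ℝ) : ℂ)⁻¹ • WB) →
      traceNorm (Ψ * Ψᴴ - (((frobSq A * frobSq B)⁻¹ : ℝ) : ℂ) • ζ) ≤
        (frobSq A * frobSq B)⁻¹ * δ + ((1 + h) ^ 4 - 1) := by
  obtain ⟨WA, hWA, hEA⟩ := exists_isometry_family (n := r × f) hA hcA hh hAh
  obtain ⟨WB, hWB, hEB⟩ := exists_isometry_family (n := s × g) hB hcB hh hBh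
  set κ := frobSq A * frobSq B with hκ
  have hκ0 : 0 < κ := mul_pos hA hB
  set PA := fun σ => ((√(Fintype.card (r × f) : ℝ) : ℝ) : ℂ)⁻¹ • WA σ with hPA
  set PB := fun σ => ((√(Fintype.card (s × g) : ℝ) : ℝ) : ℂ)⁻¹ • WB σ with hPB
  set VA := fun σ : a × (r × f) → ZMod 3 => ((√(frobSq A * Fintype.card (r × f)) : ℝ) : ℂ)⁻¹ • (A * phaseMat σ) with hVA
  set VB := fun σ : b × (s × g) → ZMod 3 => ((√(frobSq B * Fintype.card (s × g)) : ℝ) : ℂ)⁻¹ • (B * phaseMat σ) with hVB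
  -- The random encoders are normalised by the norms of A and B, whence the factor κ⁻¹.
  have hsig : ∀ σ : (a × (r × f) → ZMod 3) × (b × (s × g) → ZMod 3),
      outputAmp U (VA σ.1) (VB σ.2) * (outputAmp U (VA σ.1) (VB σ.2))ᴴ =
        ((κ⁻¹ : ℝ) : ℂ) • lift (kerProd (kerRand σ.1) (kerRand σ.2)) (envState (U * (A ⊗ₖ B))) := by
    intro σ
    rw [lift_kerRand_envState, hVA, hVB]
    simp only
    rw [outputAmp_smul, Matrix.conjTranspose_smul, Matrix.smul_mul, Matrix.mul_smul, smul_smul,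
      smul_smul]
    congr 1
    rw [Complex.star_def, ← Complex.ofReal_inv, ← Complex.ofReal_inv, ← Complex.ofReal_mul,
      Complex.conj_ofReal, ← Complex.ofReal_mul]
    have e1 : (√(frobSq A * Fintype.card (r × f)))⁻¹ * (√(frobSq B * Fintype.card (s × g)))⁻¹ *
        ((√(frobSq A * Fintype.card (r × f)))⁻¹ * (√(frobSq B * Fintype.card (s × g)))⁻¹) =
        (frobSq A * Fintype.card (r × f))⁻¹ * (frobSq B * Fintype.card (s × g))⁻¹ := by
      rw [mul_mul_mul_comm, ← mul_inv, ← mul_inv, Real.mul_self_sqrt (by positivity),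
        Real.mul_self_sqrt (by positivity)]
    rw [e1, hκ, Fintype.card_prod, Fintype.card_prod]
    push_cast
    simp only [mul_inv]
    ring
  -- The two seeds are independent, so the mean of the product of the encoder errors factorises.
  have hEtot : 𝔼 σ : (a × (r × f) → ZMod 3) × (b × (s × g) → ZMod 3),
      (κ⁻¹ * traceNorm (lift (kerProd (kerRand σ.1) (kerRand σ.2)) (envState (U * (A ⊗ₖ B))) - ζ) +
        ((1 + frob (PA σ.1 - VA σ.1)) ^ 2 * (1 + frob (PB σ.2 - VB σ.2)) ^ 2 - 1)) ≤
      κ⁻¹ * δ + ((1 + h) ^ 4 - 1) := by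
    rw [Finset.expect_add_distrib, ← Finset.mul_expect, Finset.expect_sub_distrib,
      Fintype.expect_const]
    refine add_le_add (mul_le_mul_of_nonneg_left hδ (by positivity)) (sub_le_sub_right ?_ _)
    rw [expect_prod]
    simp only [← Finset.mul_expect, ← Finset.expect_mul]
    calc _ ≤ (1 + h) ^ 2 * (1 + h) ^ 2 := by
          refine mul_le_mul hEA hEB (Finset.expect_nonneg fun _ _ => by positivity) (by positivity)
      _ = _ := by ring
  -- One seed has to serve the decoupling error and both encoder errors at once, so their sum is
  -- averaged.
  obtain ⟨σ, hσ⟩ := exists_le_expect fun σ : (a × (r × f) → ZMod 3) × (b × (s × g) → ZMod 3) =>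
    κ⁻¹ * traceNorm (lift (kerProd (kerRand σ.1) (kerRand σ.2)) (envState (U * (A ⊗ₖ B))) - ζ) +
      ((1 + frob (PA σ.1 - VA σ.1)) ^ 2 * (1 + frob (PB σ.2 - VB σ.2)) ^ 2 - 1)
  refine ⟨WA σ.1, WB σ.2, hWA _, hWB _, ?_⟩
  rintro Ψ rfl
  refine le_trans ?_ (hσ.trans hEtot)
  have hL : (lift (kerProd (kerRand σ.1) (kerRand σ.2)) (envState (U * (A ⊗ₖ B)))).IsHermitian :=
    (((isCP_kerRand σ.1).kerProd (isCP_kerRand σ.2)).posSemidef_lift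
      (posSemidef_envState _)).isHermitian
  have e3 : outputAmp U (PA σ.1) (PB σ.2) * (outputAmp U (PA σ.1) (PB σ.2))ᴴ -
      ((κ⁻¹ : ℝ) : ℂ) • ζ =
      ((κ⁻¹ : ℝ) : ℂ) • (lift (kerProd (kerRand σ.1) (kerRand σ.2))
        (envState (U * (A ⊗ₖ B))) - ζ) +
      (outputAmp U (PA σ.1) (PB σ.2) * (outputAmp U (PA σ.1) (PB σ.2))ᴴ -
        outputAmp U (VA σ.1) (VB σ.2) * (outputAmp U (VA σ.1) (VB σ.2))ᴴ) := by
    rw [hsig, smul_sub]; abel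
  have hsm : (((κ⁻¹ : ℝ) : ℂ) • (lift (kerProd (kerRand σ.1) (kerRand σ.2))
      (envState (U * (A ⊗ₖ B))) - ζ)).IsHermitian := by
    rw [Matrix.IsHermitian, Matrix.conjTranspose_smul, (hL.sub hζ).eq, Complex.star_def,
      Complex.conj_ofReal]
  refine (le_of_eq (congrArg traceNorm e3)).trans ((traceNorm_add_le hsm
    ((Matrix.isHermitian_mul_conjTranspose_self _).sub
      (Matrix.isHermitian_mul_conjTranspose_self _))).trans (add_le_add ?_ ?_))
  · exact traceNorm_smul_le (hL.sub hζ) (by positivity)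
  · exact traceNorm_outputAmp_sub_le hU (frob_normalised_isometry (hWA _))
      (frob_normalised_isometry (hWB _))

end Encoders

/-! ### Channels given by Kraus operators -/

section Kraus

variable {J ι κ : Type*} [Fintype J] [DecidableEq J] [Fintype ι] [DecidableEq ι]
  [Fintype κ] [DecidableEq κ]

/-- The superoperator with Kraus operators `A`. -/
def krausMap (A : J → Matrix κ ι ℂ) : Matrix ι ι ℂ →ₗ[ℂ] Matrix κ κ ℂ where
  toFun X := ∑ j, A j * X * (A j)ᴴ
  map_add' X Y := by simp [Matrix.mul_add, Matrix.add_mul, Finset.sum_add_distrib]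
  map_smul' z X := by simp [Finset.smul_sum]

lemma tensorId_krausMap (A : J → Matrix κ ι ℂ) {μ : Type*} [Fintype μ] [DecidableEq μ]
    (X : Matrix (ι × μ) (ι × μ) ℂ) :
    tensorId (krausMap A) X =
      ∑ j, (A j ⊗ₖ (1 : Matrix μ μ ℂ)) * X * (A j ⊗ₖ (1 : Matrix μ μ ℂ))ᴴ := by
  ext p q
  rw [Matrix.sum_apply]
  simp only [tensorId, krausMap, LinearMap.coe_mk, AddHom.coe_mk, Matrix.sum_apply]
  refine Finset.sum_congr rfl fun j _ => ?_
  rw [kronecker_one_conj_apply]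
  rw [Finset.sum_comm, Matrix.mul_apply]
  refine Finset.sum_congr rfl fun y' _ => ?_
  have h : (A j * Matrix.of fun i i' => X (i, p.2) (i', q.2)) p.1 y' =
    ∑ y, A j p.1 y * X (y, p.2) (y', q.2) := rfl
  refine (congrArg (· * _) h).trans ?_
  rw [Finset.sum_mul]
  refine Finset.sum_congr rfl fun y _ => ?_
  rw [Matrix.conjTranspose_apply, Complex.star_def]
  ring

lemma isChannel_krausMap {A : J → Matrix κ ι ℂ} (hA : ∑ j, (A j)ᴴ * A j = 1) :
    IsChannel (krausMap A) := by
  refine ⟨fun n X hX => ?_, fun X => ?_⟩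
  · rw [tensorId_krausMap]
    exact Matrix.posSemidef_sum _ fun j _ => hX.mul_mul_conjTranspose_same _
  · show (∑ j, A j * X * (A j)ᴴ).trace = _
    rw [Matrix.trace_sum]
    simp only [Matrix.trace_mul_cycle (A _) X]
    rw [← Matrix.trace_sum, ← Finset.sum_mul, hA, Matrix.one_mul]

/-- Completing a trace non-increasing family of Kraus operators. -/
lemma exists_kraus_completion [Nonempty κ] {A : J → Matrix κ ι ℂ}
    (hA : (1 - ∑ j, (A j)ᴴ * A j).PosSemidef) :
    ∃ B : J ⊕ ι → Matrix κ ι ℂ, (∀ j, B (Sum.inl j) = A j) ∧ ∑ j, (B j)ᴴ * B j = 1 := by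
  obtain ⟨L, hL⟩ := exists_eq_conjTranspose_mul_self hA
  obtain ⟨k₀⟩ := ‹Nonempty κ›
  -- The missing part LᴴL is sent to the fixed output vector k₀, with one Kraus operator for each
  -- row of L.
  refine ⟨Sum.elim A fun i => Matrix.of fun k x => if k = k₀ then L i x else 0, fun j => rfl, ?_⟩
  rw [Fintype.sum_sum_type]
  simp only [Sum.elim_inl, Sum.elim_inr]
  have h : ∑ i : ι, (Matrix.of fun k x => if k = k₀ then L i x else 0 : Matrix κ ι ℂ)ᴴ *
      (Matrix.of fun k x => if k = k₀ then L i x else 0 : Matrix κ ι ℂ) = Lᴴ * L := by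
    ext x y
    rw [Matrix.sum_apply]
    simp only [Matrix.mul_apply, Matrix.conjTranspose_apply, Matrix.of_apply]
    refine Finset.sum_congr rfl fun i _ => ?_
    rw [Finset.sum_eq_single k₀ (fun k _ hk => by simp [hk]) (by simp)]
    simp
  rw [h, ← hL]
  abel

end Kraus

/-! ### Distance from a pure state without a square root loss -/

section TraceNormEstimate

variable {n J : Type*} [Fintype n] [DecidableEq n] [Fintype J] [DecidableEq J]

lemma posSemidef_one_sub_of_idempotent {P : Matrix n n ℂ} (hP : P.IsHermitian) (h : P * P = P) :
    (1 - P).PosSemidef := by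
  have e : 1 - P = (1 - P)ᴴ * (1 - P) := by
    rw [Matrix.conjTranspose_sub, Matrix.conjTranspose_one, hP.eq, Matrix.mul_sub, Matrix.sub_mul,
      Matrix.sub_mul, h]
    simp
  rw [e]
  exact Matrix.posSemidef_conjTranspose_mul_self _

/-- The distance of a state from a pure state, when one of its pure components nearly is that pure
state. -/
lemma traceNorm_sub_pure_le {W : Matrix n J ℂ} (hW : frobSq W = 1) {T : Matrix J Unit ℂ}
    (hT : Tᴴ * T = 1) {Φ u : Matrix n Unit ℂ} (hΦ : frobSq Φ = 1) {c : ℝ} (hc : 0 ≤ c)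
    (hc1 : c ≤ 1) (hv : W * T = (c : ℂ) • Φ + u) :
    traceNorm (W * Wᴴ - Φ * Φᴴ) ≤
      2 * (1 - c ^ 2) + 2 * c * frob u - 2 * c * (Φᴴ * u).trace.re := by
  set v := W * T with hvdef
  -- T is a unit vector, so v = W T is one pure component of the mixture and what is left stays
  -- positive.
  have hrest : (W * Wᴴ - v * vᴴ).PosSemidef := by
    have e : W * Wᴴ - v * vᴴ = W * (1 - T * Tᴴ) * Wᴴ := by
      rw [hvdef, Matrix.conjTranspose_mul, Matrix.mul_sub, Matrix.sub_mul, Matrix.mul_one]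
      simp only [Matrix.mul_assoc]
    rw [e]
    refine Matrix.PosSemidef.mul_mul_conjTranspose_same (posSemidef_one_sub_of_idempotent
      (Matrix.isHermitian_mul_conjTranspose_self T) ?_) W
    rw [Matrix.mul_assoc, ← Matrix.mul_assoc Tᴴ, hT, Matrix.one_mul]
  have hcross : (Φ * uᴴ + u * Φᴴ).IsHermitian := by
    rw [Matrix.IsHermitian, Matrix.conjTranspose_add, Matrix.conjTranspose_mul,
      Matrix.conjTranspose_mul, Matrix.conjTranspose_conjTranspose,
      Matrix.conjTranspose_conjTranspose, add_comm]
  have hnv : frobSq v = c ^ 2 + 2 * c * (Φᴴ * u).trace.re + frobSq u := by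
    have h1 := trace_conjTranspose_mul_eq_frobSq v
    have h2 : (uᴴ * Φ).trace = conj (Φᴴ * u).trace := by
      rw [← Complex.star_def, ← Matrix.trace_conjTranspose, Matrix.conjTranspose_mul,
        Matrix.conjTranspose_conjTranspose]
    have h3 : (vᴴ * v).trace = (c : ℂ) ^ 2 * (Φᴴ * Φ).trace + c * (Φᴴ * u).trace +
        c * (uᴴ * Φ).trace + (uᴴ * u).trace := by
      rw [hv, Matrix.conjTranspose_add, Matrix.conjTranspose_smul, Complex.star_def,
        Complex.conj_ofReal]
      simp only [Matrix.add_mul, Matrix.mul_add, Matrix.smul_mul, Matrix.mul_smul, Matrix.trace_add,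
        Matrix.trace_smul, smul_eq_mul]
      ring
    rw [h1, trace_conjTranspose_mul_eq_frobSq, trace_conjTranspose_mul_eq_frobSq, hΦ, h2] at h3
    have h4 := congrArg Complex.re h3
    simp only [Complex.add_re, Complex.ofReal_re, Complex.mul_re, Complex.ofReal_im,
      Complex.conj_re, zero_mul, sub_zero, ← Complex.ofReal_pow, Complex.ofReal_one,
      mul_one] at h4
    linarith
  -- The trace of u uᴴ cancels against the −‖u‖² contained in the trace of W Wᴴ − v vᴴ. Only terms
  -- linear in u survive: the cross term and the real part of Φᴴu.
  have hdec : W * Wᴴ - Φ * Φᴴ = ((W * Wᴴ - v * vᴴ) + u * uᴴ - ((1 - c ^ 2 : ℝ) : ℂ) • (Φ * Φᴴ)) +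
      (c : ℂ) • (Φ * uᴴ + u * Φᴴ) := by
    have : v * vᴴ = ((c ^ 2 : ℝ) : ℂ) • (Φ * Φᴴ) + (c : ℂ) • (Φ * uᴴ + u * Φᴴ) + u * uᴴ := by
      rw [hv, Matrix.conjTranspose_add, Matrix.conjTranspose_smul, Complex.star_def,
        Complex.conj_ofReal]
      simp only [Matrix.add_mul, Matrix.mul_add, Matrix.smul_mul, Matrix.mul_smul, smul_add,
        smul_smul]
      push_cast
      rw [sq]
      abel
    rw [this]
    push_cast
    rw [sub_smul, one_smul]
    abel
  have hΦΦ : (Φ * Φᴴ).PosSemidef := Matrix.posSemidef_self_mul_conjTranspose Φ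
  have hcc : (0 : ℝ) ≤ 1 - c ^ 2 := by nlinarith
  have hN : (((1 - c ^ 2 : ℝ) : ℂ) • (Φ * Φᴴ)).PosSemidef :=
    hΦΦ.smul (by exact_mod_cast hcc)
  have hP := hrest.add (Matrix.posSemidef_self_mul_conjTranspose u)
  rw [hdec]
  refine (traceNorm_add_le (hP.isHermitian.sub hN.isHermitian) ?_).trans
    ((add_le_add (traceNorm_sub_le hP hN) ((traceNorm_smul_le hcross hc).trans
      (mul_le_mul_of_nonneg_left (traceNorm_cross_le Φ u) hc))).trans (le_of_eq ?_))
  · rw [Matrix.IsHermitian, Matrix.conjTranspose_smul, hcross.eq, Complex.star_def,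
      Complex.conj_ofReal]
  · rw [Matrix.trace_add, Matrix.trace_sub, Matrix.trace_smul, trace_mul_conjTranspose_eq_frobSq,
      trace_mul_conjTranspose_eq_frobSq, trace_mul_conjTranspose_eq_frobSq,
      trace_mul_conjTranspose_eq_frobSq, hW, hΦ, hnv,
      smul_eq_mul, ← Complex.ofReal_mul, frob, hΦ, Real.sqrt_one]
    simp only [Complex.add_re, Complex.sub_re, Complex.ofReal_re]
    ring

end TraceNormEstimate

lemma sum_sum_comm_sum_sum {α β γ δ : Type*} [Fintype α] [Fintype β] [Fintype γ] [Fintype δ]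
    (F : α → β → γ → δ → ℂ) :
    ∑ x, ∑ y, ∑ z, ∑ w, F x y z w = ∑ z, ∑ w, ∑ x, ∑ y, F x y z w := by
  have : ∀ x, ∑ y, ∑ z, ∑ w, F x y z w = ∑ z, ∑ w, ∑ y, F x y z w := by
    intro x
    rw [Finset.sum_comm]
    exact Finset.sum_congr rfl fun z _ => Finset.sum_comm
  simp only [this]
  rw [Finset.sum_comm]
  exact Finset.sum_congr rfl fun z _ => Finset.sum_comm

/-! ### The Uhlmann decoder -/

section Decoder

variable {r e k m : Type*} [Fintype r] [DecidableEq r] [Fintype e] [DecidableEq e]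
  [Fintype k] [DecidableEq k] [Fintype m] [DecidableEq m]

/-- The joint amplitudes of decoded register and reference, with a column for each Kraus operator
and environment basis vector. -/
def decodedAmp {J : Type*} (Ψ : Matrix (m × e) k ℂ) (A : J → Matrix m k ℂ) :
    Matrix (m × m) (J × e) ℂ :=
  fun p j => (Ψ * (A j.1)ᵀ) (p.2, j.2) p.1

lemma frobSq_decodedAmp {J : Type*} [Fintype J] (Ψ : Matrix (m × e) k ℂ) {A : J → Matrix m k ℂ}
    (hA : ∑ j, (A j)ᴴ * A j = 1) : frobSq (decodedAmp Ψ A) = frobSq Ψ := by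
  have h1 : frobSq (decodedAmp Ψ A) = ∑ j, frobSq (Ψ * (A j)ᵀ) := by
    simp only [frobSq, decodedAmp, Fintype.sum_prod_type]
    calc _ = ∑ x, ∑ y, ∑ j, ∑ z, ‖(Ψ * (A j)ᵀ) (y, z) x‖ ^ 2 := rfl
      _ = ∑ j, ∑ x, ∑ y, ∑ z, ‖(Ψ * (A j)ᵀ) (y, z) x‖ ^ 2 := by
          rw [Finset.sum_congr rfl fun x _ => Finset.sum_comm, Finset.sum_comm]
      _ = _ := by
          refine Finset.sum_congr rfl fun j _ => ?_
          rw [Finset.sum_comm]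
          refine Finset.sum_congr rfl fun y _ => ?_
          rw [Finset.sum_comm]
  have h2 : ((∑ j, frobSq (Ψ * (A j)ᵀ) : ℝ) : ℂ) = (frobSq Ψ : ℂ) := by
    rw [Complex.ofReal_sum]
    simp only [← trace_mul_conjTranspose_eq_frobSq]
    rw [← Matrix.trace_sum]
    have : ∀ j, Ψ * (A j)ᵀ * (Ψ * (A j)ᵀ)ᴴ = Ψ * ((A j)ᴴ * A j)ᵀ * Ψᴴ := by
      intro j
      rw [Matrix.conjTranspose_mul, Matrix.transpose_mul]
      have : ((A j)ᵀ)ᴴ = ((A j)ᴴ)ᵀ := rfl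
      rw [this]
      simp only [Matrix.mul_assoc]
    simp only [this]
    rw [← Matrix.sum_mul, ← Matrix.mul_sum, ← Matrix.transpose_sum, hA, Matrix.transpose_one,
      Matrix.mul_one]
  rw [h1]
  exact_mod_cast h2

/-- The Uhlmann-type decoder followed by the adjoint of the isometry `w`. -/
lemma exists_decoder [Nonempty m] (Ψ : Matrix (r × e) k ℂ) {θ S : Matrix e e ℂ}
    (hS : S.IsHermitian) (hSS : S * S = θ) (hθ : θ.trace = 1) :
    ∃ R : Matrix (r × e) (r × e) ℂ, R.PosSemidef ∧ R * R = Ψ * Ψᴴ ∧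
      ∀ (w : Matrix r m ℂ), wᴴ * w = 1 → ∀ z : ℂ,
      ∃ (A : e ⊕ k → Matrix m k ℂ) (T : Matrix ((e ⊕ k) × e) Unit ℂ),
        ∑ j, (A j)ᴴ * A j = 1 ∧ Tᴴ * T = 1 ∧
        ∀ p : m × m, (decodedAmp (z • ((wᵀ ⊗ₖ (1 : Matrix e e ℂ)) * Ψ)) A * T) p () =
          z * (wᴴ * (traceSnd (R * ((1 : Matrix r r ℂ) ⊗ₖ S)))ᵀ * w) p.1 p.2 := by
  have hσ : (Ψ * Ψᴴ).PosSemidef := Matrix.posSemidef_self_mul_conjTranspose Ψ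
  obtain ⟨R, H, hR, hH, hRR, hσH, hHH⟩ := exists_sqrt_pinv hσ
  refine ⟨R, hR, hRR, fun w hw z => ?_⟩
  -- The partial isometry of the polar decomposition of Ψ, carrying the given purification to the
  -- canonical one R = √(ΨΨᴴ). It depends on Ψ alone, so w may be chosen with knowledge of the
  -- overlap operator.
  set Z := Ψᴴ * H with hZ
  have hZR : Ψ * Z = R := by rw [hZ, ← Matrix.mul_assoc, hσH]
  have hZZ : (1 - Z * Zᴴ).PosSemidef := by
    refine posSemidef_one_sub_of_idempotent (Matrix.isHermitian_mul_conjTranspose_self Z) ?_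
    have e1 : Z * Zᴴ = Ψᴴ * (H * H) * Ψ := by
      rw [hZ, Matrix.conjTranspose_mul, Matrix.conjTranspose_conjTranspose, hH.eq]
      simp only [Matrix.mul_assoc]
    rw [e1]
    calc _ = Ψᴴ * (H * H * (Ψ * Ψᴴ) * (H * H)) * Ψ := by simp only [Matrix.mul_assoc]
      _ = _ := by rw [hHH]
  clear_value Z
  set w1 := w ⊗ₖ (1 : Matrix e e ℂ) with hw1
  have hw1i : w1ᴴ * w1 = 1 := by
    rw [hw1, Matrix.conjTranspose_kronecker, ← Matrix.mul_kronecker_mul, hw,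
      Matrix.conjTranspose_one, Matrix.mul_one, Matrix.one_kronecker_one]
  have hww : (1 - w1 * w1ᴴ).PosSemidef := by
    refine posSemidef_one_sub_of_idempotent (Matrix.isHermitian_mul_conjTranspose_self w1) ?_
    rw [Matrix.mul_assoc, ← Matrix.mul_assoc w1ᴴ, hw1i, Matrix.one_mul]
  -- The receiver maps to a copy of r × e and compresses the first factor by w. The copy of e is not
  -- output; its basis indexes the Kraus operators.
  set G : Matrix (m × e) k ℂ := w1ᴴ * Zᵀ with hG
  let A₀ : e → Matrix m k ℂ := fun e' => Matrix.of fun i x => G (i, e') x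
  have hA₀ : (1 - ∑ j, (A₀ j)ᴴ * A₀ j).PosSemidef := by
    have e1 : ∑ j, (A₀ j)ᴴ * A₀ j = Gᴴ * G := by
      ext x y
      rw [Matrix.sum_apply]
      simp only [Matrix.mul_apply, Matrix.conjTranspose_apply, A₀, Matrix.of_apply,
        Fintype.sum_prod_type]
      rw [Finset.sum_comm]
    have e2 : 1 - Gᴴ * G = (1 - Z * Zᴴ)ᵀ + (Zᵀ)ᴴ * (1 - w1 * w1ᴴ) * Zᵀ := by
      have : (Zᵀ)ᴴ = (Zᴴ)ᵀ := rfl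
      rw [hG, Matrix.conjTranspose_mul, Matrix.conjTranspose_conjTranspose, Matrix.transpose_sub,
        Matrix.transpose_mul, Matrix.transpose_one, Matrix.mul_sub, Matrix.sub_mul, Matrix.mul_one,
        this]
      simp only [Matrix.mul_assoc]
      abel
    rw [e1, e2]
    exact hZZ.transpose.add (hww.conjTranspose_mul_mul_same _)
  obtain ⟨A, hA, hA1⟩ := exists_kraus_completion hA₀
  -- T is the purification of θ on the environment and its copy, with the entries of S = √θ as
  -- amplitudes. The completing Kraus operators do not enter.
  refine ⟨A, Matrix.of fun j _ => Sum.elim (fun e' => S e' j.2) (fun _ => 0) j.1, hA1, ?_, ?_⟩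
  · ext
    have htr : ∑ x, ∑ y, conj (S x y) * S x y = 1 := by
      have : (S * Sᴴ).trace = 1 := by rw [hS.eq, hSS, hθ]
      rw [← this]
      simp only [Matrix.trace, Matrix.diag_apply, Matrix.mul_apply, Matrix.conjTranspose_apply,
        Complex.star_def]
      exact Finset.sum_congr rfl fun _ _ => Finset.sum_congr rfl fun _ _ => mul_comm _ _
    simp only [Matrix.mul_apply, Matrix.conjTranspose_apply, Matrix.of_apply,
      Fintype.sum_prod_type, Fintype.sum_sum_type, Sum.elim_inl, Sum.elim_inr]
    simpa using htr
  · intro p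
    have hM : ∀ e' e'' : e, decodedAmp (z • ((wᵀ ⊗ₖ (1 : Matrix e e ℂ)) * Ψ)) A p
        (Sum.inl e', e'') = z * ∑ i, ∑ j, w i p.2 * conj (w j p.1) * R (i, e'') (j, e') := by
      intro e' e''
      have e1 : A (Sum.inl e') = A₀ e' := hA e'
      have e2 : ∀ x : m × e, ((wᵀ ⊗ₖ (1 : Matrix e e ℂ)) * Ψ * Gᵀ) x (p.1, e') =
          ∑ i, ∑ j, w i x.1 * conj (w j p.1) * R (i, x.2) (j, e') := by
        intro x
        have hGt : Gᵀ = Z * (w1ᴴ)ᵀ := by rw [hG, Matrix.transpose_mul, Matrix.transpose_transpose]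
        rw [hGt, Matrix.mul_assoc, ← Matrix.mul_assoc Ψ, hZR]
        simp only [Matrix.mul_apply, Matrix.transpose_apply, Matrix.conjTranspose_apply, hw1,
          Matrix.kroneckerMap_apply, Fintype.sum_prod_type, Matrix.one_apply, mul_ite, mul_one,
          mul_zero, ite_mul, zero_mul, Finset.sum_ite_eq, Finset.sum_ite_eq', Finset.mem_univ,
          if_true, Complex.star_def, apply_ite conj, map_zero]
        refine Finset.sum_congr rfl fun i _ => ?_
        rw [Finset.mul_sum]
        refine Finset.sum_congr rfl fun j _ => ?_
        ring
      have e3 := e2 (p.2, e'')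
      simp only at e3
      rw [← e3, decodedAmp, e1, Matrix.smul_mul, Matrix.smul_apply, smul_eq_mul]
      congr 1
    have e4 : ∀ i j, traceSnd (R * ((1 : Matrix r r ℂ) ⊗ₖ S)) i j =
        ∑ e', ∑ e'', R (i, e'') (j, e') * S e' e'' := by
      intro i j
      simp only [traceSnd, Matrix.mul_apply, Matrix.kroneckerMap_apply, Fintype.sum_prod_type,
        Matrix.one_apply, ite_mul, one_mul, zero_mul, mul_ite, mul_zero]
      conv_rhs => rw [Finset.sum_comm]
      refine Finset.sum_congr rfl fun e'' _ => ?_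
      rw [Finset.sum_eq_single j (fun i' _ hi => by simp [hi]) (by simp)]
      simp
    rw [Matrix.mul_apply]
    simp only [Fintype.sum_prod_type, Fintype.sum_sum_type, Matrix.of_apply, Sum.elim_inl,
      Sum.elim_inr, mul_zero, Finset.sum_const_zero, add_zero, hM]
    rw [Matrix.mul_apply]
    simp only [Matrix.mul_apply, Matrix.conjTranspose_apply, Matrix.transpose_apply, e4,
      Complex.star_def, Finset.mul_sum, Finset.sum_mul]
    rw [sum_sum_comm_sum_sum]
    refine Finset.sum_congr rfl fun i _ => Finset.sum_congr rfl fun j _ =>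
      Finset.sum_congr rfl fun e' _ => Finset.sum_congr rfl fun e'' _ => ?_
    ring

end Decoder

/-! ### The overlap operator of actual and ideal purification -/

section Overlap

variable {r e : Type*} [Fintype r] [DecidableEq r] [Fintype e] [DecidableEq e]

lemma traceSnd_mul_one_kronecker (Y : Matrix (r × e) (r × e) ℂ) (S : Matrix e e ℂ) :
    traceSnd (Y * ((1 : Matrix r r ℂ) ⊗ₖ S)) = traceSnd (((1 : Matrix r r ℂ) ⊗ₖ S) * Y) := by
  ext i j
  simp only [traceSnd, Matrix.mul_apply, Matrix.kroneckerMap_apply, Fintype.sum_prod_type,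
    Matrix.one_apply, ite_mul, one_mul, zero_mul, mul_ite, mul_zero]
  have h1 : ∀ x, ∑ i', ∑ x', (if i' = j then Y (i, x) (i', x') * S x' x else 0) =
      ∑ x', Y (i, x) (j, x') * S x' x := fun x => by
    rw [Finset.sum_eq_single j (fun i' _ hi => by simp [hi]) (by simp)]; simp
  have h2 : ∀ x, ∑ i', ∑ x', (if i = i' then S x x' * Y (i', x') (j, x) else 0) =
      ∑ x', S x x' * Y (i, x') (j, x) := fun x => by
    rw [Finset.sum_eq_single i (fun i' _ hi => by simp [Ne.symm hi]) (by simp)]; simp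
  simp only [h1, h2]
  rw [Finset.sum_comm]
  exact Finset.sum_congr rfl fun _ _ => Finset.sum_congr rfl fun _ _ => mul_comm _ _

lemma posSemidef_traceSnd {Y : Matrix (r × e) (r × e) ℂ} (hY : Y.PosSemidef) :
    (traceSnd Y).PosSemidef := by
  have h : traceSnd Y = ∑ x, Y.submatrix (fun i => (i, x)) (fun i => (i, x)) := by
    ext i j; simp [traceSnd, Matrix.sum_apply]
  rw [h]
  exact Matrix.posSemidef_sum _ fun x _ => hY.submatrix _

lemma trace_traceSnd (Y : Matrix (r × e) (r × e) ℂ) : (traceSnd Y).trace = Y.trace := by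
  simp [Matrix.trace, traceSnd, Fintype.sum_prod_type]

lemma ofReal_re_trace {K : Matrix r r ℂ} (hK : K.IsHermitian) :
    ((K.trace.re : ℝ) : ℂ) = K.trace := by
  have h : conj K.trace = K.trace := by
    rw [← Complex.star_def, ← Matrix.trace_conjTranspose, hK.eq]
  exact Complex.conj_eq_iff_re.1 h

/-- The partial trace is cyclic for operators on the traced factor; splitting S = s² puts one s on
each side of R. -/
lemma posSemidef_overlap {R : Matrix (r × e) (r × e) ℂ} (hR : R.PosSemidef) {S : Matrix e e ℂ}
    (hS : S.PosSemidef) : (traceSnd (R * ((1 : Matrix r r ℂ) ⊗ₖ S))).PosSemidef := by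
  obtain ⟨s, -, hs, -, hss, -, -⟩ := exists_sqrt_pinv hS
  have h1 : (1 : Matrix r r ℂ) ⊗ₖ S = ((1 : Matrix r r ℂ) ⊗ₖ s) * ((1 : Matrix r r ℂ) ⊗ₖ s) := by
    rw [← Matrix.mul_kronecker_mul, hss, Matrix.one_mul]
  rw [h1, ← Matrix.mul_assoc, traceSnd_mul_one_kronecker, ← Matrix.mul_assoc]
  refine posSemidef_traceSnd ?_
  have := hR.mul_mul_conjTranspose_same ((1 : Matrix r r ℂ) ⊗ₖ s)
  rwa [(isHermitian_one_kronecker hs.isHermitian).eq] at this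

lemma frobSq_of_isHermitian {K : Matrix r r ℂ} (hK : K.IsHermitian) :
    frobSq K = (K * K).trace.re := by
  have := trace_mul_conjTranspose_eq_frobSq K
  rw [hK.eq] at this
  rw [this, Complex.ofReal_re]

/-- The operator overlap of two purifications whose reference marginals are maximally mixed is
subidempotent in trace. -/
lemma frobSq_overlap_le [Nonempty r] {R : Matrix (r × e) (r × e) ℂ} (hR : R.PosSemidef)
    (hRm : traceSnd (R * R) = (Fintype.card r : ℂ)⁻¹ • 1) {S : Matrix e e ℂ} (hS : S.PosSemidef)
    (hS1 : (S * S).trace = 1) {K : Matrix r r ℂ}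
    (hK : K = ((√(Fintype.card r : ℝ) : ℝ) : ℂ) • traceSnd (R * ((1 : Matrix r r ℂ) ⊗ₖ S))) :
    frobSq K ≤ K.trace.re := by
  have hd : (0 : ℝ) < Fintype.card r := by exact_mod_cast Fintype.card_pos
  have hKp : K.PosSemidef := by
    rw [hK]
    exact (posSemidef_overlap hR hS).smul (by exact_mod_cast Real.sqrt_nonneg _)
  obtain ⟨X, -, hX, -, hXX, -, -⟩ := exists_sqrt_pinv hKp
  have htr0 : 0 ≤ K.trace.re := PosSemidef.re_trace_nonneg hKp
  have hfX : frobSq X = K.trace.re := by rw [frobSq_of_isHermitian hX.isHermitian, hXX]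
  have hfS : frobSq S = 1 := by rw [frobSq_of_isHermitian hS.isHermitian, hS1, Complex.one_re]
  have hfXS : frobSq (X ⊗ₖ S) = K.trace.re := by rw [frobSq_kronecker, hfX, hfS, mul_one]
  have hXS : (X ⊗ₖ S)ᴴ = X ⊗ₖ S := by
    rw [Matrix.conjTranspose_kronecker, hX.isHermitian.eq, hS.isHermitian.eq]
  have hX1 : (X ⊗ₖ (1 : Matrix e e ℂ))ᴴ = X ⊗ₖ (1 : Matrix e e ℂ) := by
    rw [Matrix.conjTranspose_kronecker, hX.isHermitian.eq, Matrix.conjTranspose_one]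
  have hfXR : frobSq ((X ⊗ₖ (1 : Matrix e e ℂ)) * R) = (Fintype.card r : ℝ)⁻¹ * K.trace.re := by
    have h1 := trace_mul_conjTranspose_eq_frobSq ((X ⊗ₖ (1 : Matrix e e ℂ)) * R)
    have h2 : ((X ⊗ₖ (1 : Matrix e e ℂ)) * R * ((X ⊗ₖ (1 : Matrix e e ℂ)) * R)ᴴ).trace =
        (Fintype.card r : ℂ)⁻¹ * K.trace := by
      rw [Matrix.conjTranspose_mul, hR.isHermitian.eq, hX1, Matrix.mul_assoc,
        Matrix.trace_mul_comm]
      have : R * (R * (X ⊗ₖ (1 : Matrix e e ℂ))) * (X ⊗ₖ (1 : Matrix e e ℂ)) =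
          (R * R) * (K ⊗ₖ (1 : Matrix e e ℂ)) := by
        rw [← hXX, ← Matrix.mul_one (1 : Matrix e e ℂ), Matrix.mul_kronecker_mul]
        simp only [Matrix.mul_assoc, Matrix.mul_one]
      rw [this, trace_mul_kronecker_one, hRm, Matrix.smul_mul, Matrix.one_mul, Matrix.trace_smul,
        smul_eq_mul]
    rw [h2, ← ofReal_re_trace hKp.isHermitian] at h1
    rw [← Complex.ofReal_natCast, ← Complex.ofReal_inv, ← Complex.ofReal_mul] at h1
    exact (Complex.ofReal_inj.1 h1).symm
  -- With X = √K, Tr K² is √d times the Hilbert–Schmidt product of (X ⊗ 1)R and X ⊗ S. Their squared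
  -- norms are Tr K / d, because the reference marginal of R² is maximally mixed, and Tr K.
  have hkey : (K * K).trace = ((√(Fintype.card r : ℝ) : ℝ) : ℂ) *
      (((X ⊗ₖ (1 : Matrix e e ℂ)) * R) * (X ⊗ₖ S)ᴴ).trace := by
    rw [hXS]
    nth_rw 1 [hK]
    rw [Matrix.smul_mul, Matrix.trace_smul, ← trace_mul_kronecker_one, smul_eq_mul]
    congr 1
    have : R * ((1 : Matrix r r ℂ) ⊗ₖ S) * (K ⊗ₖ (1 : Matrix e e ℂ)) =
        R * (X ⊗ₖ S) * (X ⊗ₖ (1 : Matrix e e ℂ)) := by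
      rw [Matrix.mul_assoc, Matrix.mul_assoc, ← Matrix.mul_kronecker_mul,
        ← Matrix.mul_kronecker_mul, Matrix.one_mul, Matrix.mul_one, hXX]
    rw [this, Matrix.trace_mul_comm, Matrix.mul_assoc]
  rw [frobSq_of_isHermitian hKp.isHermitian, hkey, Complex.re_ofReal_mul]
  have hle := re_trace_mul_conjTranspose_le ((X ⊗ₖ (1 : Matrix e e ℂ)) * R) (X ⊗ₖ S)
  rw [frob, frob, hfXR, hfXS] at hle
  calc _ ≤ √(Fintype.card r : ℝ) * (√((Fintype.card r : ℝ)⁻¹ * K.trace.re) * √K.trace.re) :=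
        mul_le_mul_of_nonneg_left hle (Real.sqrt_nonneg _)
    _ = K.trace.re := by
        rw [Real.sqrt_mul (by positivity), mul_assoc, Real.mul_self_sqrt htr0, ← mul_assoc,
          ← Real.sqrt_mul hd.le, mul_inv_cancel₀ hd.ne', Real.sqrt_one, one_mul]

/-- The overlap of the actual purification with the ideal one. -/
lemma exists_overlap [Nonempty r] {R : Matrix (r × e) (r × e) ℂ} (hR : R.PosSemidef)
    (hRm : traceSnd (R * R) = (Fintype.card r : ℂ)⁻¹ • 1) {S : Matrix e e ℂ} (hS : S.PosSemidef)
    (hS1 : (S * S).trace = 1) {X : ℝ → Matrix r r ℂ}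
    (hX : ∀ t, X t = ((√(Fintype.card r : ℝ) : ℝ) : ℂ) •
      (traceSnd (R * ((1 : Matrix r r ℂ) ⊗ₖ S)))ᵀ - (t : ℂ) • 1) :
    ∃ c : ℝ, 0 ≤ c ∧ c ≤ 1 ∧ (X c).trace = 0 ∧ frobSq (X c) ≤ Fintype.card r * (c - c ^ 2) ∧
      ∀ κ : ℝ, 0 < κ → 1 + κ⁻¹ - 2 * c / √κ ≤ traceNorm (R * R - ((κ⁻¹ : ℝ) : ℂ) •
        ((Fintype.card r : ℂ)⁻¹ • ((1 : Matrix r r ℂ) ⊗ₖ (S * S)))) := by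
  have hd : (0 : ℝ) < Fintype.card r := by exact_mod_cast Fintype.card_pos
  have hd' : (Fintype.card r : ℂ) ≠ 0 := by exact_mod_cast Fintype.card_ne_zero
  set K := ((√(Fintype.card r : ℝ) : ℝ) : ℂ) • traceSnd (R * ((1 : Matrix r r ℂ) ⊗ₖ S)) with hK
  have hKp : K.PosSemidef :=
    (posSemidef_overlap hR hS).smul (by exact_mod_cast Real.sqrt_nonneg _)
  have hfK := frobSq_overlap_le hR hRm hS hS1 hK
  have htr0 : 0 ≤ K.trace.re := PosSemidef.re_trace_nonneg hKp
  -- The mean eigenvalue of the overlap operator, which is the amplitude of the maximally entangled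
  -- state after decoding.
  set c := K.trace.re / Fintype.card r with hc
  have hcd : K.trace.re = Fintype.card r * c := by rw [hc]; field_simp
  have hcd' : K.trace = Fintype.card r * (c : ℂ) := by
    rw [← ofReal_re_trace hKp.isHermitian, hcd]; push_cast; rfl
  have hc0 : 0 ≤ c := by positivity
  have hXK : X c = (K - (c : ℂ) • 1)ᵀ := by
    rw [hX, hK, Matrix.transpose_sub, Matrix.transpose_smul, Matrix.transpose_smul,
      Matrix.transpose_one]
  -- The variance of the eigenvalues; Tr K² ≤ Tr K = dc bounds it by d(c − c²).
  have hfX : frobSq (X c) = frobSq K - Fintype.card r * c ^ 2 := by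
    have hH : (K - (c : ℂ) • 1).IsHermitian := by
      refine hKp.isHermitian.sub ?_
      rw [Matrix.IsHermitian, Matrix.conjTranspose_smul, Complex.star_def, Complex.conj_ofReal,
        Matrix.conjTranspose_one]
    have h1 : frobSq (X c) = frobSq (K - (c : ℂ) • 1) := by
      rw [hXK, frobSq, frobSq, Finset.sum_comm]; rfl
    rw [h1, frobSq_of_isHermitian hH, frobSq_of_isHermitian hKp.isHermitian]
    have h2 : ((K - (c : ℂ) • 1) * (K - (c : ℂ) • 1)).trace =
        (K * K).trace - ((Fintype.card r * c ^ 2 : ℝ) : ℂ) := by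
      simp only [Matrix.sub_mul, Matrix.mul_sub, Matrix.trace_sub, Matrix.smul_mul,
        Matrix.mul_smul, Matrix.one_mul, Matrix.mul_one, Matrix.trace_smul, Matrix.trace_one,
        smul_eq_mul, hcd']
      push_cast
      ring
    rw [h2, Complex.sub_re, Complex.ofReal_re]
  have hfX' : frobSq (X c) ≤ Fintype.card r * (c - c ^ 2) := by
    rw [hfX]; linarith
  refine ⟨c, hc0, ?_, ?_, hfX', fun κ hκ => ?_⟩
  · have h := (frobSq_nonneg (X c)).trans hfX'
    have h2 : 0 ≤ c - c ^ 2 := nonneg_of_mul_nonneg_right h hd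
    by_contra! h3
    nlinarith
  · rw [hXK, Matrix.trace_transpose, Matrix.trace_sub, hcd', Matrix.trace_smul, Matrix.trace_one,
      smul_eq_mul]
    ring
  -- Powers–Størmer for the roots R and y(1 ⊗ S) of the actual and the ideal state, where y gives
  -- the second one trace κ⁻¹.
  · set y : ℝ := (√(Fintype.card r * κ))⁻¹ with hy
    have hdk : (0 : ℝ) < Fintype.card r * κ := mul_pos hd hκ
    have hyy : y * y = (Fintype.card r : ℝ)⁻¹ * κ⁻¹ := by
      rw [hy, ← mul_inv, Real.mul_self_sqrt hdk.le, mul_inv]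
    have hQ : ((y : ℂ) • ((1 : Matrix r r ℂ) ⊗ₖ S)).PosSemidef := by
      refine (posSemidef_one_kronecker hS).smul ?_
      exact_mod_cast inv_nonneg.2 (Real.sqrt_nonneg _)
    have hPS := frobSq_sub_le_traceNorm hR hQ
    have hQQ : ((y : ℂ) • ((1 : Matrix r r ℂ) ⊗ₖ S)) * ((y : ℂ) • ((1 : Matrix r r ℂ) ⊗ₖ S)) =
        ((κ⁻¹ : ℝ) : ℂ) • ((Fintype.card r : ℂ)⁻¹ • ((1 : Matrix r r ℂ) ⊗ₖ (S * S))) := by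
      rw [Matrix.smul_mul, Matrix.mul_smul, smul_smul, ← Matrix.mul_kronecker_mul, Matrix.one_mul,
        smul_smul, ← Complex.ofReal_mul, hyy]
      congr 1
      push_cast
      ring
    rw [hQQ] at hPS
    refine le_trans (le_of_eq ?_) hPS
    have hRt : (R * R).trace = 1 := by
      rw [← trace_traceSnd, hRm, Matrix.trace_smul, Matrix.trace_one, smul_eq_mul,
        inv_mul_cancel₀ hd']
    have hRS : ((√(Fintype.card r : ℝ) : ℝ) : ℂ) * (R * ((1 : Matrix r r ℂ) ⊗ₖ S)).trace =
        Fintype.card r * (c : ℂ) := by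
      rw [← hcd', hK, Matrix.trace_smul, trace_traceSnd, smul_eq_mul]
    have hsq : √(Fintype.card r : ℝ) * √(Fintype.card r : ℝ) = Fintype.card r :=
      Real.mul_self_sqrt hd.le
    have hsq0 : (0 : ℝ) < √(Fintype.card r : ℝ) := Real.sqrt_pos.2 hd
    have hRS' : (R * ((1 : Matrix r r ℂ) ⊗ₖ S)).trace = ((√(Fintype.card r : ℝ) * c : ℝ) : ℂ) := by
      have h0 : ((√(Fintype.card r : ℝ) : ℝ) : ℂ) ≠ 0 := by exact_mod_cast hsq0.ne'
      apply mul_left_cancel₀ h0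
      rw [hRS, ← Complex.ofReal_mul, ← mul_assoc, hsq]
      push_cast; rfl
    have hSR' : (((1 : Matrix r r ℂ) ⊗ₖ S) * R).trace = ((√(Fintype.card r : ℝ) * c : ℝ) : ℂ) := by
      rw [Matrix.trace_mul_comm, hRS']
    rw [frobSq_of_isHermitian (hR.isHermitian.sub hQ.isHermitian), Matrix.sub_mul, Matrix.mul_sub,
      Matrix.mul_sub, hQQ]
    simp only [Matrix.trace_sub, Matrix.smul_mul, Matrix.mul_smul, Matrix.trace_smul, hRt, hRS',
      hSR', Matrix.trace_kronecker, Matrix.trace_one, hS1, smul_eq_mul, mul_one]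
    rw [inv_mul_cancel₀ hd', mul_one, ← Complex.ofReal_mul, ← Complex.ofReal_one,
      ← Complex.ofReal_sub, ← Complex.ofReal_sub, ← Complex.ofReal_sub, Complex.ofReal_re]
    have hyv : y * (√(Fintype.card r : ℝ) * c) = c / √κ := by
      rw [hy, Real.sqrt_mul hd.le]
      field_simp
    rw [hyv]
    ring

end Overlap

/-! ### Reference marginals and restriction of the messages -/

section Marginal

variable {r s f g a b c e p q : Type*} [Fintype r] [DecidableEq r] [Fintype s] [DecidableEq s]
  [Fintype f] [DecidableEq f] [Fintype g] [DecidableEq g]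
  [Fintype a] [DecidableEq a] [Fintype b] [DecidableEq b] [Fintype c] [DecidableEq c]
  [Fintype e] [DecidableEq e] [Fintype p] [DecidableEq p] [Fintype q] [DecidableEq q]

lemma lift_kerBar (X : Matrix (a × e) (a × e) ℂ) :
    lift (kerBar : Ker r a) X = (Fintype.card r : ℂ)⁻¹ • ((1 : Matrix r r ℂ) ⊗ₖ traceFst X) := by
  ext i j
  simp only [lift, kerBar, Matrix.smul_apply, Matrix.kroneckerMap_apply, Matrix.one_apply,
    traceFst, smul_eq_mul, mul_ite, mul_one, mul_zero, ite_mul, zero_mul, one_mul,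
    Finset.sum_ite_eq, Finset.mem_univ, if_true]
  split_ifs
  · rw [Finset.mul_sum]
  · simp

/-- The references are maximally mixed. -/
lemma traceSnd_outputAmp [Nonempty r] [Nonempty s] [Nonempty f] [Nonempty g]
    {U : Matrix (c × e) (a × b) ℂ} (hU : Uᴴ * U = 1) {WA : Matrix a (r × f) ℂ}
    {WB : Matrix b (s × g) ℂ} (hA : WAᴴ * WA = 1) (hB : WBᴴ * WB = 1)
    {Ψ : Matrix ((r × s) × e) (c × (f × g)) ℂ}
    (hΨ : Ψ = outputAmp U (((√(Fintype.card (r × f) : ℝ) : ℝ) : ℂ)⁻¹ • WA)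
      (((√(Fintype.card (s × g) : ℝ) : ℝ) : ℂ)⁻¹ • WB)) :
    traceSnd (Ψ * Ψᴴ) = (Fintype.card (r × s) : ℂ)⁻¹ • 1 := by
  set x : ℂ := ((√(Fintype.card (r × f) : ℝ) : ℝ) : ℂ)⁻¹ * ((√(Fintype.card (s × g) : ℝ) : ℝ) : ℂ)⁻¹
    with hx
  have hxx : x * conj x = ((Fintype.card (r × f) : ℂ) * (Fintype.card (s × g) : ℂ))⁻¹ := by
    rw [hx, ← Complex.ofReal_inv, ← Complex.ofReal_inv, ← Complex.ofReal_mul, Complex.conj_ofReal,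
      ← Complex.ofReal_mul, mul_mul_mul_comm, ← mul_inv, ← mul_inv,
      Real.mul_self_sqrt (Nat.cast_nonneg _), Real.mul_self_sqrt (Nat.cast_nonneg _)]
    push_cast
    rw [mul_inv]
  rw [outputAmp_smul, ← hx] at hΨ
  have hG : (U * (WA ⊗ₖ WB))ᴴ * (U * (WA ⊗ₖ WB)) = 1 := by
    rw [Matrix.conjTranspose_mul, Matrix.mul_assoc, ← Matrix.mul_assoc Uᴴ, hU, Matrix.one_mul,
      Matrix.conjTranspose_kronecker, ← Matrix.mul_kronecker_mul, hA, hB, Matrix.one_kronecker_one]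
  set Z := U * (WA ⊗ₖ WB) with hZ
  set O := outputAmp U WA WB with hO
  have hOZ : ∀ i j, O i j = Z (j.1, i.2) ((i.1.1, j.2.1), (i.1.2, j.2.2)) := fun _ _ => rfl
  clear_value Z O
  have h1 : ∀ i j : r × s, traceSnd (O * Oᴴ) i j =
      ∑ k : f, ∑ l : g, (Zᴴ * Z) ((j.1, k), (j.2, l)) ((i.1, k), (i.2, l)) := by
    intro i j
    simp only [traceSnd, Matrix.mul_apply, Matrix.conjTranspose_apply, hOZ,
      Fintype.sum_prod_type]
    calc _ = ∑ y : c, ∑ k : f, ∑ l : g, ∑ x : e, Z (y, x) ((i.1, k), (i.2, l)) *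
          star (Z (y, x) ((j.1, k), (j.2, l))) := by
          rw [Finset.sum_comm]
          refine Finset.sum_congr rfl fun y _ => ?_
          rw [Finset.sum_comm]
          refine Finset.sum_congr rfl fun k _ => ?_
          rw [Finset.sum_comm]
      _ = _ := by
          rw [Finset.sum_comm]
          refine Finset.sum_congr rfl fun k _ => ?_
          rw [Finset.sum_comm]
          exact Finset.sum_congr rfl fun l _ => Finset.sum_congr rfl fun _ _ =>
            Finset.sum_congr rfl fun _ _ => mul_comm _ _
  ext i j
  have h2 : traceSnd (Ψ * Ψᴴ) i j =
      x * conj x * traceSnd (O * Oᴴ) i j := by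
    rw [hΨ, Matrix.conjTranspose_smul, Matrix.smul_mul, Matrix.mul_smul, smul_smul]
    simp only [traceSnd, Matrix.smul_apply, smul_eq_mul, Finset.mul_sum, Complex.star_def]
  rw [h2, h1, hG, hxx]
  have hf : (Fintype.card f : ℂ) ≠ 0 := by exact_mod_cast Fintype.card_ne_zero
  have hg : (Fintype.card g : ℂ) ≠ 0 := by exact_mod_cast Fintype.card_ne_zero
  have hr : (Fintype.card r : ℂ) ≠ 0 := by exact_mod_cast Fintype.card_ne_zero
  have hs : (Fintype.card s : ℂ) ≠ 0 := by exact_mod_cast Fintype.card_ne_zero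
  simp only [Matrix.one_apply, Matrix.smul_apply, smul_eq_mul, Prod.ext_iff, and_true,
    Finset.sum_const, Finset.card_univ, nsmul_eq_mul, Fintype.card_prod, Nat.cast_mul]
  by_cases h : i.1 = j.1 ∧ i.2 = j.2
  · rw [if_pos h, if_pos ⟨h.1.symm, h.2.symm⟩]
    field_simp
  · rw [if_neg h, if_neg fun h' => h ⟨h'.1.symm, h'.2.symm⟩]
    simp

/-- Restricting the messages to subspaces. -/
lemma outputAmp_restrict (U : Matrix (c × e) (a × b) ℂ) (P : Matrix a (r × f) ℂ)
    (Q : Matrix b (s × g) ℂ) (v : Matrix r p ℂ) (w : Matrix s q ℂ) :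
    outputAmp U (P * (v ⊗ₖ (1 : Matrix f f ℂ))) (Q * (w ⊗ₖ (1 : Matrix g g ℂ))) =
      ((v ⊗ₖ w)ᵀ ⊗ₖ (1 : Matrix e e ℂ)) * outputAmp U P Q := by
  ext i j
  rw [outputAmp, Matrix.mul_kronecker_mul, ← Matrix.mul_assoc]
  simp only [Matrix.mul_apply (N := (v ⊗ₖ (1 : Matrix f f ℂ)) ⊗ₖ (w ⊗ₖ (1 : Matrix g g ℂ))),
    Matrix.mul_apply (M := (v ⊗ₖ w)ᵀ ⊗ₖ (1 : Matrix e e ℂ)), outputAmp, Fintype.sum_prod_type,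
    Matrix.kroneckerMap_apply, Matrix.transpose_apply, Matrix.one_apply, mul_ite, mul_one,
    mul_zero, ite_mul, zero_mul, Finset.sum_ite_eq, Finset.sum_ite_eq', Finset.mem_univ, if_true]
  refine Finset.sum_congr rfl fun x _ => ?_
  simp only [Finset.sum_ite_irrel, Finset.sum_const_zero, Finset.sum_ite_eq',
    Finset.mem_univ, if_true]
  exact Finset.sum_congr rfl fun y _ => by ring

end Marginal

/-! ### The protocol expressed through amplitude matrices -/

section Output

variable {a b c e : Type*} [Fintype a] [DecidableEq a] [Fintype b] [DecidableEq b]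
  [Fintype c] [DecidableEq c] [Fintype e] [DecidableEq e]

lemma encodedKet_eq {Q E : ℕ} (V : Matrix a (Qubits Q × Qubits E) ℂ)
    (p : (Qubits Q × Qubits E) × a) :
    encodedKet V p =
      (((√(Fintype.card (Qubits Q × Qubits E) : ℝ) : ℝ) : ℂ)⁻¹ • V) p.2 p.1 := by
  simp only [encodedKet, epr, ite_mul, zero_mul, mul_ite, mul_zero, Finset.sum_ite_eq,
    Finset.mem_univ, if_true]
  rw [Matrix.smul_apply, smul_eq_mul, mul_comm, Fintype.card_prod, Nat.cast_mul,
    Real.sqrt_mul (Nat.cast_nonneg _), Complex.ofReal_mul, mul_inv]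
  push_cast
  rfl

lemma traceSnd_conj_vecMulVec (U : Matrix (c × e) (a × b) ℂ) (ψ φ : a × b → ℂ) (y y' : c) :
    traceSnd (U * Matrix.vecMulVec ψ (star φ) * Uᴴ) y y' =
      ∑ x, (∑ i, U (y, x) i * ψ i) * conj (∑ i, U (y', x) i * φ i) := by
  rw [traceSnd]
  refine Finset.sum_congr rfl fun x _ => ?_
  simp only [Matrix.mul_apply, Matrix.vecMulVec_apply, Matrix.conjTranspose_apply, Pi.star_apply,
    map_sum, map_mul, Finset.mul_sum, Complex.star_def, ← mul_assoc]
  refine Finset.sum_congr rfl fun i _ => ?_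
  rw [← Finset.sum_mul]
  ring

variable {QA EA QB EB : ℕ}

/-- The Stinespring dilation turns the joint state of receiver and references into amplitudes with
the environment summed out. -/
lemma tensorId_inputState {N : Matrix (a × b) (a × b) ℂ →ₗ[ℂ] Matrix c c ℂ}
    {U : Matrix (c × e) (a × b) ℂ} (hU : IsStinespring N U)
    (VA : Matrix a (Qubits QA × Qubits EA) ℂ) (VB : Matrix b (Qubits QB × Qubits EB) ℂ)
    {Ψ : Matrix ((Qubits QA × Qubits QB) × e) (c × (Qubits EA × Qubits EB)) ℂ}
    (hΨ : Ψ = outputAmp U (((√(Fintype.card (Qubits QA × Qubits EA) : ℝ) : ℝ) : ℂ)⁻¹ • VA)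
      (((√(Fintype.card (Qubits QB × Qubits EB) : ℝ) : ℝ) : ℂ)⁻¹ • VB))
    (k k' : c × (Qubits EA × Qubits EB)) (m m' : Qubits QA × Qubits QB) :
    tensorId N (inputState VA VB) (k.1, (k.2, m)) (k'.1, (k'.2, m')) =
      ∑ x, Ψ (m, x) k * conj (Ψ (m', x) k') := by
  refine (congrFun (congrFun (hU.2 (Matrix.of fun i j =>
    inputState VA VB (i, (k.2, m)) (j, (k'.2, m')))) k.1) k'.1).trans ?_
  refine (traceSnd_conj_vecMulVec U
    (fun i => encodedKet VA ((m.1, k.2.1), i.1) * encodedKet VB ((m.2, k.2.2), i.2))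
    (fun i => encodedKet VA ((m'.1, k'.2.1), i.1) * encodedKet VB ((m'.2, k'.2.2), i.2))
    k.1 k'.1).trans ?_
  subst hΨ
  refine Finset.sum_congr rfl fun x _ => ?_
  simp only [encodedKet_eq]
  rfl

lemma outputState_krausMap {N : Matrix (a × b) (a × b) ℂ →ₗ[ℂ] Matrix c c ℂ}
    {U : Matrix (c × e) (a × b) ℂ} (hU : IsStinespring N U)
    (VA : Matrix a (Qubits QA × Qubits EA) ℂ) (VB : Matrix b (Qubits QB × Qubits EB) ℂ)
    {Ψ : Matrix ((Qubits QA × Qubits QB) × e) (c × (Qubits EA × Qubits EB)) ℂ}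
    (hΨ : Ψ = outputAmp U (((√(Fintype.card (Qubits QA × Qubits EA) : ℝ) : ℝ) : ℂ)⁻¹ • VA)
      (((√(Fintype.card (Qubits QB × Qubits EB) : ℝ) : ℝ) : ℂ)⁻¹ • VB))
    {J : Type*} [Fintype J] [DecidableEq J]
    (A : J → Matrix (Qubits QA × Qubits QB) (c × (Qubits EA × Qubits EB)) ℂ) :
    outputState N VA VB (krausMap A) = decodedAmp Ψ A * (decodedAmp Ψ A)ᴴ := by
  ext p q
  rw [outputState, tensorId_krausMap, Matrix.sum_apply, Matrix.mul_apply, Fintype.sum_prod_type]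
  refine Finset.sum_congr rfl fun j _ => ?_
  rw [kronecker_one_conj_apply]
  simp only [Matrix.submatrix_apply, tensorId_inputState hU VA VB hΨ, Matrix.conjTranspose_apply,
    decodedAmp]
  simp only [Matrix.mul_apply (M := Ψ), Matrix.transpose_apply, Complex.star_def, map_sum,
    map_mul, Finset.sum_mul_sum]
  simp only [Finset.mul_sum]
  rw [Finset.sum_congr rfl fun y _ => Finset.sum_comm, Finset.sum_comm]
  refine Finset.sum_congr rfl fun x _ => Finset.sum_congr rfl fun y _ =>
    Finset.sum_congr rfl fun y' _ => ?_
  ring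

/-- The entries of `z • X`, as a column. -/
def colOf {m : Type*} (z : ℂ) (X : Matrix m m ℂ) : Matrix (m × m) Unit ℂ :=
  fun p _ => z * X p.1 p.2

/-- The ket of the maximally entangled state, as a column. -/
def eprCol (m : Type*) [Fintype m] [DecidableEq m] : Matrix (m × m) Unit ℂ :=
  colOf ((√(Fintype.card m : ℝ) : ℝ) : ℂ)⁻¹ 1

lemma targetState_eq (QA QB : ℕ) :
    targetState QA QB = eprCol (Qubits QA × Qubits QB) * (eprCol (Qubits QA × Qubits QB))ᴴ := by
  have h : ∀ p : (Qubits QA × Qubits QB) × (Qubits QA × Qubits QB),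
      epr (p.1.1, p.2.1) * epr (p.1.2, p.2.2) = eprCol (Qubits QA × Qubits QB) p () := by
    intro p
    simp only [epr, eprCol, colOf, Matrix.one_apply, Prod.ext_iff]
    rw [Fintype.card_prod, Nat.cast_mul, Real.sqrt_mul (Nat.cast_nonneg _), Complex.ofReal_mul,
      mul_inv]
    by_cases h1 : p.1.1 = p.2.1 <;> by_cases h2 : p.1.2 = p.2.2 <;> simp [h1, h2]
  ext p q
  rw [Matrix.mul_apply, targetState, ketbra, Matrix.vecMulVec_apply]
  simp only [h, Pi.star_apply, Matrix.conjTranspose_apply, Finset.univ_unique, Finset.sum_singleton]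

lemma frobSq_colOf {m : Type*} [Fintype m] [DecidableEq m] (z : ℂ) (X : Matrix m m ℂ) :
    frobSq (colOf z X) = ‖z‖ ^ 2 * frobSq X := by
  simp [frobSq, colOf, Fintype.sum_prod_type, mul_pow, Finset.mul_sum]

lemma norm_sq_inv_sqrt (n : ℕ) : ‖((√(n : ℝ) : ℝ) : ℂ)⁻¹‖ ^ 2 = (n : ℝ)⁻¹ := by
  rw [norm_inv, Complex.norm_real, Real.norm_eq_abs, abs_of_nonneg (Real.sqrt_nonneg _), inv_pow,
    Real.sq_sqrt (Nat.cast_nonneg _)]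

lemma frobSq_one {m : Type*} [Fintype m] [DecidableEq m] :
    frobSq (1 : Matrix m m ℂ) = Fintype.card m := by
  rw [frobSq_of_isHermitian Matrix.isHermitian_one, Matrix.mul_one, Matrix.trace_one]
  simp

lemma frobSq_eprCol {m : Type*} [Fintype m] [DecidableEq m] [Nonempty m] :
    frobSq (eprCol m) = 1 := by
  have hd : (Fintype.card m : ℝ) ≠ 0 := by exact_mod_cast Fintype.card_ne_zero
  refine (frobSq_colOf _ _).trans ?_
  rw [norm_sq_inv_sqrt, frobSq_one, inv_mul_cancel₀ hd]

lemma trace_eprCol_mul {m : Type*} [Fintype m] [DecidableEq m] (X : Matrix m m ℂ) :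
    ((eprCol m)ᴴ * colOf ((√(Fintype.card m : ℝ) : ℝ) : ℂ)⁻¹ X).trace.re =
      (Fintype.card m : ℝ)⁻¹ * X.trace.re := by
  set y : ℂ := ((√(Fintype.card m : ℝ) : ℝ) : ℂ)⁻¹ with hy
  have hyy : conj y * y = (((Fintype.card m : ℝ)⁻¹ : ℝ) : ℂ) := by
    rw [mul_comm, Complex.mul_conj, Complex.normSq_eq_norm_sq, hy, norm_sq_inv_sqrt]
  have : ((eprCol m)ᴴ * colOf y X).trace = (((Fintype.card m : ℝ)⁻¹ : ℝ) : ℂ) * X.trace := by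
    rw [← hyy]
    simp only [Matrix.trace, Matrix.diag_apply, Matrix.mul_apply, Matrix.conjTranspose_apply,
      Finset.univ_unique, Finset.sum_singleton, eprCol, colOf, ← hy, Complex.star_def,
      Fintype.sum_prod_type, Matrix.one_apply,
      apply_ite conj, map_zero, mul_ite, mul_one, mul_zero, ite_mul, zero_mul,
      Finset.sum_ite_eq, Finset.mem_univ, if_true, Finset.mul_sum]
    exact Finset.sum_congr rfl fun _ _ => by ring
  rw [this, Complex.re_ofReal_mul]

end Output

/-! ### Random subcodes -/

section Subcode

variable {a b c e p q f g : Type*} [Fintype a] [DecidableEq a] [Fintype b] [DecidableEq b]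
  [Fintype c] [DecidableEq c] [Fintype e] [DecidableEq e] [Fintype p] [DecidableEq p]
  [Fintype q] [DecidableEq q] [Fintype f] [DecidableEq f] [Fintype g] [DecidableEq g]
  [Nonempty p] [Nonempty q] [Nonempty f] [Nonempty g] {M : ℕ}

/-- Some subspace compresses a trace-free operator well. -/
lemma exists_compression (hM : 0 < M)
    {X : Matrix ((p × Fin M) × (q × Fin M)) ((p × Fin M) × (q × Fin M)) ℂ} (hX : X.trace = 0)
    {t : ℝ} (ht : 0 ≤ t) {η : ℝ}
    (hXf : frobSq X ≤ Fintype.card ((p × Fin M) × (q × Fin M)) * η) :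
    ∃ (v : Matrix (p × Fin M) p ℂ) (w : Matrix (q × Fin M) q ℂ), vᴴ * v = 1 ∧ wᴴ * w = 1 ∧
      2 * t * (√(Fintype.card (p × q) : ℝ)⁻¹ * frob ((v ⊗ₖ w)ᴴ * X * (v ⊗ₖ w))) -
        2 * t * ((Fintype.card (p × q) : ℝ)⁻¹ * ((v ⊗ₖ w)ᴴ * X * (v ⊗ₖ w)).trace.re) ≤
        2 * t * √(η / M) := by
  have hM0 : (0 : ℝ) < M := by exact_mod_cast hM
  have hd0 : (0 : ℝ) < Fintype.card (p × q) := by exact_mod_cast Fintype.card_pos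
  have hcard : (Fintype.card ((p × Fin M) × (q × Fin M)) : ℝ) = Fintype.card (p × q) * M ^ 2 := by
    simp only [Fintype.card_prod, Fintype.card_fin, Nat.cast_mul]; ring
  let cmp : IsoSeed q M × IsoSeed p M → Matrix (p × q) (p × q) ℂ := fun ω =>
    (blockIso ω.2 ⊗ₖ blockIso ω.1)ᴴ * X * (blockIso ω.2 ⊗ₖ blockIso ω.1)
  -- The factor M⁻³ of the compression meets the dimension ratio M²: relative to the smaller
  -- dimension the squared norm gains 1/M.
  have hE2 : 𝔼 ω, frobSq (cmp ω) ≤ Fintype.card (p × q) * (η / M) := by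
    rw [expect_prod]
    refine (expect_compress_le hM X hX).trans ?_
    rw [div_le_iff₀ (by positivity)]
    refine hXf.trans (le_of_eq ?_)
    rw [hcard]
    field_simp
  have hEf : 𝔼 ω, √(Fintype.card (p × q) : ℝ)⁻¹ * frob (cmp ω) ≤ √(η / M) := by
    rw [← Finset.mul_expect]
    have := (expect_le_sqrt_expect_sq fun ω => frob (cmp ω)).trans
      (Real.sqrt_le_sqrt (le_of_eq_of_le (by simp only [sq_frob]) hE2))
    refine (mul_le_mul_of_nonneg_left this (Real.sqrt_nonneg _)).trans (le_of_eq ?_)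
    rw [← Real.sqrt_mul (by positivity), ← mul_assoc, inv_mul_cancel₀ hd0.ne', one_mul]
  have hEt : 𝔼 ω, (cmp ω).trace.re = 0 := by
    rw [← Complex.re_expect, expect_prod_complex]
    rw [show (𝔼 s, 𝔼 t, (cmp (s, t)).trace) = 0 from expect_trace_compress X hX, Complex.zero_re]
  -- The trace term vanishes only on average, so it is kept inside the averaged quantity.
  obtain ⟨ω, hω⟩ := exists_le_expect fun ω =>
    2 * t * (√(Fintype.card (p × q) : ℝ)⁻¹ * frob (cmp ω)) -
      2 * t * ((Fintype.card (p × q) : ℝ)⁻¹ * (cmp ω).trace.re)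
  rw [Finset.expect_sub_distrib, ← Finset.mul_expect, ← Finset.mul_expect (a := 2 * t),
    ← Finset.mul_expect (a := (Fintype.card (p × q) : ℝ)⁻¹), hEt, mul_zero, mul_zero,
    sub_zero] at hω
  exact ⟨blockIso ω.2, blockIso ω.1, blockIso_isometry hM _, blockIso_isometry hM _,
    hω.trans (mul_le_mul_of_nonneg_left hEf (by positivity))⟩

lemma sqrt_card_prod_fin {m : Type*} [Fintype m] :
    √(Fintype.card ((m × Fin M) × f) : ℝ) = √(M : ℝ) * √(Fintype.card (m × f) : ℝ) := by
  rw [← Real.sqrt_mul (Nat.cast_nonneg _)]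
  congr 1
  simp only [Fintype.card_prod, Fintype.card_fin, Nat.cast_mul]
  ring

lemma isometry_restrict {m r x : Type*} [Fintype m] [DecidableEq m] [Fintype r] [DecidableEq r]
    [Fintype x] {W : Matrix x (r × f) ℂ} (hW : Wᴴ * W = 1) {v : Matrix r m ℂ} (hv : vᴴ * v = 1) :
    (W * (v ⊗ₖ (1 : Matrix f f ℂ)))ᴴ * (W * (v ⊗ₖ (1 : Matrix f f ℂ))) = 1 := by
  rw [Matrix.conjTranspose_mul, Matrix.mul_assoc, ← Matrix.mul_assoc Wᴴ, hW, Matrix.one_mul,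
    Matrix.conjTranspose_kronecker, ← Matrix.mul_kronecker_mul, hv, Matrix.conjTranspose_one,
    Matrix.one_mul, Matrix.one_kronecker_one]

/-- Each message space shrinks by the factor M, which changes the normalisation by √M per sender. -/
lemma outputAmp_subcode (hM : 0 < M) (U : Matrix (c × e) (a × b) ℂ)
    (WA : Matrix a ((p × Fin M) × f) ℂ) (WB : Matrix b ((q × Fin M) × g) ℂ)
    (v : Matrix (p × Fin M) p ℂ) (w : Matrix (q × Fin M) q ℂ) :
    outputAmp U
      (((√(Fintype.card (p × f) : ℝ) : ℝ) : ℂ)⁻¹ • (WA * (v ⊗ₖ (1 : Matrix f f ℂ))))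
      (((√(Fintype.card (q × g) : ℝ) : ℝ) : ℂ)⁻¹ • (WB * (w ⊗ₖ (1 : Matrix g g ℂ)))) =
      (M : ℂ) • (((v ⊗ₖ w)ᵀ ⊗ₖ (1 : Matrix e e ℂ)) * outputAmp U
        (((√(Fintype.card ((p × Fin M) × f) : ℝ) : ℝ) : ℂ)⁻¹ • WA)
        (((√(Fintype.card ((q × Fin M) × g) : ℝ) : ℝ) : ℂ)⁻¹ • WB)) := by
  have hM0 : (0 : ℝ) < M := by exact_mod_cast hM
  rw [← outputAmp_restrict, Matrix.smul_mul, Matrix.smul_mul, outputAmp_smul, outputAmp_smul,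
    smul_smul, sqrt_card_prod_fin, sqrt_card_prod_fin]
  congr 1
  have hs : ((√(M : ℝ) : ℝ) : ℂ) * ((√(M : ℝ) : ℝ) : ℂ) = M := by
    rw [← Complex.ofReal_mul, Real.mul_self_sqrt (Nat.cast_nonneg _)]; simp
  have hs0 : ((√(M : ℝ) : ℝ) : ℂ) ≠ 0 := by exact_mod_cast (Real.sqrt_pos.2 hM0).ne'
  rw [Complex.ofReal_mul, Complex.ofReal_mul, mul_inv, mul_inv, ← hs]
  field_simp

/-- A random subcode of a code with small environment correlations can be decoded with an error
that is linear in the decoupling error. -/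
theorem exists_subcode {U : Matrix (c × e) (a × b) ℂ} (hU : Uᴴ * U = 1) (hM : 0 < M)
    {WA : Matrix a ((p × Fin M) × f) ℂ} {WB : Matrix b ((q × Fin M) × g) ℂ}
    (hA : WAᴴ * WA = 1) (hB : WBᴴ * WB = 1)
    {Ψ : Matrix (((p × Fin M) × (q × Fin M)) × e) (c × (f × g)) ℂ}
    (hΨ : Ψ = outputAmp U (((√(Fintype.card ((p × Fin M) × f) : ℝ) : ℝ) : ℂ)⁻¹ • WA)
      (((√(Fintype.card ((q × Fin M) × g) : ℝ) : ℝ) : ℂ)⁻¹ • WB))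
    {θ : Matrix e e ℂ} (hθ : θ.PosSemidef) (hθ1 : θ.trace = 1) :
    ∃ t : ℝ, 0 ≤ t ∧ t ≤ 1 ∧
      (∀ κ : ℝ, 0 < κ → 1 + κ⁻¹ - 2 * t / √κ ≤ traceNorm (Ψ * Ψᴴ - ((κ⁻¹ : ℝ) : ℂ) •
        ((Fintype.card ((p × Fin M) × (q × Fin M)) : ℂ)⁻¹ •
          ((1 : Matrix ((p × Fin M) × (q × Fin M)) ((p × Fin M) × (q × Fin M)) ℂ) ⊗ₖ θ)))) ∧
      ∃ (VA : Matrix a (p × f) ℂ) (VB : Matrix b (q × g) ℂ)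
        (A : e ⊕ (c × (f × g)) → Matrix (p × q) (c × (f × g)) ℂ),
        VAᴴ * VA = 1 ∧ VBᴴ * VB = 1 ∧ ∑ j, (A j)ᴴ * A j = 1 ∧
        ∀ Φ, Φ = outputAmp U (((√(Fintype.card (p × f) : ℝ) : ℝ) : ℂ)⁻¹ • VA)
          (((√(Fintype.card (q × g) : ℝ) : ℝ) : ℂ)⁻¹ • VB) →
        traceNorm (decodedAmp Φ A * (decodedAmp Φ A)ᴴ - eprCol (p × q) * (eprCol (p × q))ᴴ) ≤
          2 * (1 - t ^ 2) + 2 * t * √((t - t ^ 2) / M) := by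
  have : NeZero M := ⟨hM.ne'⟩
  have hM0 : (0 : ℝ) < M := by exact_mod_cast hM
  have hd0 : (0 : ℝ) < Fintype.card (p × q) := by exact_mod_cast Fintype.card_pos
  have hcard : (Fintype.card ((p × Fin M) × (q × Fin M)) : ℝ) = Fintype.card (p × q) * M ^ 2 := by
    simp only [Fintype.card_prod, Fintype.card_fin, Nat.cast_mul]; ring
  obtain ⟨S, -, hS, -, hSS, -, -⟩ := exists_sqrt_pinv hθ
  obtain ⟨R, hR, hRR, hdec⟩ := exists_decoder (m := p × q) Ψ hS.isHermitian hSS hθ1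
  have hRm := traceSnd_outputAmp hU hA hB hΨ
  rw [← hRR] at hRm
  obtain ⟨t, h0, h1, hXtr, hXf, hlow⟩ := exists_overlap hR hRm hS (by rw [hSS, hθ1])
    (fun t => rfl)
  rw [hRR, hSS] at hlow
  refine ⟨t, h0, h1, hlow, ?_⟩
  set L := (traceSnd (R * ((1 : Matrix ((p × Fin M) × (q × Fin M))
    ((p × Fin M) × (q × Fin M)) ℂ) ⊗ₖ S)))ᵀ with hL
  clear_value L
  -- The compression is chosen with the overlap operator already fixed; the decoder is then adapted
  -- to it through `hdec`.
  obtain ⟨v, w, hv1, hw1, hvw⟩ := exists_compression hM hXtr h0 hXf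
  have hw : (v ⊗ₖ w)ᴴ * (v ⊗ₖ w) = 1 := by
    rw [Matrix.conjTranspose_kronecker, ← Matrix.mul_kronecker_mul, hv1, hw1,
      Matrix.one_kronecker_one]
  obtain ⟨A, T, hA1, hT, hAT⟩ := hdec (v ⊗ₖ w) hw (M : ℂ)
  have hVA := isometry_restrict hA hv1
  have hVB := isometry_restrict hB hw1
  refine ⟨_, _, A, hVA, hVB, hA1, fun Φ hΦ => ?_⟩
  have hW1 : frobSq (decodedAmp Φ A) = 1 := by
    rw [frobSq_decodedAmp _ hA1, ← sq_frob, hΦ, frob_outputAmp hU, frob_normalised_isometry hVA,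
      frob_normalised_isometry hVB, one_mul, one_pow]
  rw [outputAmp_subcode hM, ← hΨ] at hΦ
  rw [← hΦ] at hAT
  set C := (v ⊗ₖ w)ᴴ * (((√(Fintype.card ((p × Fin M) × (q × Fin M)) : ℝ) : ℝ) : ℂ) • L -
    (t : ℂ) • 1) * (v ⊗ₖ w) with hC
  have hcm : C = ((√(Fintype.card ((p × Fin M) × (q × Fin M)) : ℝ) : ℝ) : ℂ) •
      ((v ⊗ₖ w)ᴴ * L * (v ⊗ₖ w)) - (t : ℂ) • 1 := by
    rw [hC, Matrix.mul_sub, Matrix.sub_mul, Matrix.mul_smul, Matrix.smul_mul, Matrix.mul_smul,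
      Matrix.smul_mul, Matrix.mul_one, hw]
  clear_value C
  set y : ℂ := ((√(Fintype.card (p × q) : ℝ) : ℝ) : ℂ)⁻¹ with hy
  -- The rescaling M converts the normalisation √d of the large code into that of the maximally
  -- entangled state of the subcode.
  have hsd : (M : ℂ) = y * ((√(Fintype.card ((p × Fin M) × (q × Fin M)) : ℝ) : ℝ) : ℂ) := by
    rw [hcard, Real.sqrt_mul hd0.le, Real.sqrt_sq hM0.le, hy, Complex.ofReal_mul, ← mul_assoc,
      inv_mul_cancel₀ (by exact_mod_cast (Real.sqrt_pos.2 hd0).ne'), one_mul]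
    simp
  have hv : decodedAmp Φ A * T = (t : ℂ) • eprCol (p × q) + colOf y C := by
    ext i j
    rw [hAT i, Matrix.add_apply, Matrix.smul_apply, hcm, hsd]
    simp only [eprCol, colOf, ← hy, Matrix.sub_apply, Matrix.smul_apply, smul_eq_mul]
    ring
  -- The compressed fluctuation plays the role of u; its norm and trace are controlled jointly by
  -- `hvw`.
  refine (traceNorm_sub_pure_le hW1 hT frobSq_eprCol h0 h1 hv).trans ?_
  rw [trace_eprCol_mul, frob, frobSq_colOf, hy, norm_sq_inv_sqrt,
    Real.sqrt_mul (by positivity)]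
  rw [frob] at hvw
  linarith

end Subcode

/-! ### Achievability from Kraus decoders, and the trivial bound -/

section Protocol

variable {a b c e : Type*} [Fintype a] [DecidableEq a] [Fintype b] [DecidableEq b]
  [Fintype c] [DecidableEq c] [Fintype e] [DecidableEq e] {QA EA QB EB : ℕ}

lemma isAchievable_of_kraus {N : Matrix (a × b) (a × b) ℂ →ₗ[ℂ] Matrix c c ℂ}
    {U : Matrix (c × e) (a × b) ℂ} (hU : IsStinespring N U) {δ : ℝ}
    {VA : Matrix a (Qubits QA × Qubits EA) ℂ} {VB : Matrix b (Qubits QB × Qubits EB) ℂ}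
    {J : Type*} [Fintype J] [DecidableEq J]
    {A : J → Matrix (Qubits QA × Qubits QB) (c × (Qubits EA × Qubits EB)) ℂ}
    (hA : VAᴴ * VA = 1) (hB : VBᴴ * VB = 1) (hA1 : ∑ j, (A j)ᴴ * A j = 1)
    (h : ∀ Φ, Φ = outputAmp U (((√(Fintype.card (Qubits QA × Qubits EA) : ℝ) : ℝ) : ℂ)⁻¹ • VA)
      (((√(Fintype.card (Qubits QB × Qubits EB) : ℝ) : ℝ) : ℂ)⁻¹ • VB) →
      traceNorm (decodedAmp Φ A * (decodedAmp Φ A)ᴴ -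
        eprCol (Qubits QA × Qubits QB) * (eprCol (Qubits QA × Qubits QB))ᴴ) ≤ δ) :
    IsAchievable N δ QA EA QB EB := by
  refine ⟨VA, VB, krausMap A, hA, hB, isChannel_krausMap hA1, ?_⟩
  rw [outputState_krausMap hU VA VB rfl, targetState_eq]
  exact h _ rfl

/-- Every protocol has error at most two. -/
lemma isAchievable_two {N : Matrix (a × b) (a × b) ℂ →ₗ[ℂ] Matrix c c ℂ}
    {U : Matrix (c × e) (a × b) ℂ} (hU : IsStinespring N U)
    (hA : 2 ^ (QA + EA) ≤ Fintype.card a) (hB : 2 ^ (QB + EB) ≤ Fintype.card b) :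
    IsAchievable N 2 QA EA QB EB := by
  -- Applied to the zero matrix, merely to extract some isometry from the dimension bound.
  obtain ⟨VA, hVA⟩ := exists_isometry_close (j := Qubits QA × Qubits EA) (x := a)
      (by simpa [pow_add] using hA) 0 one_pos
  obtain ⟨VB, hVB⟩ := exists_isometry_close (j := Qubits QB × Qubits EB) (x := b)
      (by simpa [pow_add] using hB) 0 one_pos
  -- Completing the empty family gives a channel that discards its input.
  obtain ⟨A, -, hA1⟩ := exists_kraus_completion (J := Empty) (κ := Qubits QA × Qubits QB)
    (ι := c × (Qubits EA × Qubits EB)) (A := fun j => j.elim)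
    (by simpa using Matrix.PosSemidef.one)
  refine isAchievable_of_kraus hU hVA.1 hVB.1 hA1 fun Φ hΦ => ?_
  refine (traceNorm_sub_le (Matrix.posSemidef_self_mul_conjTranspose _)
    (Matrix.posSemidef_self_mul_conjTranspose _)).trans (le_of_eq ?_)
  rw [trace_mul_conjTranspose_eq_frobSq, trace_mul_conjTranspose_eq_frobSq, frobSq_eprCol,
    frobSq_decodedAmp _ hA1, ← sq_frob, hΦ, frob_outputAmp hU.1, frob_normalised_isometry hVA.1,
    frob_normalised_isometry hVB.1]
  norm_num

end Protocol

/-! ### Numerical estimates leading to the constant 29 -/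

section Numerics

lemma four_pow_sub_one_le {x y : ℝ} (hx3 : x ^ 3 ≤ 0.0182) (hy0 : 0 ≤ y)
    (hy1 : y ≤ 1.112 * x ^ 3) : (1 + y) ^ 4 - 1 ≤ 4.6 * x ^ 3 := by
  have hy2 : y ≤ 0.0203 := by linarith
  have h1 : (1 + y) ^ 4 - 1 = y * (4 + 6 * y + 4 * y ^ 2 + y ^ 3) := by ring
  have h2 : y ^ 2 ≤ 0.0203 ^ 2 := pow_le_pow_left₀ hy0 hy2 2
  have h3 : y ^ 3 ≤ 0.0203 ^ 3 := pow_le_pow_left₀ hy0 hy2 3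
  norm_num at h2 h3
  have h4 : y * (4 + 6 * y + 4 * y ^ 2 + y ^ 3) ≤ y * 4.13 :=
    mul_le_mul_of_nonneg_left (by linarith) hy0
  rw [h1]
  linarith

/-- Here x = √ε and k = √κ, and `hmain` is the Powers–Størmer bound multiplied by k². Division by k
≥ 1 − x² costs the factor 1 + 1.08x², valid since x² ≤ 0.069. -/
lemma one_sub_overlap_le {x k t D E : ℝ} (hx2 : x ^ 2 ≤ 0.069) (hk0 : 0 < k)
    (hk1 : k ≤ 1) (hk2 : 1 - x ^ 2 ≤ k) (hD0 : 0 ≤ D) (hE0 : 0 ≤ E)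
    (hmain : 2 * k ^ 2 - D - k ^ 2 * E ≤ 2 * t * k) :
    1 - t ≤ x ^ 2 + D / 2 * (1 + 1.08 * x ^ 2) + E / 2 := by
  have hx0 : 0 ≤ x ^ 2 := sq_nonneg x
  have h0 : 1 ≤ (1 + 1.08 * x ^ 2) * k := by
    have h1 : (1 + 1.08 * x ^ 2) * (1 - x ^ 2) ≤ (1 + 1.08 * x ^ 2) * k :=
      mul_le_mul_of_nonneg_left hk2 (by linarith)
    have h2 : 0 ≤ x ^ 2 * (0.08 - 1.08 * x ^ 2) := mul_nonneg hx0 (by linarith)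
    linarith
  have h1 : D * 1 ≤ D * ((1 + 1.08 * x ^ 2) * k) := mul_le_mul_of_nonneg_left h0 hD0
  have h2 : k * (1 - x ^ 2) ≤ k * k := mul_le_mul_of_nonneg_left hk2 hk0.le
  have h4 : k * E * k ≤ k * E * 1 := mul_le_mul_of_nonneg_left hk1 (mul_nonneg hk0.le hE0)
  refine le_of_mul_le_mul_left ?_ hk0
  linarith

/-- The leading coefficients are 1 + 9/2 = 5.5 and 1 + 4.6/2 = 3.3; all higher orders are absorbed
into 6x⁴. -/
lemma one_sub_overlap_le_poly {x t D E : ℝ} (hx0 : 0 < x) (hx1 : x ≤ 0.263) (hx2 : x ^ 2 ≤ 0.069)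
    (hx3 : x ^ 3 ≤ 0.0182) (hD1 : D ≤ 9 * x ^ 2 + 2 * x ^ 3 + x ^ 4 + x ^ 5)
    (hE1 : E ≤ 4.6 * x ^ 3) (h : 1 - t ≤ x ^ 2 + D / 2 * (1 + 1.08 * x ^ 2) + E / 2) :
    1 - t ≤ x ^ 2 * (5.5 + 3.3 * x + 6 * x ^ 2) := by
  have h1 : D / 2 * (1 + 1.08 * x ^ 2) ≤
      (9 * x ^ 2 + 2 * x ^ 3 + x ^ 4 + x ^ 5) / 2 * (1 + 1.08 * x ^ 2) :=
    mul_le_mul_of_nonneg_right (by linarith) (by positivity)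
  have h2 : x ^ 2 * (x ^ 2 * (0.64 - 1.58 * x - 0.54 * x ^ 2 - 0.54 * x ^ 3)) ≥ 0 := by
    have : 0 ≤ 0.64 - 1.58 * x - 0.54 * x ^ 2 - 0.54 * x ^ 3 := by linarith
    positivity
  linarith

lemma final_error_le {x m t : ℝ} (hx0 : 0 < x) (hx1 : x ≤ 0.263) (hx2 : x ^ 2 ≤ 0.069)
    (hm0 : 0 < m) (hp1 : 1 ≤ (m * x) ^ 2) (ht1 : t ≤ 1)
    (h : 1 - t ≤ x ^ 2 * (5.5 + 3.3 * x + 6 * x ^ 2)) :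
    2 * (1 - t ^ 2) + 2 * t * √((t - t ^ 2) / m ^ 2) ≤ 29 * x ^ 2 := by
  have hτ0 : 0 ≤ 1 - t := by linarith
  have hsq : √((t - t ^ 2) / m ^ 2) ≤ 0.2 * (1 - t) + 1.25 * x ^ 2 := by
    have h1 : (t - t ^ 2) / m ^ 2 ≤ (1 - t) * x ^ 2 := by
      rw [div_le_iff₀ (by positivity)]
      have e1 : t - t ^ 2 ≤ 1 - t := by linarith [sq_nonneg (1 - t)]
      have e2 := mul_le_mul_of_nonneg_left hp1 hτ0
      linarith
    refine Real.sqrt_le_iff.2 ⟨by positivity, h1.trans ?_⟩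
    -- Arithmetic–geometric mean with weights satisfying 4 · 0.2 · 1.25 = 1.
    linarith [sq_nonneg (0.2 * (1 - t) - 1.25 * x ^ 2)]
  have hsq2 : t * √((t - t ^ 2) / m ^ 2) ≤ 0.2 * (1 - t) + 1.25 * x ^ 2 :=
    (mul_le_of_le_one_left (Real.sqrt_nonneg _) ht1).trans hsq
  obtain ⟨s, hs⟩ : ∃ s, s = 5.5 + 3.3 * x + 6 * x ^ 2 := ⟨_, rfl⟩
  rw [← hs] at h
  have hs0 : 5.5 ≤ s := by rw [hs]; linarith [sq_nonneg x]
  have hs1 : s ≤ 6.79 := by rw [hs]; linarith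
  have hp : x ^ 2 * s ≤ 0.069 * 6.79 := mul_le_mul hx2 hs1 (by linarith) (by norm_num)
  -- 4.4τ − 2τ² increases on the relevant range, so τ = 1 − t may be replaced by its upper bound
  -- x²s.
  have hfin : 0 ≤ (x ^ 2 * s - (1 - t)) * (4.4 - 2 * (x ^ 2 * s) - 2 * (1 - t)) :=
    mul_nonneg (by linarith) (by linarith)
  have hpoly : 4.4 * s - 2 * x ^ 2 * s ^ 2 + 2.5 ≤ 29 := by
    have h1 : (5.5 : ℝ) ^ 2 ≤ s ^ 2 := pow_le_pow_left₀ (by norm_num) hs0 2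
    have h2 := mul_le_mul_of_nonneg_left h1 (sq_nonneg x)
    have h3 : 4.4 * s = 24.2 + 14.52 * x + 26.4 * x ^ 2 := by rw [hs]; ring
    rw [h3]
    -- 0.213 is close to the maximiser of 14.52x − 34.1x².
    linarith [sq_nonneg (x - 0.213)]
  have := mul_le_mul_of_nonneg_left hpoly (sq_nonneg x)
  linarith

/-- The substitution x = √ε, m = √M, k = √κ makes everything polynomial. Since M is about 1/ε, m x
is about 1, so Mε² is of order x² and √M ε² of order x³; 29ε < 2 gives x ≤ 0.263. -/
lemma error_bound {ε y κ t : ℝ} {M : ℕ} (hε0 : 0 < ε) (hε1 : 29 * ε < 2) (hM : ε⁻¹ ≤ M)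
    (hM' : (M : ℝ) ≤ ε⁻¹ + 1) (hκ : (1 - ε) ^ 2 ≤ κ) (hκ1 : κ ≤ 1)
    (hh : y = ε ^ 2 * √M / (1 - ε)) (ht1 : t ≤ 1)
    (h : 1 + κ⁻¹ - 2 * t / √κ ≤ κ⁻¹ * (8 * ε + (1 - κ) + (M * ε ^ 2 + √M * ε ^ 2 + √M * ε ^ 2)) +
      ((1 + y) ^ 4 - 1)) :
    2 * (1 - t ^ 2) + 2 * t * √((t - t ^ 2) / M) ≤ 29 * ε := by
  have hM0 : (0 : ℝ) < M := (inv_pos.2 hε0).trans_le hM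
  have hκ0 : 0 < κ := lt_of_lt_of_le (pow_pos (by linarith) 2) hκ
  obtain ⟨x, hx0, rfl⟩ : ∃ x : ℝ, 0 < x ∧ x ^ 2 = ε :=
    ⟨√ε, Real.sqrt_pos.2 hε0, Real.sq_sqrt hε0.le⟩
  obtain ⟨m, hm0, hmM⟩ : ∃ m : ℝ, 0 < m ∧ m ^ 2 = (M : ℝ) :=
    ⟨√M, Real.sqrt_pos.2 hM0, Real.sq_sqrt hM0.le⟩
  have hsM : √(M : ℝ) = m := by rw [← hmM, Real.sqrt_sq hm0.le]
  obtain ⟨k, hk0, rfl⟩ : ∃ k : ℝ, 0 < k ∧ k ^ 2 = κ :=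
    ⟨√κ, Real.sqrt_pos.2 hκ0, Real.sq_sqrt hκ0.le⟩
  have hsk : √(k ^ 2) = k := Real.sqrt_sq hk0.le
  rw [hsM, hsk, ← hmM] at h
  rw [hsM] at hh
  rw [← hmM] at hM hM' ⊢
  have hx1 : x ≤ 0.263 := by
    refine (pow_le_pow_iff_left₀ hx0.le (by norm_num) two_ne_zero).1 ?_
    norm_num
    linarith
  have hx2 : x ^ 2 ≤ 0.069 := by linarith
  have hk1 : k ≤ 1 := (pow_le_one_iff_of_nonneg hk0.le two_ne_zero).1 hκ1
  have hk2 : 1 - x ^ 2 ≤ k := (pow_le_pow_iff_left₀ (by linarith) hk0.le two_ne_zero).1 hκ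
  have hp2 : (m * x) ^ 2 ≤ 1 + x ^ 2 := by
    have := mul_le_mul_of_nonneg_right hM' (sq_nonneg x)
    rw [add_mul, inv_mul_cancel₀ (by positivity), one_mul] at this
    linarith
  have hp1 : 1 ≤ (m * x) ^ 2 := by
    have := mul_le_mul_of_nonneg_right hM (sq_nonneg x)
    rw [inv_mul_cancel₀ (by positivity)] at this
    linarith
  have hp : m * x ≤ 1 + x ^ 2 / 2 := by
    refine (pow_le_pow_iff_left₀ (by positivity) (by positivity) two_ne_zero).1 ?_
    linarith [sq_nonneg (x ^ 2)]
  have hx3 : x ^ 3 ≤ 0.0182 := by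
    calc x ^ 3 = x ^ 2 * x := by ring
      _ ≤ 0.069 * 0.263 := mul_le_mul hx2 hx1 hx0.le (by norm_num)
      _ ≤ 0.0182 := by norm_num
  have h3 := mul_le_mul_of_nonneg_right hp (pow_nonneg hx0.le 3)
  obtain ⟨D, hD⟩ : ∃ D, D = 8 * x ^ 2 + (m ^ 2 * (x ^ 2) ^ 2 + m * (x ^ 2) ^ 2 + m * (x ^ 2) ^ 2) :=
    ⟨_, rfl⟩
  have hD0 : 0 ≤ D := by rw [hD]; positivity
  have hD1 : D ≤ 9 * x ^ 2 + 2 * x ^ 3 + x ^ 4 + x ^ 5 := by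
    have h1 := mul_le_mul_of_nonneg_right hp2 (sq_nonneg x)
    rw [hD]
    linarith
  have hy0 : 0 ≤ y := by rw [hh]; exact div_nonneg (by positivity) (by linarith)
  have hy1 : y ≤ 1.112 * x ^ 3 := by
    rw [hh, div_le_iff₀ (by linarith)]
    have h4 : (1 + x ^ 2 / 2) * x ^ 3 ≤ 1.112 * (1 - x ^ 2) * x ^ 3 :=
      mul_le_mul_of_nonneg_right (by linarith) (pow_nonneg hx0.le 3)
    linarith
  have hE1 := four_pow_sub_one_le hx3 hy0 hy1
  have hE0 : 0 ≤ (1 + y) ^ 4 - 1 := by linarith [one_le_pow₀ (by linarith : 1 ≤ 1 + y) (n := 4)]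
  refine final_error_le hx0 hx1 hx2 hm0 hp1 ht1
    (one_sub_overlap_le_poly hx0 hx1 hx2 hx3 hD1 hE1
      (one_sub_overlap_le hx2 hk0 hk1 hk2 hD0 hE0 ?_))
  have h1 := mul_le_mul_of_nonneg_left h (sq_nonneg k)
  have e1 : k ^ 2 * (1 + (k ^ 2)⁻¹ - 2 * t / k) = k ^ 2 + 1 - 2 * t * k := by
    field_simp
  have e2 : k ^ 2 * ((k ^ 2)⁻¹ * (8 * x ^ 2 + (1 - k ^ 2) +
      (m ^ 2 * (x ^ 2) ^ 2 + m * (x ^ 2) ^ 2 + m * (x ^ 2) ^ 2)) + ((1 + y) ^ 4 - 1)) =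
      D + (1 - k ^ 2) + k ^ 2 * ((1 + y) ^ 4 - 1) := by
    rw [mul_add, ← mul_assoc, mul_inv_cancel₀ (by positivity), hD]
    ring
  rw [e1, e2] at h1
  linarith

end Numerics

/-! ### The control state and its marginals -/

section ControlState

variable {a b c e ι κ : Type*} [Fintype a] [DecidableEq a] [Fintype b] [DecidableEq b]
  [Fintype c] [DecidableEq c] [Fintype e] [DecidableEq e] [Fintype ι] [DecidableEq ι]
  [Fintype κ] [DecidableEq κ]

/-- The amplitudes of a bipartite ket, with the second register as row index. -/
def ketMatrix (Ω : a × a → ℂ) : Matrix a a ℂ := fun x y => Ω (y, x)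

lemma frobSq_ketMatrix {Ω : a × a → ℂ} (hΩ : IsUnitKet Ω) : frobSq (ketMatrix Ω) = 1 := by
  rw [← hΩ, Fintype.sum_prod_type, Finset.sum_comm]
  rfl

lemma controlABE_eq_envState (U : Matrix (c × e) (a × b) ℂ) (Ω : a × a → ℂ) (Δ : b × b → ℂ) :
    controlABE U Ω Δ = envState (U * (ketMatrix Ω ⊗ₖ ketMatrix Δ)) := by
  have h : ∀ (p : (a × b) × e) (k : c), controlKet U Ω Δ (p, k) =
      (U * (ketMatrix Ω ⊗ₖ ketMatrix Δ)) (k, p.2) p.1 := by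
    intro p k
    rw [controlKet, Matrix.mul_apply, Fintype.sum_prod_type]
    rfl
  ext p q
  simp only [controlABE, traceSnd, ketbra, Matrix.vecMulVec_apply, envState, Pi.star_apply, h]
  rfl

lemma traceFst_margAE (X : Matrix ((a × b) × e) ((a × b) × e) ℂ) :
    traceFst (margAE X) = traceFst X := by
  ext k l
  simp only [traceFst, margAE, traceSnd, Matrix.submatrix_apply, Fintype.sum_prod_type]

lemma traceFst_margBE (X : Matrix ((a × b) × e) ((a × b) × e) ℂ) :
    traceFst (margBE X) = traceFst X := by
  ext k l
  simp only [traceFst, margBE, traceSnd, Matrix.submatrix_apply, Fintype.sum_prod_type]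
  exact Finset.sum_comm

lemma trace_traceFst (X : Matrix (ι × κ) (ι × κ) ℂ) : (traceFst X).trace = X.trace := by
  simp only [Matrix.trace, Matrix.diag_apply, traceFst, Fintype.sum_prod_type]
  exact Finset.sum_comm

lemma posSemidef_traceFst {X : Matrix (ι × κ) (ι × κ) ℂ} (hX : X.PosSemidef) :
    (traceFst X).PosSemidef :=
  posSemidef_traceSnd (hX.submatrix Prod.swap)

lemma traceSnd_margAE_envState (Z : Matrix (c × e) (a × b) ℂ) (i j : a) :
    traceSnd (margAE (envState Z)) i j = ∑ y, (Zᴴ * Z) (j, y) (i, y) := by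
  simp only [traceSnd, margAE, Matrix.submatrix_apply, envState, Matrix.mul_apply,
    Matrix.conjTranspose_apply, Fintype.sum_prod_type]
  rw [Finset.sum_comm]
  refine Finset.sum_congr rfl fun y _ => ?_
  rw [Finset.sum_comm]
  exact Finset.sum_congr rfl fun k _ => Finset.sum_congr rfl fun l _ => mul_comm _ _

lemma traceSnd_margBE_envState (Z : Matrix (c × e) (a × b) ℂ) (i j : b) :
    traceSnd (margBE (envState Z)) i j = ∑ y, (Zᴴ * Z) (y, j) (y, i) := by
  simp only [traceSnd, margBE, Matrix.submatrix_apply, envState, Matrix.mul_apply,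
    Matrix.conjTranspose_apply, Fintype.sum_prod_type]
  rw [Finset.sum_comm]
  refine Finset.sum_congr rfl fun y _ => ?_
  rw [Finset.sum_comm]
  exact Finset.sum_congr rfl fun k _ => Finset.sum_congr rfl fun l _ => mul_comm _ _

lemma gram_isometry_mul_kronecker {U : Matrix (c × e) (a × b) ℂ} (hU : Uᴴ * U = 1)
    (P : Matrix a a ℂ) (Q : Matrix b b ℂ) :
    (U * (P ⊗ₖ Q))ᴴ * (U * (P ⊗ₖ Q)) = (Pᴴ * P) ⊗ₖ (Qᴴ * Q) := by
  rw [Matrix.conjTranspose_mul, Matrix.mul_assoc, ← Matrix.mul_assoc Uᴴ, hU, Matrix.one_mul,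
    Matrix.conjTranspose_kronecker, Matrix.mul_kronecker_mul]

/-- U is an isometry and Δ is normalised, so the marginal on A is determined by Ω alone. -/
lemma controlA_eq {U : Matrix (c × e) (a × b) ℂ} (hU : Uᴴ * U = 1) (Ω : a × a → ℂ)
    {Δ : b × b → ℂ} (hΔ : IsUnitKet Δ) :
    controlA U Ω Δ = ((ketMatrix Ω)ᴴ * ketMatrix Ω)ᵀ := by
  have h : controlA U Ω Δ = traceSnd (margAE (controlABE U Ω Δ)) := rfl
  have h1 := trace_conjTranspose_mul_eq_frobSq (ketMatrix Δ)
  rw [frobSq_ketMatrix hΔ, Complex.ofReal_one] at h1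
  ext i j
  rw [h, controlABE_eq_envState, traceSnd_margAE_envState, gram_isometry_mul_kronecker hU]
  simp only [Matrix.kroneckerMap_apply]
  rw [← Finset.mul_sum]
  change _ * ((ketMatrix Δ)ᴴ * ketMatrix Δ).trace = _
  rw [h1, mul_one, Matrix.transpose_apply]

lemma controlB_eq {U : Matrix (c × e) (a × b) ℂ} (hU : Uᴴ * U = 1) {Ω : a × a → ℂ}
    (hΩ : IsUnitKet Ω) (Δ : b × b → ℂ) :
    controlB U Ω Δ = ((ketMatrix Δ)ᴴ * ketMatrix Δ)ᵀ := by
  have h : controlB U Ω Δ = traceSnd (margBE (controlABE U Ω Δ)) := rfl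
  have h1 := trace_conjTranspose_mul_eq_frobSq (ketMatrix Ω)
  rw [frobSq_ketMatrix hΩ, Complex.ofReal_one] at h1
  ext i j
  rw [h, controlABE_eq_envState, traceSnd_margBE_envState, gram_isometry_mul_kronecker hU]
  simp only [Matrix.kroneckerMap_apply]
  rw [← Finset.sum_mul]
  change ((ketMatrix Ω)ᴴ * ketMatrix Ω).trace * _ = _
  rw [h1, one_mul, Matrix.transpose_apply]

end ControlState

/-! ### Consequences of the entropy conditions -/

section Entropies

variable {a ι κ : Type*} [Fintype a] [DecidableEq a] [Fintype ι] [DecidableEq ι]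
  [Fintype κ] [DecidableEq κ]

/-- The norm inside the divergence is that of the smoothed state stripped of its weights θ^{1/4},
which is the form used in decoupling. -/
lemma exists_weighted_of_lt_smoothCondH2 {ε x : ℝ} (hε : 0 < ε)
    {ρ : Matrix (ι × κ) (ι × κ) ℂ} (hρ1 : ρ.trace.re = 1) {θ : Matrix κ κ ℂ} (hθ : θ.PosSemidef)
    (hρθ : traceFst ρ = θ)
    (h : (x : EReal) < smoothCondH2 ε ρ - ((Real.logb 2 (ε ^ (-4 : ℤ)) : ℝ) : EReal)) :
    ∃ T : Matrix (ι × κ) (ι × κ) ℂ, T.IsHermitian ∧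
      traceNorm (((1 : Matrix ι ι ℂ) ⊗ₖ cfc (fun x : ℝ => x ^ (1 / 4 : ℝ)) θ) * T *
        ((1 : Matrix ι ι ℂ) ⊗ₖ cfc (fun x : ℝ => x ^ (1 / 4 : ℝ)) θ) - ρ) ≤ ε ∧
      (2 : ℝ) ^ x * frobSq T ≤ ε ^ 4 := by
  obtain ⟨α, hα, hαρ, hs, hle⟩ := exists_of_lt_neg_smoothRenyiTwoDiv hε h
  rw [hρθ] at hs hle
  rw [hρ1, mul_one] at hαρ
  obtain ⟨T, hT, rfl, hfrob⟩ := exists_weighted_factor hθ hα.1.isHermitian hs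
  rw [hfrob, sq_frob] at hle
  exact ⟨T, hT, hαρ, hle⟩

lemma frobSq_transpose {m n : Type*} [Fintype m] [Fintype n] (X : Matrix m n ℂ) :
    frobSq Xᵀ = frobSq X := by
  rw [frobSq, Finset.sum_comm]
  rfl

lemma pinvFourthRoot_one : pinvFourthRoot (1 : Matrix a a ℂ) = 1 := by
  rw [pinvFourthRoot, cfc_apply_one, Real.one_rpow, map_one]

/-- A smoothing of the input state of one sender is realised by a contraction on the sender's
reference. -/
lemma exists_contraction_of_lt_smoothH2 {ε x : ℝ} (hε : 0 < ε) {Z : Matrix a a ℂ}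
    (hZ : frobSq Z = 1)
    (h : (x : EReal) < smoothH2 ε (Zᴴ * Z)ᵀ - ((Real.logb 2 (ε ^ (-4 : ℤ)) : ℝ) : EReal)) :
    ∃ K : Matrix a a ℂ, IsContraction K ∧ 1 - ε ≤ frobSq (Z * Kᵀ) ∧ frobSq (Z * Kᵀ) ≤ 1 ∧
      (2 : ℝ) ^ x * frobSq ((Z * Kᵀ)ᴴ * (Z * Kᵀ)) ≤ ε ^ 4 := by
  have hρ : ((Zᴴ * Z)ᵀ).PosSemidef := (Matrix.posSemidef_conjTranspose_mul_self Z).transpose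
  have hρ1 : ((Zᴴ * Z)ᵀ).trace.re = 1 := by
    rw [Matrix.trace_transpose, trace_conjTranspose_mul_eq_frobSq, Complex.ofReal_re, hZ]
  obtain ⟨α, hα, hαρ, -, hle⟩ := exists_of_lt_neg_smoothRenyiTwoDiv hε h
  rw [hρ1, mul_one] at hαρ
  rw [pinvFourthRoot_one, Matrix.one_mul, Matrix.mul_one, schattenTwo,
    trace_conjTranspose_mul_eq_frobSq, Complex.ofReal_re, Real.sq_sqrt (frobSq_nonneg _)] at hle
  obtain ⟨K, hK, hKK, htr, hfr⟩ := exists_truncation hρ hρ1 hα.1 hαρ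
  have hgram : (Z * Kᵀ)ᴴ * (Z * Kᵀ) = (K * (Zᴴ * Z)ᵀ * K)ᵀ := by
    have : Kᵀᴴ = Kᵀ := hK.transpose
    rw [Matrix.conjTranspose_mul, this, Matrix.transpose_mul, Matrix.transpose_mul,
      Matrix.transpose_transpose]
    simp only [Matrix.mul_assoc]
  have hcon : IsContraction K := by rw [IsContraction, hK.eq]; exact hKK
  have hfrob : frobSq (Z * Kᵀ) = (K * (Zᴴ * Z)ᵀ * K).trace.re := by
    rw [← Matrix.trace_transpose, ← hgram, trace_conjTranspose_mul_eq_frobSq, Complex.ofReal_re]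
  refine ⟨K, hcon, hfrob ▸ htr, ?_, ?_⟩
  · have := hcon.re_trace_conj_le hρ
    rw [hfrob, ← hρ1]
    rwa [hK.eq] at this
  · rw [hgram, frobSq_transpose]
    exact (mul_le_mul_of_nonneg_left hfr (by positivity)).trans hle

/-- Cauchy–Schwarz against the identity: the collision entropy is bounded by the logarithm of the
dimension. -/
lemma sq_frobSq_le (A : Matrix a a ℂ) :
    frobSq A ^ 2 ≤ Fintype.card a * frobSq (Aᴴ * A) := by
  have h := re_trace_mul_conjTranspose_le (Aᴴ * A) 1
  have h1 : frobSq (1 : Matrix a a ℂ) = Fintype.card a := by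
    have := trace_conjTranspose_mul_eq_frobSq (1 : Matrix a a ℂ)
    rw [Matrix.conjTranspose_one, Matrix.one_mul, Matrix.trace_one] at this
    exact_mod_cast this.symm
  rw [Matrix.conjTranspose_one, Matrix.mul_one, trace_conjTranspose_mul_eq_frobSq,
    Complex.ofReal_re] at h
  have h2 := pow_le_pow_left₀ (frobSq_nonneg A) h 2
  rw [mul_pow, sq_frob, sq_frob, h1, mul_comm] at h2
  exact h2

end Entropies

/-! ### Dimensions of the enlarged code -/

section Rates

variable {a : Type*} [Fintype a] [DecidableEq a] {Q E M : ℕ} {ε : ℝ}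

lemma card_code : (Fintype.card ((Qubits Q × Fin M) × Qubits E) : ℝ) = M * 2 ^ (Q + E : ℝ) := by
  rw [Real.rpow_add two_pos, Real.rpow_natCast, Real.rpow_natCast]
  simp [Qubits]
  ring

lemma card_code_mul_le {A : Matrix a a ℂ} (h : (2 : ℝ) ^ (Q + E : ℝ) * frobSq (Aᴴ * A) ≤ ε ^ 4) :
    Fintype.card ((Qubits Q × Fin M) × Qubits E) * frobSq (Aᴴ * A) ≤ M * ε ^ 4 := by
  rw [card_code, mul_assoc]
  exact mul_le_mul_of_nonneg_left h (Nat.cast_nonneg M)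

/-- The enlarged code still fits into the channel input: the ε⁴ in the rate condition pays for the
factor M, because Mε⁴ ≤ (1 − ε)² ≤ ‖A‖⁴ ≤ |a| ‖AᴴA‖². -/
lemma card_code_le {A : Matrix a a ℂ} (hε0 : 0 < ε) (hε1 : 29 * ε < 2)
    (hM : (M : ℝ) ≤ ε⁻¹ + 1) (hA : 1 - ε ≤ frobSq A)
    (h : (2 : ℝ) ^ (Q + E : ℝ) * frobSq (Aᴴ * A) ≤ ε ^ 4) :
    Fintype.card ((Qubits Q × Fin M) × Qubits E) ≤ Fintype.card a := by
  have h1 : (M : ℝ) * ε ^ 4 ≤ frobSq A ^ 2 := by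
    have e1 : (M : ℝ) * ε ^ 4 ≤ (ε⁻¹ + 1) * ε ^ 4 :=
      mul_le_mul_of_nonneg_right hM (by positivity)
    have e2 : (ε⁻¹ + 1) * ε ^ 4 = ε ^ 3 + ε ^ 4 := by field_simp
    have e3 : ε ^ 3 ≤ ε := pow_le_of_le_one hε0.le (by linarith) (by norm_num)
    have e4 : ε ^ 4 ≤ ε := pow_le_of_le_one hε0.le (by linarith) (by norm_num)
    have e5 : (1 - ε) ^ 2 ≤ frobSq A ^ 2 := pow_le_pow_left₀ (by linarith) hA 2
    linarith [sq_nonneg ε]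
  have hA0 : 0 < frobSq A := by linarith
  have h2 := sq_frobSq_le A
  have hG : 0 < frobSq (Aᴴ * A) := by
    by_contra hG
    have : frobSq (Aᴴ * A) = 0 := le_antisymm (not_lt.1 hG) (frobSq_nonneg _)
    rw [this, mul_zero] at h2
    exact absurd h2 (not_le.2 (by positivity))
  have h3 := ((card_code_mul_le (M := M) h).trans h1).trans h2
  exact_mod_cast le_of_mul_le_mul_right h3 hG

lemma sqrt_mul_le {m X : ℝ} (hm : 0 ≤ m) (hX : X ≤ ε ^ 4) : √(m * X) ≤ √m * ε ^ 2 := by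
  rw [Real.sqrt_mul hm]
  refine mul_le_mul_of_nonneg_left ?_ (Real.sqrt_nonneg _)
  rw [Real.sqrt_le_left (by positivity)]
  linarith

lemma sqrt_single_rate_le {X : ℝ} (h : (2 : ℝ) ^ (Q - E : ℝ) * X ≤ ε ^ 4) :
    √(Fintype.card (Qubits Q × Fin M) * ((Fintype.card (Qubits E) : ℝ)⁻¹ * X)) ≤ √M * ε ^ 2 := by
  refine le_trans (le_of_eq ?_) (sqrt_mul_le (Nat.cast_nonneg M) h)
  rw [Real.rpow_sub two_pos, Real.rpow_natCast, Real.rpow_natCast]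
  congr 1
  simp [Qubits]
  ring

/-- Both message spaces are enlarged, so M² stands under the root; for M near 1/ε the result is of
order ε. -/
lemma sqrt_joint_rate_le {Q' E' : ℕ} {X : ℝ}
    (h : (2 : ℝ) ^ (Q - E + Q' - E' : ℝ) * X ≤ ε ^ 4) :
    √((Fintype.card (Qubits Q × Fin M) * Fintype.card (Qubits Q' × Fin M)) *
      ((Fintype.card (Qubits E) * Fintype.card (Qubits E') : ℝ)⁻¹ * X)) ≤ M * ε ^ 2 := by
  have hM := sqrt_mul_le (m := (M : ℝ) ^ 2) (by positivity) h
  rw [Real.sqrt_sq (Nat.cast_nonneg M)] at hM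
  refine le_trans (le_of_eq ?_) hM
  rw [Real.rpow_sub two_pos, Real.rpow_add two_pos, Real.rpow_sub two_pos, Real.rpow_natCast,
    Real.rpow_natCast, Real.rpow_natCast, Real.rpow_natCast]
  congr 1
  simp [Qubits]
  ring

end Rates

/-! ### Assembly of the coding theorem -/

section Coding

variable {a b c e : Type*} [Fintype a] [DecidableEq a] [Fintype b] [DecidableEq b]
  [Fintype c] [DecidableEq c] [Fintype e] [DecidableEq e] {QA EA QB EB : ℕ}

lemma localConj_envState (KA : Matrix a a ℂ) (KB : Matrix b b ℂ) (U : Matrix (c × e) (a × b) ℂ)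
    (P : Matrix a a ℂ) (Q : Matrix b b ℂ) :
    localConj KA KB (envState (U * (P ⊗ₖ Q))) = envState (U * ((P * KAᵀ) ⊗ₖ (Q * KBᵀ))) := by
  rw [localConj, conj_envState, Matrix.mul_assoc, Matrix.mul_kronecker_mul]
  rfl

lemma IsAchievable.mono {N : Matrix (a × b) (a × b) ℂ →ₗ[ℂ] Matrix c c ℂ} {δ δ' : ℝ}
    (h : IsAchievable N δ QA EA QB EB) (hδ : δ ≤ δ') : IsAchievable N δ' QA EA QB EB := by
  obtain ⟨VA, VB, D, h1, h2, h3, h4⟩ := h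
  exact ⟨VA, VB, D, h1, h2, h3, h4.trans hδ⟩

lemma trace_margAE (X : Matrix ((a × b) × e) ((a × b) × e) ℂ) : (margAE X).trace = X.trace := by
  rw [← trace_traceFst, traceFst_margAE, trace_traceFst]

lemma trace_margBE (X : Matrix ((a × b) × e) ((a × b) × e) ℂ) : (margBE X).trace = X.trace := by
  rw [← trace_traceFst, traceFst_margBE, trace_traceFst]

/-- Coding for small smoothing parameters. -/
theorem isAchievable_of_small {ε : ℝ} (hε0 : 0 < ε) (hε1 : 29 * ε < 2)
    {N : Matrix (a × b) (a × b) ℂ →ₗ[ℂ] Matrix c c ℂ}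
    {U : Matrix (c × e) (a × b) ℂ} (hU : IsStinespring N U)
    {Ω : a × a → ℂ} (hΩ : IsUnitKet Ω) {Δ : b × b → ℂ} (hΔ : IsUnitKet Δ)
    (hAB : (((QA : ℝ) - EA + QB - EB : ℝ) : EReal) <
      smoothCondH2 ε (controlABE U Ω Δ) - ((Real.logb 2 (ε ^ (-4 : ℤ)) : ℝ) : EReal))
    (hA : (((QA : ℝ) - EA : ℝ) : EReal) <
      smoothCondH2 ε (controlAE U Ω Δ) - ((Real.logb 2 (ε ^ (-4 : ℤ)) : ℝ) : EReal))
    (hB : (((QB : ℝ) - EB : ℝ) : EReal) <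
      smoothCondH2 ε (controlBE U Ω Δ) - ((Real.logb 2 (ε ^ (-4 : ℤ)) : ℝ) : EReal))
    (hA' : (((QA : ℝ) + EA : ℝ) : EReal) <
      smoothH2 ε (controlA U Ω Δ) - ((Real.logb 2 (ε ^ (-4 : ℤ)) : ℝ) : EReal))
    (hB' : (((QB : ℝ) + EB : ℝ) : EReal) <
      smoothH2 ε (controlB U Ω Δ) - ((Real.logb 2 (ε ^ (-4 : ℤ)) : ℝ) : EReal)) :
    IsAchievable N (29 * ε) QA EA QB EB := by
  have hU1 : Uᴴ * U = 1 := hU.1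
  rw [controlA_eq hU1 Ω hΔ] at hA'
  rw [controlB_eq hU1 hΩ Δ] at hB'
  change _ < smoothCondH2 ε (margAE (controlABE U Ω Δ)) - _ at hA
  change _ < smoothCondH2 ε (margBE (controlABE U Ω Δ)) - _ at hB
  have hΩ1 := frobSq_ketMatrix hΩ
  have hΔ1 := frobSq_ketMatrix hΔ
  rw [controlABE_eq_envState] at hAB hA hB
  generalize ketMatrix Ω = P at *
  generalize ketMatrix Δ = R at *
  obtain ⟨ρ, hρdef⟩ : ∃ ρ, ρ = envState (U * (P ⊗ₖ R)) := ⟨_, rfl⟩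
  rw [← hρdef] at hAB hA hB
  have hρ : ρ.PosSemidef := hρdef ▸ posSemidef_envState _
  have hρ1 : ρ.trace = 1 := by
    rw [hρdef, trace_envState, frobSq_isometry_mul hU1, frobSq_kronecker, hΩ1, hΔ1]
    simp
  have hρ1' : ρ.trace.re = 1 := by rw [hρ1, Complex.one_re]
  have hθ := posSemidef_traceFst hρ
  have hθ1 : (traceFst ρ).trace = 1 := by rw [trace_traceFst, hρ1]
  obtain ⟨T, hT, hTρ, hTle⟩ := exists_weighted_of_lt_smoothCondH2 hε0 hρ1' hθ rfl hAB
  obtain ⟨TA, hTA, hTAρ, hTAle⟩ := exists_weighted_of_lt_smoothCondH2 hε0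
    (by rw [trace_margAE, hρ1']) hθ (traceFst_margAE ρ) hA
  obtain ⟨TB, hTB, hTBρ, hTBle⟩ := exists_weighted_of_lt_smoothCondH2 hε0
    (by rw [trace_margBE, hρ1']) hθ (traceFst_margBE ρ) hB
  obtain ⟨KA, hKA, hA0, hA1, hAle⟩ := exists_contraction_of_lt_smoothH2 hε0 hΩ1 hA'
  obtain ⟨KB, hKB, hB0, hB1, hBle⟩ := exists_contraction_of_lt_smoothH2 hε0 hΔ1 hB'
  -- Truncating the references amounts to truncating the amplitude matrices; the encoders are built
  -- from these truncated amplitudes.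
  have hloc : localConj KA KB ρ = envState (U * ((P * KAᵀ) ⊗ₖ (R * KBᵀ))) := by
    rw [hρdef, localConj_envState]
  generalize P * KAᵀ = A at *
  generalize R * KBᵀ = B at *
  have htr : (localConj KA KB ρ).trace.re = frobSq A * frobSq B := by
    rw [hloc, trace_envState, frobSq_isometry_mul hU1, frobSq_kronecker, Complex.ofReal_re]
  have hε2 : 0 < 1 - ε := by linarith
  -- M ≥ 1/ε makes the subcode fluctuation √((t − t²)/M) of order ε, while M ≤ 1/ε + 1 keeps the
  -- joint decoupling term Mε² of order ε.
  obtain ⟨M, hM, hM'⟩ : ∃ M : ℕ, ε⁻¹ ≤ M ∧ (M : ℝ) ≤ ε⁻¹ + 1 :=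
    ⟨⌈ε⁻¹⌉₊, Nat.le_ceil _, (Nat.ceil_lt_add_one (inv_nonneg.2 hε0.le)).le⟩
  have hM0 : 0 < M := by
    have : (0 : ℝ) < M := (inv_pos.2 hε0).trans_le hM
    exact_mod_cast this
  have : NeZero M := ⟨hM0.ne'⟩
  -- Chosen so that h²(1 − ε)² = Mε⁴, as the Gram matrix estimate for the encoders requires.
  obtain ⟨h, hh⟩ : ∃ h, h = ε ^ 2 * √M / (1 - ε) := ⟨_, rfl⟩
  have hh0 : 0 ≤ h := by rw [hh]; positivity
  have hgram : ∀ {z : ℝ}, 1 - ε ≤ z → M * ε ^ 4 ≤ h ^ 2 * z ^ 2 := fun {z} hz => by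
    have h1 : (M : ℝ) * ε ^ 4 = h ^ 2 * (1 - ε) ^ 2 := by
      rw [hh, div_pow, div_mul_cancel₀ _ (by positivity), mul_pow,
        Real.sq_sqrt (Nat.cast_nonneg M)]
      ring
    rw [h1]
    exact mul_le_mul_of_nonneg_left (pow_le_pow_left₀ hε2.le hz 2) (sq_nonneg h)
  have hdec := expect_traceNorm_decoupling_le (r := Qubits QA × Fin M) (s := Qubits QB × Fin M)
    (f := Qubits EA) (g := Qubits EB) hρ hρ1' hKA hKB hθ (by rw [hθ1, Complex.one_re]) hT hTA hTB
    hTρ hTAρ hTBρ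
  rw [htr, hloc, lift_kerBar] at hdec
  replace hdec := hdec.trans (add_le_add le_rfl (add_le_add (add_le_add (sqrt_joint_rate_le hTle)
    (sqrt_single_rate_le hTAle)) (sqrt_single_rate_le hTBle)))
  have hζ : ((Fintype.card ((Qubits QA × Fin M) × (Qubits QB × Fin M)) : ℂ)⁻¹ •
      ((1 : Matrix ((Qubits QA × Fin M) × (Qubits QB × Fin M)) _ ℂ) ⊗ₖ traceFst ρ)).IsHermitian := by
    rw [← lift_kerBar]
    exact (isCP_kerBar.posSemidef_lift hρ).isHermitian
  obtain ⟨WA, WB, hWA, hWB, hΨ⟩ := exists_encoders hU1 (hε2.trans_le hA0) (hε2.trans_le hB0) hh0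
    (card_code_le hε0 hε1 hM' hA0 hAle) (card_code_le hε0 hε1 hM' hB0 hBle)
    ((card_code_mul_le hAle).trans (hgram hA0)) ((card_code_mul_le hBle).trans (hgram hB0)) hζ hdec
  obtain ⟨t, ht0, ht1, hlow, VA, VB, D, hVA, hVB, hD, hfin⟩ :=
    exists_subcode hU1 hM0 hWA hWB rfl hθ hθ1
  have hκ0 : 0 < frobSq A * frobSq B := mul_pos (hε2.trans_le hA0) (hε2.trans_le hB0)
  refine (isAchievable_of_kraus hU hVA hVB hD hfin).mono
    (error_bound hε0 hε1 hM hM' ?_ ?_ hh ht1 ((hlow _ hκ0).trans (hΨ _ rfl)))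
  · rw [sq]
    exact mul_le_mul hA0 hB0 hε2.le (hε2.le.trans hA0)
  · exact mul_le_one₀ hA1 (frobSq_nonneg _) hB1

end Coding

end

end QMAC

open QMAC in
theorem mainTheorem6 {a b c e : Type*}
    [Fintype a] [DecidableEq a] [Fintype b] [DecidableEq b]
    [Fintype c] [Fintype e] [DecidableEq e]
    (ε : ℝ) (hε0 : 0 < ε) (hε1 : ε < 1)
    (N : Matrix (a × b) (a × b) ℂ →ₗ[ℂ] Matrix c c ℂ) (hN : IsChannel N)
    (U : Matrix (c × e) (a × b) ℂ) (hU : IsStinespring N U)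
    (Ω : a × a → ℂ) (hΩ : IsUnitKet Ω) (Δ : b × b → ℂ) (hΔ : IsUnitKet Δ)
    (QA EA QB EB : ℕ)
    (hdimA : 2 ^ (QA + EA) ≤ Fintype.card a) (hdimB : 2 ^ (QB + EB) ≤ Fintype.card b)
    (hAB : (((QA : ℝ) - EA + QB - EB : ℝ) : EReal) <
      smoothCondH2 ε (controlABE U Ω Δ) - ((Real.logb 2 (ε ^ (-4 : ℤ)) : ℝ) : EReal))
    (hA : (((QA : ℝ) - EA : ℝ) : EReal) <
      smoothCondH2 ε (controlAE U Ω Δ) - ((Real.logb 2 (ε ^ (-4 : ℤ)) : ℝ) : EReal))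
    (hB : (((QB : ℝ) - EB : ℝ) : EReal) <
      smoothCondH2 ε (controlBE U Ω Δ) - ((Real.logb 2 (ε ^ (-4 : ℤ)) : ℝ) : EReal))
    (hA' : (((QA : ℝ) + EA : ℝ) : EReal) <
      smoothH2 ε (controlA U Ω Δ) - ((Real.logb 2 (ε ^ (-4 : ℤ)) : ℝ) : EReal))
    (hB' : (((QB : ℝ) + EB : ℝ) : EReal) <
      smoothH2 ε (controlB U Ω Δ) - ((Real.logb 2 (ε ^ (-4 : ℤ)) : ℝ) : EReal)) :
    IsAchievable N (29 * ε) QA EA QB EB := by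
  classical
  -- For 29ε ≥ 2 the permitted error is at least the maximal distance of two states, and any
  -- isometric encoders will do.
  rcases lt_or_ge (29 * ε) 2 with h | h
  · exact isAchievable_of_small hε0 h hU hΩ hΔ hAB hA hB hA' hB'
  · exact (isAchievable_two hU hdimA hdimB).mono h
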